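/- **Counting dominating sets on tree decompositions.** The model of computation is the random access machine with $w$-bit words: a program is a fixed finite object; arithmetic (addition, subtraction, multiplication modulo $2^w$), bitwise operations, shifts, comparisons of words, and accesses to registers and to memory cells addressed by words all take one step. An $n$-bit number is stored in $\lceil n/w\rceil$ words, in base $2^w$. Let $i_\times(n)=i_\times(w,n)$ be a bound on the time required to multiply two $n$-bit numbers on this machine, i.e. let there be a procedure for this machine and a constant $c_0$ such that, for all $n\ge 1$ and all $w\ge c_0(1+\lfloor\log_2 n\rfloor)$, the procedure multiplies any two $n$-bit numbers in at most $i_\times(w,n)$ steps (whatever the memory contains apart from its arguments). A *tree decomposition* of a graph $G=(V,E)$ is a tree $T$ with a bag $X_x\subseteq V$ for each node $x$ such that every vertex lies in some bag, both ends of every edge lie in a common bag, and if $v\in X_x\cap X_y$ then $v\in X_z$ for all $z$ on the path from $x$ to $y$ in $T$. Its *width* is $\max_x|X_x|-1$. A set $D\subseteq V$ is *dominating* if every vertex of $V\setminus D$ has a neighbour in $D$. **Theorem.** There is an algorithm that, given a graph $G$ on $n\ge 1$ vertices and a tree decomposition of $G$ of width $k$ with $O(n)$ nodes, computes for every $\kappa$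 with $0\le\kappa\le n$ the number of dominating sets of $G$ of size exactly $\kappa$, in $O(n^3\,3^k\,i_\times(n))$ time. Explicitly: there is a program $P$ such that for every $a$ there are constants $C$ and $c$ such that, for every graph $G$ on $n\ge1$ vertices, every tree decomposition of $G$ of width $k$ with at most $a\,n$ nodes, and every word length $w\ge c\,(k+1+\lfloor\log_2 n\rfloor)$, the program $P$ on the $w$-bit machine, started with $n$, the number of nodes, the adjacency matrices of $G$ and of the tree, and the incidence matrix of nodes and bag vertices in its memory, halts after at most $C\,n^3\,3^k\,i_\times(w,n)$ steps with all these $n+1$ numbers written, as $n$-bit numbers, to its output array. -/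

import Mathlib

/-! ## Graphs: dominating sets and tree decompositions -/

/-- `D` is a dominating set of `G`: every vertex outside `D` has a neighbour in `D`. -/
def IsDominatingSet {V : Type*} (G : SimpleGraph V) (D : Finset V) : Prop :=
  ∀ v, v ∉ D → ∃ d ∈ D, G.Adj v d

/-- The number of dominating sets of `G` that have exactly `κ` elements. -/
noncomputable def numDominatingSets {V : Type*} [Finite V] (G : SimpleGraph V) (κ : ℕ) : ℕ :=
  Set.ncard {D : Finset V | D.card = κ ∧ IsDominatingSet G D}

/-- A tree decomposition of `G` whose tree has node set `ι`. -/
structure TreeDecomposition {V : Type*} (G : SimpleGraph V) (ι : Type*) where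
  tree : SimpleGraph ι
  isTree : tree.IsTree
  bag : ι → Finset V
  exists_mem_bag : ∀ v, ∃ x, v ∈ bag x
  exists_adj_mem_bag : ∀ u v, G.Adj u v → ∃ x, u ∈ bag x ∧ v ∈ bag x
  mem_bag_of_path : ∀ (v : V) (x y : ι) (p : tree.Walk x y), p.IsPath →
    v ∈ bag x → v ∈ bag y → ∀ z ∈ p.support, v ∈ bag z

/-- The width: the size of a largest bag minus one (the subtraction is a true one as soon as
`G` has a vertex, since then some bag is nonempty). -/
def TreeDecomposition.width {V ι : Type*} [Fintype ι] {G : SimpleGraph V}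
    (D : TreeDecomposition G ι) : ℕ :=
  (Finset.univ.sup fun x => (D.bag x).card) - 1

/-! ## The random access machine with `w`-bit words

Programs are fixed finite objects (they depend neither on the input nor on `w`).  They act on
word registers and on word arrays; an array has one cell for every `w`-bit address.  Every
operation on words, every register or memory access and every test takes one step. -/

namespace WordRAM

/-- The operations on words. -/
inductive Op where
  | add | sub | mul | and | or | xor | shl | shr | lt | eq

/-- Expressions: literals, the word length of the machine, registers, memory cells `A_a[i]`,
and operations on words. -/
inductive Expr where
  | lit (c : ℕ)
  | wordLength
  | reg (x : ℕ)
  | load (a : ℕ) (i : Expr)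
  | op (o : Op) (e f : Expr)

/-- Programs. `loop e p` repeats `p` as long as `e` is nonzero. -/
inductive Program where
  | skip
  | assign (x : ℕ) (e : Expr)
  | store (a : ℕ) (i e : Expr)
  | seq (p q : Program)
  | ite (e : Expr) (p q : Program)
  | loop (e : Expr) (p : Program)

/-- The contents of the registers and of the arrays. -/
structure State (w : ℕ) where
  reg : ℕ → BitVec w
  mem : ℕ → BitVec w → BitVec w

/-- Arithmetic is modulo `2 ^ w`, comparisons are unsigned and yield `0` or `1`. -/
def Op.eval {w : ℕ} : Op → BitVec w → BitVec w → BitVec w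
  | .add, x, y => x + y
  | .sub, x, y => x - y
  | .mul, x, y => x * y
  | .and, x, y => x &&& y
  | .or, x, y => x ||| y
  | .xor, x, y => x ^^^ y
  | .shl, x, y => x <<< y.toNat
  | .shr, x, y => x >>> y.toNat
  | .lt, x, y => if x.toNat < y.toNat then BitVec.ofNat w 1 else BitVec.ofNat w 0
  | .eq, x, y => if x = y then BitVec.ofNat w 1 else BitVec.ofNat w 0

def Expr.eval {w : ℕ} (σ : State w) : Expr → BitVec w
  | .lit c => BitVec.ofNat w c
  | .wordLength => BitVec.ofNat w w
  | .reg x => σ.reg x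
  | .load a i => σ.mem a (i.eval σ)
  | .op o e f => o.eval (e.eval σ) (f.eval σ)

/-- The number of steps that the evaluation of an expression takes. -/
def Expr.cost : Expr → ℕ
  | .lit _ => 1
  | .wordLength => 1
  | .reg _ => 1
  | .load _ i => i.cost + 1
  | .op _ e f => e.cost + f.cost + 1

def State.setReg {w : ℕ} (σ : State w) (x : ℕ) (v : BitVec w) : State w where
  reg := Function.update σ.reg x v
  mem := σ.mem

def State.setMem {w : ℕ} (σ : State w) (a : ℕ) (i v : BitVec w) : State w where
  reg := σ.reg
  mem := Function.update σ.mem a (Function.update (σ.mem a) i v)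

/-- `Run p σ σ' t`: the program `p`, started in `σ`, halts in `σ'` after exactly `t` steps. -/
inductive Run {w : ℕ} : Program → State w → State w → ℕ → Prop where
  | skip (σ : State w) : Run .skip σ σ 1
  | assign (σ : State w) (x : ℕ) (e : Expr) :
      Run (.assign x e) σ (σ.setReg x (e.eval σ)) (e.cost + 1)
  | store (σ : State w) (a : ℕ) (i e : Expr) :
      Run (.store a i e) σ (σ.setMem a (i.eval σ) (e.eval σ)) (i.cost + e.cost + 1)
  | seq {p q : Program} {σ₁ σ₂ σ₃ : State w} {s t : ℕ} :
      Run p σ₁ σ₂ s → Run q σ₂ σ₃ t → Run (.seq p q) σ₁ σ₃ (s + t)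
  | ite_true {e : Expr} {p q : Program} {σ₁ σ₂ : State w} {t : ℕ} :
      e.eval σ₁ ≠ BitVec.ofNat w 0 → Run p σ₁ σ₂ t → Run (.ite e p q) σ₁ σ₂ (e.cost + 1 + t)
  | ite_false {e : Expr} {p q : Program} {σ₁ σ₂ : State w} {t : ℕ} :
      e.eval σ₁ = BitVec.ofNat w 0 → Run q σ₁ σ₂ t → Run (.ite e p q) σ₁ σ₂ (e.cost + 1 + t)
  | loop_done {e : Expr} {p : Program} {σ : State w} :
      e.eval σ = BitVec.ofNat w 0 → Run (.loop e p) σ σ (e.cost + 1)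
  | loop_step {e : Expr} {p : Program} {σ₁ σ₂ σ₃ : State w} {s t : ℕ} :
      e.eval σ₁ ≠ BitVec.ofNat w 0 → Run p σ₁ σ₂ s → Run (.loop e p) σ₂ σ₃ t →
      Run (.loop e p) σ₁ σ₃ (e.cost + 1 + s + t)

/-- The number `⌈n / w⌉` of `w`-bit words that an `n`-bit number occupies. -/
def numWords (w n : ℕ) : ℕ := (n + w - 1) / w

/-- The `len` cells of array `a` from address `off` on hold the natural number `x` in base
`2 ^ w`, least significant word first. -/
def State.Stores {w : ℕ} (σ : State w) (a off len x : ℕ) : Prop :=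
  x < 2 ^ (w * len) ∧
    ∀ j < len, σ.mem a (BitVec.ofNat w (off + j)) = BitVec.ofNat w (x / 2 ^ (w * j))

/-- `τ w n` bounds the time required to multiply `n`-bit numbers on the machine with `w`-bit
words: there is a procedure that, whenever words are long enough to address the operands
(`w ≥ c * (⌊log₂ n⌋ + 1)`), finds `n` in register `0` and the two operands in arrays `0` and `1`,
and leaves their product in array `2` after at most `τ w n` steps, whatever the other registers
and cells contain when it is called. -/
def IsMultiplicationTime (τ : ℕ → ℕ → ℕ) : Prop :=
  ∃ (M : Program) (c : ℕ), ∀ (w n x y : ℕ) (σ : State w),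
    0 < n → c * (Nat.log 2 n + 1) ≤ w → x < 2 ^ n → y < 2 ^ n →
    σ.reg 0 = BitVec.ofNat w n →
    σ.Stores 0 0 (numWords w n) x → σ.Stores 1 0 (numWords w n) y →
    ∃ (σ' : State w) (t : ℕ), Run M σ σ' t ∧ t ≤ τ w n ∧
      σ'.Stores 2 0 (2 * numWords w n) (x * y)

open Classical in
/-- `σ` contains the graph `G` on `n` vertices and its tree decomposition `D` with `N` nodes:
`n` and `N` are in registers `0` and `1`, and arrays `0`, `1`, `2` hold, row by row, the adjacency
matrix of `G`, the adjacency matrix of the tree, and the incidence matrix of nodes and vertices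
in bags. All other registers and cells are arbitrary. -/
structure State.Encodes {w n N : ℕ} (σ : State w) (G : SimpleGraph (Fin n))
    (D : TreeDecomposition G (Fin N)) : Prop where
  numVertices : σ.reg 0 = BitVec.ofNat w n
  numNodes : σ.reg 1 = BitVec.ofNat w N
  graph : ∀ u v : Fin n,
    σ.mem 0 (BitVec.ofNat w (u * n + v)) = BitVec.ofNat w (if G.Adj u v then 1 else 0)
  tree : ∀ x y : Fin N,
    σ.mem 1 (BitVec.ofNat w (x * N + y)) = BitVec.ofNat w (if D.tree.Adj x y then 1 else 0)
  bags : ∀ (x : Fin N) (v : Fin n),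
    σ.mem 2 (BitVec.ofNat w (x * n + v)) = BitVec.ofNat w (if v ∈ D.bag x then 1 else 0)

end WordRAM

/-! Colour every vertex 0, 1 or 2, with weights 1, `X` and -1, and call a colouring separated if no
edge joins colour 1 to colour 2. Fix the class `D` of colour 1. A vertex outside `D` may always get
colour 0, and it may get colour 2 exactly if it has no neighbour in `D`; so it contributes the
factor 1 if it is dominated and 1 - 1 = 0 if it is not. Hence the weighted sum over the separated
colourings is the sum of `X ^ |D|` over the dominating sets `D` (`sum_isSeparated`).

The gain is that being separated is a conjunction of conditions on single edges, each of which lies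
in a bag. The summand is thus a product of factors that depend on one bag each, and tables of
different children are combined by multiplying entries that belong to the same colouring. There are
three states per vertex, and no convolution over ways to distribute the duty of dominating a vertex.

A search order of the tree puts parents before children. In this order each bag meets the union of
the earlier bags only inside the bag of its parent (`TreeDecomposition.inter_subset_parent`), so the
sum can be evaluated by eliminating the nodes one after the other, each sending its parent a table
indexed by the colourings of their common vertices (`sum_colourings_eq_message`). Colourings of a
bag are numbered in base three, and `table_eq` is the same recursion in terms of these numbers.

Coefficients are kept modulo `2 ^ n`, and only those of degree at most `n` are kept. The first loses
nothing because the empty set is not dominating, so that every answer is below `2 ^ n`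
(`numDominatingSets_lt`); the second loses nothing because a coefficient of a sum or product depends
only on coefficients of at most the same degree. The residues also supply the -1.

For the time: a bag has at most `3 ^ (k + 1)` colourings, each colouring costs one polynomial
product per child, the numbers of children add up to less than the number of nodes, and a polynomial
product takes `O(n ^ 2)` multiplications of numbers. This gives `O(n ^ 3 * 3 ^ k)` multiplications.
Copying and adding numbers is linear in the number of their words, and it is charged to the
multiplications by `two_mul_numWords_le_of_mul`: a multiplication procedure must write its result.
`time_le` collects the costs, and `sizes_le` shows that all addresses and counters fit into a word.
The correctness of the program on the machine is proved by a Hoare logic with time bounds, `wp`. -/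

namespace WordRAM

open _root_.WordRAM.Expr (reg lit load)
open _root_.WordRAM.Program (assign store ite loop)

infixr:60 " ;; " => Program.seq

instance : Add Expr := ⟨Expr.op .add⟩
instance : Sub Expr := ⟨Expr.op .sub⟩
instance : Mul Expr := ⟨Expr.op .mul⟩

theorem Expr.cost_sub (e f : Expr) : (e - f).cost = e.cost + f.cost + 1 := rfl

/-! ### Hoare logic with time bounds for the word machine. -/

section Logic

variable {w : ℕ} {P P' : Program} {T T' T₁ T₂ : ℕ} {Q Q' R : State w → Prop} {σ τ : State w}
  {e f i : Expr}

/-- `P`, started in `σ`, halts within `T` steps in a state that satisfies `Q`. -/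
def wp (P : Program) (T : ℕ) (Q : State w → Prop) (σ : State w) : Prop :=
  ∃ σ' t, Run P σ σ' t ∧ t ≤ T ∧ Q σ'

theorem wp.mono (h : wp P T Q σ) (hQ : ∀ τ, Q τ → Q' τ) (hT : T ≤ T') : wp P T' Q' σ := by
  obtain ⟨σ', t, hr, ht, hq⟩ := h
  exact ⟨σ', t, hr, ht.trans hT, hQ _ hq⟩

theorem wp.of_le (h : wp P T Q σ) (hT : T ≤ T') : wp P T' Q σ :=
  h.mono (fun _ h => h) hT

theorem wp_skip (hQ : Q σ) : wp .skip 1 Q σ := ⟨_, _, .skip σ, le_rfl, hQ⟩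

theorem wp_seq (h : wp P T₁ R σ) (h' : ∀ τ, R τ → wp P' T₂ Q τ) :
    wp (P ;; P') (T₁ + T₂) Q σ := by
  obtain ⟨σ', t, hr, ht, hq⟩ := h
  obtain ⟨σ'', t', hr', ht', hq'⟩ := h' _ hq
  exact ⟨σ'', t + t', .seq hr hr', by omega, hq'⟩

/-- The expression `e` evaluates to the word that represents `m`. -/
def Ev (σ : State w) (e : Expr) (m : ℕ) : Prop := e.eval σ = BitVec.ofNat w m

variable {m k : ℕ}

theorem Ev.lit (c : ℕ) : Ev σ (.lit c) c := rfl

theorem Ev.wordLength : Ev σ .wordLength w := rfl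

theorem Ev.reg {x : ℕ} (h : σ.reg x = BitVec.ofNat w m) : Ev σ (.reg x) m := h

theorem Ev.load {a : ℕ} (hi : Ev σ i k) (h : σ.mem a (BitVec.ofNat w k) = BitVec.ofNat w m) :
    Ev σ (.load a i) m := by
  unfold Ev at *
  rw [Expr.eval, hi, h]

/-- `BitVec.ofNat w` respects sums and products, so these need no bound and may wrap around.
Subtraction needs `k ≤ m` because natural subtraction truncates; comparisons see residues, so they
need both sides below `2 ^ w`. -/
theorem Ev.add (he : Ev σ e m) (hf : Ev σ f k) : Ev σ (e + f) (m + k) := by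
  unfold Ev at *
  change e.eval σ + f.eval σ = _
  rw [he, hf, BitVec.ofNat_add]

theorem Ev.mul (he : Ev σ e m) (hf : Ev σ f k) : Ev σ (e * f) (m * k) := by
  unfold Ev at *
  change e.eval σ * f.eval σ = _
  rw [he, hf, BitVec.ofNat_mul]

theorem Ev.sub (he : Ev σ e m) (hf : Ev σ f k) (h : k ≤ m) : Ev σ (e - f) (m - k) := by
  unfold Ev at *
  change e.eval σ - f.eval σ = _
  rw [he, hf, sub_eq_iff_eq_add, ← BitVec.ofNat_add, Nat.sub_add_cancel h]

theorem Ev.lt (he : Ev σ e m) (hf : Ev σ f k) (hm : m < 2 ^ w) (hk : k < 2 ^ w) :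
    Ev σ (.op .lt e f) (if m < k then 1 else 0) := by
  unfold Ev at *
  simp only [Expr.eval, Op.eval]
  rw [he, hf, BitVec.toNat_ofNat, BitVec.toNat_ofNat, Nat.mod_eq_of_lt hm, Nat.mod_eq_of_lt hk]
  split_ifs <;> rfl

theorem ofNat_inj_of_lt (hm : m < 2 ^ w) (hk : k < 2 ^ w) :
    BitVec.ofNat w m = BitVec.ofNat w k ↔ m = k := by
  constructor
  · intro h
    have := congrArg BitVec.toNat h
    rwa [BitVec.toNat_ofNat, BitVec.toNat_ofNat, Nat.mod_eq_of_lt hm, Nat.mod_eq_of_lt hk] at this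
  · rintro rfl; rfl

theorem Ev.eq (he : Ev σ e m) (hf : Ev σ f k) (hm : m < 2 ^ w) (hk : k < 2 ^ w) :
    Ev σ (.op .eq e f) (if m = k then 1 else 0) := by
  unfold Ev at *
  simp only [Expr.eval, Op.eval]
  simp only [he, hf, ofNat_inj_of_lt hm hk]
  split_ifs <;> rfl

theorem wp_assign {x : ℕ} (he : Ev σ e m) (hQ : Q (σ.setReg x (BitVec.ofNat w m))) :
    wp (assign x e) (e.cost + 1) Q σ :=
  ⟨_, _, .assign σ x e, le_rfl, by rwa [he]⟩

theorem wp_store {a : ℕ} (hi : Ev σ i k) (he : Ev σ e m)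
    (hQ : Q (σ.setMem a (BitVec.ofNat w k) (BitVec.ofNat w m))) :
    wp (store a i e) (i.cost + e.cost + 1) Q σ :=
  ⟨_, _, .store σ a i e, le_rfl, by rwa [hi, he]⟩

theorem wp_assign_seq {x : ℕ} (he : Ev σ e m)
    (h : wp P T Q (σ.setReg x (BitVec.ofNat w m))) :
    wp (assign x e ;; P) (e.cost + 1 + T) Q σ :=
  wp_seq (R := fun τ => τ = σ.setReg x (BitVec.ofNat w m)) (wp_assign he rfl)
    (by rintro _ rfl; exact h)

theorem wp_store_seq {a : ℕ} (hi : Ev σ i k) (he : Ev σ e m)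
    (h : wp P T Q (σ.setMem a (BitVec.ofNat w k) (BitVec.ofNat w m))) :
    wp (store a i e ;; P) (i.cost + e.cost + 1 + T) Q σ :=
  wp_seq (R := fun τ => τ = σ.setMem a (BitVec.ofNat w k) (BitVec.ofNat w m))
    (wp_store hi he rfl) (by rintro _ rfl; exact h)

theorem wp_ite_pos (he : Ev σ e m) (hm : m ≠ 0) (hw : m < 2 ^ w) (h : wp P T Q σ) :
    wp (ite e P P') (e.cost + 1 + T) Q σ := by
  obtain ⟨σ', t, hr, ht, hq⟩ := h
  refine ⟨σ', _, .ite_true ?_ hr, by omega, hq⟩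
  rw [he]
  exact fun h => hm ((ofNat_inj_of_lt hw (by positivity)).1 h)

theorem wp_ite_neg (he : Ev σ e 0) (h : wp P' T Q σ) :
    wp (ite e P P') (e.cost + 1 + T) Q σ := by
  obtain ⟨σ', t, hr, ht, hq⟩ := h
  exact ⟨σ', _, .ite_false he hr, by omega, hq⟩

/-- `for x in [0, y)`, where `x` and `y` are registers. -/
def forUp (x y : ℕ) (P : Program) : Program :=
  assign x (lit 0) ;; loop (.op .lt (reg x) (reg y)) (P ;; assign x (reg x + lit 1))

/-- Induction on the number of rounds left. Besides the body, a round costs 4 steps for the test and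
4 for the increment; the first assignment and the last test cost 6. The bound may depend on the
round, so that a loop over all nodes can be charged only for those that are children. -/
theorem wp_forUp_sum {x y : ℕ} (I : ℕ → State w → Prop) (T : ℕ → ℕ) (hxy : y ≠ x)
    (hm : m < 2 ^ w)
    (hy : σ.reg y = BitVec.ofNat w m) (h0 : I 0 (σ.setReg x (BitVec.ofNat w 0)))
    (hstep : ∀ j < m, ∀ τ : State w, τ.reg x = BitVec.ofNat w j → τ.reg y = BitVec.ofNat w m →
      I j τ → wp P (T j) (fun τ' => τ'.reg x = BitVec.ofNat w j ∧ τ'.reg y = BitVec.ofNat w m ∧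
        I (j + 1) (τ'.setReg x (BitVec.ofNat w (j + 1)))) τ) :
    wp (forUp x y P) (∑ j ∈ Finset.range m, (T j + 8) + 6) (I m) σ := by
  have key : ∀ d j, j + d = m → ∀ τ : State w, τ.reg x = BitVec.ofNat w j →
      τ.reg y = BitVec.ofNat w m → I j τ →
      wp (loop (.op .lt (reg x) (reg y)) (P ;; assign x (reg x + lit 1)))
        (∑ i ∈ Finset.range d, (T (j + i) + 8) + 4) (I m) τ := by
    intro d
    induction d with
    | zero =>
      intro j hj τ hx hy hI
      obtain rfl : j = m := by omega
      refine ⟨τ, _, .loop_done ?_, by simp [Expr.cost], hI⟩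
      have := Ev.lt (Ev.reg hx) (Ev.reg hy) hm hm
      rw [if_neg (lt_irrefl _)] at this
      exact this
    | succ d ih =>
      intro j hj τ hx hy hI
      obtain ⟨τ', t, hr, ht, hx', hy', hI'⟩ := hstep j (by omega) τ hx hy hI
      have he : Ev τ' (reg x + lit 1) (j + 1) := (Ev.reg hx').add (Ev.lit 1)
      have h2 : Run (assign x (reg x + lit 1)) τ' (τ'.setReg x (BitVec.ofNat w (j + 1))) 4 := by
        have h3 := Run.assign τ' x (reg x + lit 1)
        rw [he] at h3
        exact h3
      obtain ⟨τ'', t', hr', ht', hI''⟩ := ih (j + 1) (by omega)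
        (τ'.setReg x (BitVec.ofNat w (j + 1))) (by simp [State.setReg])
        (by simpa [State.setReg, Function.update_of_ne hxy] using hy') hI'
      refine ⟨τ'', _, .loop_step ?_ (.seq hr h2) hr', ?_, hI''⟩
      · have := Ev.lt (Ev.reg hx) (Ev.reg hy) (show j < 2 ^ w by omega) hm
        rw [if_pos (by omega)] at this
        rw [this]
        exact fun h => one_ne_zero ((ofNat_inj_of_lt (show 1 < 2 ^ w by omega)
          (by positivity)).1 h)
      · simp only [Expr.cost]
        rw [Finset.sum_range_succ', add_zero]
        simp only [← add_assoc, add_right_comm j _ 1] at ht' ⊢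
        omega
  refine (wp_assign_seq (Ev.lit 0) (key m 0 (by omega) _ (by simp [State.setReg])
    (by simpa [State.setReg, Function.update_of_ne hxy] using hy) h0)).of_le ?_
  simp only [Expr.cost, zero_add]
  omega

theorem wp_forUp {x y : ℕ} (I : ℕ → State w → Prop) (hxy : y ≠ x) (hm : m < 2 ^ w)
    (hy : σ.reg y = BitVec.ofNat w m) (h0 : I 0 (σ.setReg x (BitVec.ofNat w 0)))
    (hstep : ∀ j < m, ∀ τ : State w, τ.reg x = BitVec.ofNat w j → τ.reg y = BitVec.ofNat w m →
      I j τ → wp P T (fun τ' => τ'.reg x = BitVec.ofNat w j ∧ τ'.reg y = BitVec.ofNat w m ∧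
        I (j + 1) (τ'.setReg x (BitVec.ofNat w (j + 1)))) τ) :
    wp (forUp x y P) (m * (T + 8) + 6) (I m) σ := by
  refine (wp_forUp_sum I (fun _ => T) hxy hm hy h0 hstep).of_le ?_
  simp

/-- Registers below `b`, and arrays below `100` other than those in `A`, are the same in
`σ` and `τ`. -/
structure Keep (b : ℕ) (A : List ℕ) (σ τ : State w) : Prop where
  reg : ∀ x < b, τ.reg x = σ.reg x
  mem : ∀ a < 100, a ∉ A → τ.mem a = σ.mem a

variable {b b' : ℕ} {A A' : List ℕ} {ρ : State w}

theorem Keep.refl (σ : State w) : Keep b A σ σ := ⟨fun _ _ => rfl, fun _ _ _ => rfl⟩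

theorem Keep.trans (h : Keep b A σ τ) (h' : Keep b A τ ρ) : Keep b A σ ρ :=
  ⟨fun x hx => (h'.reg x hx).trans (h.reg x hx),
    fun a ha hA => (h'.mem a ha hA).trans (h.mem a ha hA)⟩

theorem Keep.mono (h : Keep b A σ τ) (hb : b' ≤ b) (hA : A ⊆ A') : Keep b' A' σ τ :=
  ⟨fun x hx => h.reg x (by omega), fun a ha h' => h.mem a ha fun h'' => h' (hA h'')⟩

theorem Keep.setReg (h : Keep b A σ τ) {x : ℕ} (hx : b ≤ x) (v : BitVec w) :
    Keep b A σ (τ.setReg x v) :=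
  ⟨fun y hy => (Function.update_of_ne (by omega) _ _).trans (h.reg y hy), h.mem⟩

theorem Keep.setMem (h : Keep b A σ τ) {a : ℕ} (ha : 100 ≤ a ∨ a ∈ A) (i v : BitVec w) :
    Keep b A σ (τ.setMem a i v) := by
  refine ⟨h.reg, fun c hc hA => ?_⟩
  refine (Function.update_of_ne ?_ _ _).trans (h.mem c hc hA)
  rintro rfl
  rcases ha with ha | ha
  · omega
  · exact hA ha

theorem setReg_reg_self (x : ℕ) (v : BitVec w) : (σ.setReg x v).reg x = v :=
  Function.update_self ..

theorem setReg_reg_ne {x y : ℕ} (h : y ≠ x) (v : BitVec w) : (σ.setReg x v).reg y = σ.reg y :=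
  Function.update_of_ne h ..

theorem setMem_mem_self (a : ℕ) (i v : BitVec w) : (σ.setMem a i v).mem a i = v := by
  simp [State.setMem]

theorem setMem_mem_ne {a k m : ℕ} (hk : k < 2 ^ w) (hm : m < 2 ^ w) (h : k ≠ m) (v : BitVec w) :
    (σ.setMem a (BitVec.ofNat w m) v).mem a (BitVec.ofNat w k) = σ.mem a (BitVec.ofNat w k) := by
  simp only [State.setMem, Function.update_self]
  exact Function.update_of_ne (fun h' => h ((ofNat_inj_of_lt hk hm).1 h')) ..

theorem setMem_mem_other {a c : ℕ} (h : c ≠ a) (i v : BitVec w) :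
    (σ.setMem a i v).mem c = σ.mem c :=
  Function.update_of_ne h ..

end Logic

/-! ### Moving a program to other registers and arrays. -/

section Rename

/-- `e` with all registers and arrays moved up by `d`. -/
def Expr.shift (d : ℕ) : Expr → Expr
  | .lit c => .lit c
  | .wordLength => .wordLength
  | .reg x => .reg (x + d)
  | .load a i => .load (a + d) (i.shift d)
  | .op o e f => .op o (e.shift d) (f.shift d)

/-- `P` with all registers and arrays moved up by `d`. -/
def Program.shift (d : ℕ) : Program → Program
  | .skip => .skip
  | .assign x e => .assign (x + d) (e.shift d)
  | .store a i e => .store (a + d) (i.shift d) (e.shift d)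
  | .seq p q => .seq (p.shift d) (q.shift d)
  | .ite e p q => .ite (e.shift d) (p.shift d) (q.shift d)
  | .loop e p => .loop (e.shift d) (p.shift d)

variable {w : ℕ}

/-- The state whose registers and arrays below `d` are those of `σ`, and whose other registers
and arrays are those of `τ`, moved up by `d`. -/
def State.combine (d : ℕ) (σ τ : State w) : State w where
  reg x := if x < d then σ.reg x else τ.reg (x - d)
  mem a := if a < d then σ.mem a else τ.mem (a - d)

/-- The state that is seen from register and array `d` on. -/
def State.drop (d : ℕ) (σ : State w) : State w where
  reg x := σ.reg (x + d)
  mem a := σ.mem (a + d)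

theorem State.combine_drop (d : ℕ) (σ : State w) : σ.combine d (σ.drop d) = σ := by
  cases σ
  simp only [State.combine, State.drop, State.mk.injEq]
  constructor <;> funext x <;> split_ifs with h
  · rfl
  · rw [Nat.sub_add_cancel (by omega)]
  · rfl
  · rw [Nat.sub_add_cancel (by omega)]

theorem Expr.eval_shift (d : ℕ) (σ τ : State w) (e : Expr) :
    (e.shift d).eval (σ.combine d τ) = e.eval τ := by
  induction e with
  | lit c => rfl
  | wordLength => rfl
  | reg x => simp [Expr.shift, Expr.eval, State.combine]
  | load a i ih =>
    simp only [Expr.shift, Expr.eval, ih]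
    simp [State.combine]
  | op o e f ihe ihf => simp [Expr.shift, Expr.eval, ihe, ihf]

theorem Expr.cost_shift (d : ℕ) (e : Expr) : (e.shift d).cost = e.cost := by
  induction e with
  | lit c => rfl
  | wordLength => rfl
  | reg x => rfl
  | load a i ih => simp [Expr.shift, Expr.cost, ih]
  | op o e f ihe ihf => simp [Expr.shift, Expr.cost, ihe, ihf]

theorem State.combine_setReg (d : ℕ) (σ τ : State w) (x : ℕ) (v : BitVec w) :
    (σ.combine d τ).setReg (x + d) v = σ.combine d (τ.setReg x v) := by
  simp only [State.combine, State.setReg, State.mk.injEq, and_true]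
  funext y
  by_cases hy : y = x + d
  · subst hy; simp
  · rw [Function.update_of_ne hy]
    split_ifs with h
    · rfl
    · rw [Function.update_of_ne (by omega)]

theorem State.combine_setMem (d : ℕ) (σ τ : State w) (a : ℕ) (i v : BitVec w) :
    (σ.combine d τ).setMem (a + d) i v = σ.combine d (τ.setMem a i v) := by
  simp only [State.combine, State.setMem, State.mk.injEq, true_and]
  funext y
  by_cases hy : y = a + d
  · subst hy; simp
  · rw [Function.update_of_ne hy]
    split_ifs with h
    · rfl
    · rw [Function.update_of_ne (by omega)]

/-- A procedure known only by its specification may overwrite whatever it can name. After the shift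
it names nothing below `d`, so the data of its caller survive, and it takes the same number of
steps. -/
theorem Run.shift (d : ℕ) (σ : State w) {P : Program} {τ τ' : State w} {t : ℕ}
    (h : Run P τ τ' t) : Run (P.shift d) (σ.combine d τ) (σ.combine d τ') t := by
  induction h with
  | skip => exact .skip _
  | assign τ x e =>
    have := Run.assign (σ.combine d τ) (x + d) (e.shift d)
    rwa [Expr.eval_shift, Expr.cost_shift, State.combine_setReg] at this
  | store τ a i e =>
    have := Run.store (σ.combine d τ) (a + d) (i.shift d) (e.shift d)
    rwa [Expr.eval_shift, Expr.eval_shift, Expr.cost_shift, Expr.cost_shift,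
      State.combine_setMem] at this
  | seq _ _ ih₁ ih₂ => exact .seq ih₁ ih₂
  | ite_true he _ ih =>
    rw [← Expr.eval_shift d σ] at he
    simpa only [Expr.cost_shift, Program.shift] using Run.ite_true he ih
  | ite_false he _ ih =>
    rw [← Expr.eval_shift d σ] at he
    simpa only [Expr.cost_shift, Program.shift] using Run.ite_false he ih
  | loop_done he =>
    rw [← Expr.eval_shift d σ] at he
    simpa only [Expr.cost_shift, Program.shift] using Run.loop_done he
  | loop_step he _ _ ih₁ ih₂ =>
    rw [← Expr.eval_shift d σ] at he
    simpa only [Expr.cost_shift, Program.shift] using Run.loop_step he ih₁ ih₂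

end Rename

/-! ### A lower bound for multiplication procedures. -/

section LowerBound

variable {w : ℕ}

/-- A program cannot change more cells than it makes steps. -/
theorem Run.card_le {P : Program} {σ σ' : State w} {t : ℕ} (h : Run P σ σ' t) (a : ℕ) :
    (Finset.univ.filter fun i => σ'.mem a i ≠ σ.mem a i).card ≤ t := by
  have comp : ∀ {σ₁ σ₂ σ₃ : State w} {s t : ℕ},
      (Finset.univ.filter fun i => σ₂.mem a i ≠ σ₁.mem a i).card ≤ s →
      (Finset.univ.filter fun i => σ₃.mem a i ≠ σ₂.mem a i).card ≤ t →
      (Finset.univ.filter fun i => σ₃.mem a i ≠ σ₁.mem a i).card ≤ s + t := by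
    intro σ₁ σ₂ σ₃ s t h₁ h₂
    refine le_trans ?_ (add_le_add h₁ h₂)
    refine le_trans (Finset.card_le_card ?_) (Finset.card_union_le _ _)
    intro i hi
    simp only [Finset.mem_union, Finset.mem_filter, Finset.mem_univ, true_and] at hi ⊢
    by_contra hc
    push Not at hc
    exact hi (hc.2.trans hc.1)
  induction h with
  | skip => simp
  | assign => simp [State.setReg]
  | store σ b i e =>
    refine le_trans (Finset.card_le_card (t := {i.eval σ}) ?_) (by simp)
    intro k hk
    simp only [Finset.mem_filter, Finset.mem_univ, true_and, Finset.mem_singleton] at hk ⊢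
    by_contra hc
    refine hk ?_
    by_cases hb : a = b
    · subst hb; simp [State.setMem, hc]
    · simp [State.setMem, hb]
  | seq _ _ ih₁ ih₂ => exact comp ih₁ ih₂
  | ite_true _ _ ih => omega
  | ite_false _ _ ih => omega
  | loop_done => simp
  | loop_step _ _ _ ih₁ ih₂ => have := comp ih₁ ih₂; omega

/-- The result array may initially contain anything. Let it contain 1 everywhere and multiply 0 by
0: then all words of the product have to be changed, and a step changes at most one cell. By `h2L`
these words have different addresses. -/
theorem two_mul_numWords_le_of_mul {M : Program} {n T : ℕ} (hw : 0 < w)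
    (h2L : 2 * numWords w n ≤ 2 ^ w)
    (hM : ∀ (x y : ℕ) (σ : State w), x < 2 ^ n → y < 2 ^ n → σ.reg 0 = BitVec.ofNat w n →
      σ.Stores 0 0 (numWords w n) x → σ.Stores 1 0 (numWords w n) y →
      ∃ (σ' : State w) (t : ℕ), Run M σ σ' t ∧ t ≤ T ∧
        σ'.Stores 2 0 (2 * numWords w n) (x * y)) :
    2 * numWords w n ≤ T := by
  obtain ⟨σ', t, hr, ht, -, hs⟩ := hM 0 0
    ⟨fun _ => BitVec.ofNat w n, fun a _ => if a = 2 then BitVec.ofNat w 1 else BitVec.ofNat w 0⟩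
    (by positivity) (by positivity) rfl ⟨by positivity, by simp⟩ ⟨by positivity, by simp⟩
  refine le_trans ?_ ((hr.card_le 2).trans ht)
  have hinj : Set.InjOn (BitVec.ofNat w) (Finset.range (2 * numWords w n) : Set ℕ) := by
    intro i hi j hj hij
    simp only [Finset.coe_range, Set.mem_Iio] at hi hj
    exact (ofNat_inj_of_lt (by omega) (by omega)).1 hij
  calc 2 * numWords w n = ((Finset.range (2 * numWords w n)).image (BitVec.ofNat w)).card := by
        rw [Finset.card_image_of_injOn hinj, Finset.card_range]
    _ ≤ _ := by
        refine Finset.card_le_card fun k hk => ?_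
        obtain ⟨j, hj, rfl⟩ := Finset.mem_image.1 hk
        rw [Finset.mem_range] at hj
        have := hs j hj
        simp only [zero_add, mul_zero, Nat.zero_div] at this
        simp only [ne_eq, ite_true, Finset.mem_filter, Finset.mem_univ, true_and]
        rw [this]
        intro h
        have h01 := (ofNat_inj_of_lt (w := w) (by positivity) (Nat.one_lt_two_pow hw.ne')).1 h
        omega

end LowerBound

end WordRAM

namespace WordRAM

open _root_.WordRAM.Expr (reg lit load)
open _root_.WordRAM.Program (assign store ite loop)

/-! ### Copying and adding sequences of words. -/

section Words

variable {w : ℕ} {σ : State w}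

theorem ofNat_toNat_self (v : BitVec w) : BitVec.ofNat w v.toNat = v := by simp

theorem ofNat_eq_of_mod_eq {m k : ℕ} (h : m % 2 ^ w = k % 2 ^ w) :
    BitVec.ofNat w m = BitVec.ofNat w k := by
  apply BitVec.eq_of_toNat_eq
  rwa [BitVec.toNat_ofNat, BitVec.toNat_ofNat]

theorem ofNat_mod (m : ℕ) : BitVec.ofNat w (m % 2 ^ w) = BitVec.ofNat w m :=
  ofNat_eq_of_mod_eq (Nat.mod_mod _ _)

/-- Copies as many words as register 33 says from array `b`, offset register 32, to array `a`,
offset register 31. -/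
def copyWords (a b : ℕ) : Program :=
  forUp 34 33 (store a (reg 31 + reg 34) (load b (reg 32 + reg 34)))

theorem wp_copyWords {a b o₁ o₂ m : ℕ} (h31 : σ.reg 31 = BitVec.ofNat w o₁)
    (h32 : σ.reg 32 = BitVec.ofNat w o₂) (h33 : σ.reg 33 = BitVec.ofNat w m) (hm : m < 2 ^ w)
    (h₁ : o₁ + m ≤ 2 ^ w) (h₂ : o₂ + m ≤ 2 ^ w) (hd : a ≠ b ∨ o₁ + m ≤ o₂ ∨ o₂ + m ≤ o₁) :
    wp (copyWords a b) (m * 16 + 6) (fun τ => (∀ x < 34, τ.reg x = σ.reg x) ∧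
      (∀ c ≠ a, τ.mem c = σ.mem c) ∧
      (∀ j < m, τ.mem a (BitVec.ofNat w (o₁ + j)) = σ.mem b (BitVec.ofNat w (o₂ + j))) ∧
      ∀ k < 2 ^ w, k < o₁ ∨ o₁ + m ≤ k →
        τ.mem a (BitVec.ofNat w k) = σ.mem a (BitVec.ofNat w k)) σ := by
  refine (wp_forUp (T := 8) (fun i τ => (∀ x < 34, τ.reg x = σ.reg x) ∧
      (∀ c ≠ a, τ.mem c = σ.mem c) ∧
      (∀ j < i, τ.mem a (BitVec.ofNat w (o₁ + j)) = σ.mem b (BitVec.ofNat w (o₂ + j))) ∧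
      ∀ k < 2 ^ w, k < o₁ ∨ o₁ + i ≤ k →
        τ.mem a (BitVec.ofNat w k) = σ.mem a (BitVec.ofNat w k)) (by norm_num) hm h33 ?_ ?_).of_le
      (by omega)
  · refine ⟨fun x hx => setReg_reg_ne (by omega) _, fun _ _ => rfl, by simp, fun _ _ _ => rfl⟩
  · rintro j hj τ h34 h33' ⟨hr, hc, hd1, hd2⟩
    have e1 : Ev τ (reg 31 + reg 34) (o₁ + j) :=
      (Ev.reg ((hr 31 (by norm_num)).trans h31)).add (Ev.reg h34)
    have e2 : Ev τ (reg 32 + reg 34) (o₂ + j) :=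
      (Ev.reg ((hr 32 (by norm_num)).trans h32)).add (Ev.reg h34)
    have e3 : Ev τ (load b (reg 32 + reg 34)) (σ.mem b (BitVec.ofNat w (o₂ + j))).toNat := by
      refine e2.load ?_
      rw [ofNat_toNat_self]
      by_cases hab : b = a
      · subst hab
        exact hd2 _ (by omega) (by omega)
      · rw [hc b hab]
    refine wp.of_le (wp_store e1 e3 ⟨h34, h33', fun x hx => ?_, fun c hca => ?_, fun i hi => ?_,
      fun k hk hk' => ?_⟩) le_rfl
    · exact (setReg_reg_ne (by omega) _).trans (hr x hx)
    · exact (setMem_mem_other hca _ _).trans (hc c hca)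
    · rw [ofNat_toNat_self]
      rcases Nat.lt_succ_iff_lt_or_eq.1 hi with hi | rfl
      · refine (setMem_mem_ne ?_ ?_ ?_ _).trans (hd1 i hi) <;> omega
      · exact setMem_mem_self ..
    · refine (setMem_mem_ne hk ?_ ?_ _).trans (hd2 k hk ?_) <;> omega

/-- A modular addition has overflowed exactly if its result is smaller than a summand. Since `x + y
+ c < 2 * W`, at most one of the two additions overflows, so the carry is the sum of the two tests.
-/
theorem carry_word {x y c W : ℕ} (hW2 : 2 ≤ W) (hx : x < W) (hy : y < W) (hc : c ≤ 1) :
    (if (x + y) % W < x then 1 else 0) + (if (x + y + c) % W < (x + y) % W then 1 else 0)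
      = (x + y + c) / W := by
  have hW : 0 < W := by omega
  rcases lt_or_ge (x + y + c) W with h | h
  · rw [Nat.mod_eq_of_lt h, Nat.mod_eq_of_lt (by omega), Nat.div_eq_of_lt h]
    simp
  · rw [Nat.div_eq_of_lt_le (k := 1) (by omega) (by omega), Nat.mod_eq_sub_mod h,
      Nat.mod_eq_of_lt (a := x + y + c - W) (by omega)]
    rcases lt_or_ge (x + y) W with h' | h'
    · rw [Nat.mod_eq_of_lt h', if_neg (by omega), if_pos (by omega)]
    · rw [Nat.mod_eq_sub_mod h', Nat.mod_eq_of_lt (by omega), if_pos (by omega),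
        if_neg (by omega)]

/-- The residue modulo `D * W` is the residue modulo `D` plus `D` times the next digit in base `W`;
so the carry out of the longer block is the carry of that digit with the carry out of the shorter
block. -/
theorem carry_succ (X Y D W : ℕ) (hD : 0 < D) :
    (X % (D * W) + Y % (D * W)) / (D * W) =
      (X / D % W + Y / D % W + (X % D + Y % D) / D) / W := by
  rw [← Nat.div_div_eq_div_mul, Nat.mod_mul, Nat.mod_mul,
    show X % D + D * (X / D % W) + (Y % D + D * (Y / D % W)) =
      X % D + Y % D + D * (X / D % W + Y / D % W) by ring, Nat.add_mul_div_left _ _ hD, add_comm]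

theorem add_div_carry (X Y D : ℕ) (hD : 0 < D) :
    (X + Y) / D = X / D + Y / D + (X % D + Y % D) / D := by
  conv_lhs => rw [← Nat.mod_add_div X D, ← Nat.mod_add_div Y D,
    show X % D + D * (X / D) + (Y % D + D * (Y / D)) = X % D + Y % D + D * (X / D + Y / D) by ring,
    Nat.add_mul_div_left _ _ hD, add_comm]

/-- Adds the number in array `b`, offset register 32, to the one in array 3, offset register 31,
modulo `2 ^ (w * L)`, where register 2 contains `L`. -/
def addWordsLoop (b : ℕ) : Program :=
  assign 35 (lit 0) ;;
  forUp 34 2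
    (assign 36 (load 3 (reg 31 + reg 34)) ;;
      assign 37 (reg 36 + load b (reg 32 + reg 34)) ;;
      assign 38 (reg 37 + reg 35) ;;
      assign 35 (.op .lt (reg 37) (reg 36) + .op .lt (reg 38) (reg 37)) ;;
      store 3 (reg 31 + reg 34) (reg 38))

theorem wp_addWordsLoop {b o₁ o₂ L X Y : ℕ} (h31 : σ.reg 31 = BitVec.ofNat w o₁)
    (h32 : σ.reg 32 = BitVec.ofNat w o₂) (h2 : σ.reg 2 = BitVec.ofNat w L) (hL : L < 2 ^ w)
    (h₁ : o₁ + L ≤ 2 ^ w) (hX : ∀ j < L, σ.mem 3 (BitVec.ofNat w (o₁ + j)) =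
      BitVec.ofNat w (X / 2 ^ (w * j)))
    (hY : ∀ j < L, σ.mem b (BitVec.ofNat w (o₂ + j)) = BitVec.ofNat w (Y / 2 ^ (w * j)))
    (hd : b ≠ 3 ∨ (o₂ + L ≤ 2 ^ w ∧ (o₁ + L ≤ o₂ ∨ o₂ + L ≤ o₁))) :
    wp (addWordsLoop b) (L * 40 + 8) (fun τ => (∀ x < 34, τ.reg x = σ.reg x) ∧
      (∀ c ≠ 3, τ.mem c = σ.mem c) ∧
      (∀ j < L, τ.mem 3 (BitVec.ofNat w (o₁ + j)) = BitVec.ofNat w ((X + Y) / 2 ^ (w * j))) ∧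
      ∀ k < 2 ^ w, k < o₁ ∨ o₁ + L ≤ k →
        τ.mem 3 (BitVec.ofNat w k) = σ.mem 3 (BitVec.ofNat w k)) σ := by
  -- Register 35 contains the carry out of the lowest `i` words. The cells from `o₁ + i` on still
  -- have their old contents, which provides the next word of the first summand.
  refine (wp_assign_seq (Ev.lit 0) (wp_forUp (T := 32) (fun i τ => (∀ x < 34, τ.reg x = σ.reg x) ∧
      τ.reg 35 = BitVec.ofNat w ((X % 2 ^ (w * i) + Y % 2 ^ (w * i)) / 2 ^ (w * i)) ∧
      (∀ c ≠ 3, τ.mem c = σ.mem c) ∧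
      (∀ j < i, τ.mem 3 (BitVec.ofNat w (o₁ + j)) = BitVec.ofNat w ((X + Y) / 2 ^ (w * j))) ∧
      ∀ k < 2 ^ w, k < o₁ ∨ o₁ + i ≤ k →
        τ.mem 3 (BitVec.ofNat w k) = σ.mem 3 (BitVec.ofNat w k))
      (by norm_num) hL (setReg_reg_ne (by norm_num) _ |>.trans h2) ?_ ?_)).mono ?_ ?_
  · refine ⟨fun x hx => ?_, ?_, fun _ _ => rfl, by simp, fun _ _ _ => rfl⟩
    · rw [setReg_reg_ne (by omega), setReg_reg_ne (by omega)]
    · simp [setReg_reg_ne, setReg_reg_self, Nat.mod_one]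
  · rintro j hj τ h34 h2' ⟨hr, h35, hc, hd1, hd2⟩
    have hD : 0 < 2 ^ (w * j) := by positivity
    have hW : 0 < 2 ^ w := by positivity
    set c := (X % 2 ^ (w * j) + Y % 2 ^ (w * j)) / 2 ^ (w * j) with hcdef
    have hc1 : c ≤ 1 := by
      have := Nat.mod_lt X hD
      have := Nat.mod_lt Y hD
      exact Nat.lt_succ_iff.1 ((Nat.div_lt_iff_lt_mul hD).2 (by omega))
    set x := X / 2 ^ (w * j) % 2 ^ w with hx
    set y := Y / 2 ^ (w * j) % 2 ^ w with hy
    have hxW : x < 2 ^ w := Nat.mod_lt _ hW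
    have hyW : y < 2 ^ w := Nat.mod_lt _ hW
    clear_value x y
    have e1 : Ev τ (load 3 (reg 31 + reg 34)) x := by
      refine ((Ev.reg ((hr 31 (by norm_num)).trans h31)).add (Ev.reg h34)).load ?_
      rw [hd2 _ (by omega) (by omega), hX j hj, hx, ofNat_mod]
    apply wp.of_le
    · apply wp_assign_seq e1
      have e2 : Ev (τ.setReg 36 (BitVec.ofNat w x)) (reg 36 + load b (reg 32 + reg 34))
          (x + y) := by
        refine (Ev.reg (setReg_reg_self ..)).add (Ev.load (k := o₂ + j) ?_ ?_)
        · refine (Ev.reg ?_).add (Ev.reg ?_)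
          · rw [setReg_reg_ne (by norm_num), hr 32 (by norm_num), h32]
          · rw [setReg_reg_ne (by norm_num), h34]
        · rw [hy, ofNat_mod (Y / _), ← hY j hj]
          by_cases hb : b = 3
          · subst hb
            exact hd2 _ (by omega) (by omega)
          · exact congrFun (hc b hb) _
      apply wp_assign_seq e2
      · rw [← ofNat_mod (x + y)]
        have e3 : Ev ((τ.setReg 36 (BitVec.ofNat w x)).setReg 37
            (BitVec.ofNat w ((x + y) % 2 ^ w))) (reg 37 + reg 35) ((x + y) % 2 ^ w + c) := by
          refine (Ev.reg (setReg_reg_self ..)).add (Ev.reg ?_)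
          rw [setReg_reg_ne (by norm_num), setReg_reg_ne (by norm_num), h35]
        apply wp_assign_seq e3
        · rw [← ofNat_mod ((x + y) % 2 ^ w + c), Nat.mod_add_mod (x + y)]
          apply wp_assign_seq (((Ev.reg (m := (x + y) % 2 ^ w) rfl).lt (Ev.reg (m := x) rfl)
            (Nat.mod_lt _ hW) hxW).add ((Ev.reg (m := (x + y + c) % 2 ^ w) rfl).lt
              (Ev.reg (m := (x + y) % 2 ^ w) rfl) (Nat.mod_lt _ hW) (Nat.mod_lt _ hW)))
          · rw [carry_word (by omega) hxW hyW hc1]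
            refine wp_store (((Ev.reg (m := o₁) ?_)).add (Ev.reg (m := j) ?_))
              (Ev.reg (m := (x + y + c) % 2 ^ w) rfl) ⟨?_, ?_, fun z hz => ?_, ?_, fun d hd => ?_,
                fun i hi => ?_, fun k hk hk' => ?_⟩
            · exact (hr 31 (by norm_num)).trans h31
            · exact h34
            · exact h34
            · exact h2'
            · refine Eq.trans ?_ (hr z hz)
              have : z ≠ 34 ∧ z ≠ 35 ∧ z ≠ 36 ∧ z ≠ 37 ∧ z ≠ 38 := by omega
              simp [State.setMem, State.setReg, this]
            · have : 2 ^ (w * (j + 1)) = 2 ^ (w * j) * 2 ^ w := by rw [← pow_add]; congr 1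
              rw [this, carry_succ _ _ _ _ hD]
              rw [hcdef, hx, hy]
              rfl
            · exact (setMem_mem_other hd _ _).trans (hc d hd)
            · rcases Nat.lt_succ_iff_lt_or_eq.1 hi with hi | rfl
              · refine (setMem_mem_ne ?_ ?_ ?_ _).trans (hd1 i hi) <;> omega
              · simp only [State.setReg, State.setMem, Function.update_self]
                rw [ofNat_mod, add_div_carry _ _ _ hD]
                refine ofNat_eq_of_mod_eq ?_
                rw [Nat.add_mod, Nat.add_mod (X / _ + _), hx, hy, ← Nat.add_mod (X / _)]
            · refine (setMem_mem_ne hk ?_ ?_ _).trans (hd2 k hk ?_) <;> omega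
    · simp [Expr.cost]
  · exact fun τ ⟨h1, _, h2⟩ => ⟨h1, h2⟩
  · simp only [Expr.cost]; omega

end Words

end WordRAM

namespace WordRAM

open _root_.WordRAM.Expr (reg lit load)
open _root_.WordRAM.Program (assign store ite loop)

/-! ### Arithmetic modulo `2 ^ n` on arrays of `n`-bit numbers. -/

section Numbers

variable {w n : ℕ} {σ τ : State w}

theorem numWords_pos (hw : 0 < w) (hn : 0 < n) : 0 < numWords w n :=
  Nat.div_pos (by omega) hw

theorem le_mul_numWords (hw : 0 < w) : n ≤ w * numWords w n := by
  have := Nat.div_add_mod (n + w - 1) w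
  have := Nat.mod_lt (n + w - 1) hw
  unfold numWords
  omega

theorem mul_numWords_sub_one_lt (hw : 0 < w) (hn : 0 < n) : w * (numWords w n - 1) < n := by
  have := Nat.div_mul_le_self (n + w - 1) w
  have h := numWords_pos hw hn
  unfold numWords at *
  rw [Nat.mul_sub, mul_comm]
  omega

theorem mul_numWords_lt (hw : 0 < w) (hn : 0 < n) : w * numWords w n < n + w := by
  have := Nat.div_mul_le_self (n + w - 1) w
  unfold numWords
  rw [mul_comm]
  omega

theorem numWords_le (hw : 0 < w) (hn : 0 < n) : numWords w n ≤ n := by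
  have h := mul_numWords_sub_one_lt hw hn
  have := Nat.le_mul_of_pos_left (numWords w n - 1) hw
  omega

/-- The registers 0, 2, 3, 4 contain `n`, the number of words of an `n`-bit number, the mask for
its most significant word, and `n + 1`. -/
structure Globals (n : ℕ) (σ : State w) : Prop where
  reg_zero : σ.reg 0 = BitVec.ofNat w n
  reg_two : σ.reg 2 = BitVec.ofNat w (numWords w n)
  reg_three : σ.reg 3 = BitVec.ofNat w (2 ^ (n - w * (numWords w n - 1)) - 1)
  reg_four : σ.reg 4 = BitVec.ofNat w (n + 1)

theorem Globals.keep {b : ℕ} {A : List ℕ} (h : Globals n σ) (hk : Keep b A σ τ) (hb : 5 ≤ b) :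
    Globals n τ :=
  ⟨(hk.reg 0 (by omega)).trans h.reg_zero, (hk.reg 2 (by omega)).trans h.reg_two,
    (hk.reg 3 (by omega)).trans h.reg_three, (hk.reg 4 (by omega)).trans h.reg_four⟩

/-- Array 3 holds the `n`-bit numbers `F 0`, …, `F (Q - 1)`. -/
def Nums (n Q : ℕ) (F : ℕ → ZMod (2 ^ n)) (σ : State w) : Prop :=
  ∀ q < Q, ∀ j < numWords w n, σ.mem 3 (BitVec.ofNat w (q * numWords w n + j)) =
    BitVec.ofNat w ((F q).val / 2 ^ (w * j))

theorem Nums.of_mem_eq {Q : ℕ} {F : ℕ → ZMod (2 ^ n)} (h : Nums n Q F σ)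
    (hm : τ.mem 3 = σ.mem 3) : Nums n Q F τ :=
  fun q hq j hj => by rw [hm]; exact h q hq j hj

theorem Nums.congr {Q : ℕ} {F F' : ℕ → ZMod (2 ^ n)} (h : Nums n Q F σ)
    (hF : ∀ q < Q, F q = F' q) : Nums n Q F' σ :=
  fun q hq j hj => by rw [← hF q hq]; exact h q hq j hj

theorem add_mul_le_of_lt {q q' L : ℕ} (h : q < q') : q * L + L ≤ q' * L := by
  rw [← Nat.succ_mul]
  exact Nat.mul_le_mul_right _ h

theorem Ev.and {e f : Expr} {m s : ℕ} (he : Ev σ e m) (hf : Ev σ f (2 ^ s - 1)) (hs : s ≤ w) :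
    Ev σ (.op .and e f) (m % 2 ^ s) := by
  unfold Ev at *
  simp only [Expr.eval, Op.eval]
  rw [he, hf]
  apply BitVec.eq_of_toNat_eq
  have h1 : 2 ^ s ≤ 2 ^ w := Nat.pow_le_pow_right (by norm_num) hs
  have h2 : 0 < 2 ^ s := by positivity
  rw [BitVec.toNat_and, BitVec.toNat_ofNat, BitVec.toNat_ofNat, BitVec.toNat_ofNat,
    Nat.mod_eq_of_lt (a := 2 ^ s - 1) (by omega), Nat.and_two_pow_sub_one_eq_mod,
    Nat.mod_mod_of_dvd _ (pow_dvd_pow 2 hs), Nat.mod_eq_of_lt (a := m % 2 ^ s)]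
  have := Nat.mod_lt m h2
  omega

/-- From place `w * j` on, reduction modulo `2 ^ n` keeps `n - w * j` bits. Below the most
significant word this is at least `w`, so these words stay as they are, and masking the most
significant one does the whole reduction. -/
theorem mod_two_pow_div (Z j : ℕ) (hj : w * j ≤ n) :
    Z % 2 ^ n / 2 ^ (w * j) = Z / 2 ^ (w * j) % 2 ^ (n - w * j) := by
  rw [← Nat.mod_mul_right_div_self, ← pow_add, Nat.add_sub_cancel' hj]

/-- Adds the number in array `b`, offset register 32, to the one in array 3, offset register 31,
modulo `2 ^ n`. -/
def addWords (b : ℕ) : Program :=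
  addWordsLoop b ;;
  store 3 (reg 31 + (reg 2 - lit 1)) (.op .and (load 3 (reg 31 + (reg 2 - lit 1))) (reg 3))

theorem wp_addWords {b q o Q Y : ℕ} {F : ℕ → ZMod (2 ^ n)} (hw : 0 < w) (hn : 0 < n)
    (hg : Globals n σ) (hF : Nums n Q F σ) (hQ : Q * numWords w n < 2 ^ w) (hq : q < Q)
    (h31 : σ.reg 31 = BitVec.ofNat w (q * numWords w n)) (h32 : σ.reg 32 = BitVec.ofNat w o)
    (hY : ∀ j < numWords w n, σ.mem b (BitVec.ofNat w (o + j)) = BitVec.ofNat w (Y / 2 ^ (w * j)))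
    (hd : b ≠ 3 ∨ (o + numWords w n ≤ 2 ^ w ∧ (q * numWords w n + numWords w n ≤ o ∨
      o + numWords w n ≤ q * numWords w n))) :
    wp (addWords b) (numWords w n * 40 + 30) (fun τ => Keep 34 [3] σ τ ∧
      Nums n Q (Function.update F q (F q + (Y : ZMod (2 ^ n)))) τ) σ := by
  set L := numWords w n with hLdef
  have hL : 0 < L := numWords_pos hw hn
  have hqL : q * L + L ≤ Q * L := add_mul_le_of_lt hq
  have hL1 := mul_numWords_sub_one_lt hw hn
  have hL2 := le_mul_numWords (n := n) hw
  rw [← hLdef] at hL1 hL2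
  have hwL : w * L = w * (L - 1) + w := by
    rw [← Nat.mul_succ]; congr 1; omega
  refine (wp_seq (wp_addWordsLoop h31 h32 hg.reg_two (by omega) (by omega) (hF q hq) hY hd)
    (T₂ := 17) ?_).of_le (by omega)
  rintro τ ⟨hr, hc, hd1, hd2⟩
  have e1 : Ev τ (reg 31 + (reg 2 - lit 1)) (q * L + (L - 1)) :=
    (Ev.reg ((hr 31 (by norm_num)).trans h31)).add
      ((Ev.reg ((hr 2 (by norm_num)).trans hg.reg_two)).sub (Ev.lit 1) hL)
  have e2 := (e1.load (hd1 (L - 1) (by omega))).and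
    (Ev.reg ((hr 3 (by norm_num)).trans hg.reg_three)) (show n - w * (L - 1) ≤ w by omega)
  rw [← hLdef] at e2
  refine (wp_store e1 e2 ⟨?_, ?_⟩).of_le (by simp [Expr.cost, Expr.cost_sub])
  · refine Keep.setMem ⟨fun x hx => hr x hx, fun a ha hA => hc a (by simpa using hA)⟩
      (Or.inr (by simp)) _ _
  · intro q' hq' j hj
    have hq'L : q' * L + L ≤ Q * L := add_mul_le_of_lt hq'
    rw [← hLdef] at hj ⊢
    by_cases hqq : q' = q
    · subst hqq
      rw [Function.update_self]
      have hv : (F q' + (Y : ZMod (2 ^ n))).val = ((F q').val + Y) % 2 ^ n := by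
        rw [ZMod.val_add, ZMod.val_natCast, Nat.add_mod_mod]
      have hwj : w * j ≤ w * (L - 1) := Nat.mul_le_mul_left _ (by omega)
      rw [hv, mod_two_pow_div _ _ (by omega)]
      by_cases hjL : j = L - 1
      · subst hjL
        exact setMem_mem_self ..
      · refine (setMem_mem_ne ?_ ?_ ?_ _).trans ((hd1 j hj).trans ?_)
        · omega
        · omega
        · omega
        -- Below the top word at least `w` bits are left, so reduction modulo `2 ^ n` is not seen
        -- modulo `2 ^ w`.
        · have : w * (j + 1) ≤ w * (L - 1) := Nat.mul_le_mul_left _ (by omega)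
          rw [Nat.mul_succ] at this
          refine ofNat_eq_of_mod_eq ?_
          rw [Nat.mod_mod_of_dvd _ (pow_dvd_pow 2 (by omega))]
    · rw [Function.update_of_ne hqq, ← hF q' hq' j hj]
      have hsep : q' * L + L ≤ q * L ∨ q * L + L ≤ q' * L := by
        rcases Nat.lt_or_gt_of_ne hqq with h | h
        · exact Or.inl (add_mul_le_of_lt h)
        · exact Or.inr (add_mul_le_of_lt h)
      refine (setMem_mem_ne ?_ ?_ ?_ _).trans (hd2 _ ?_ ?_) <;> omega

/-- Adds number register 28 to number register 27. -/
def addNum : Program :=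
  assign 31 (reg 27 * reg 2) ;; assign 32 (reg 28 * reg 2) ;; addWords 3

theorem wp_addNum {q q' Q : ℕ} {F : ℕ → ZMod (2 ^ n)} (hw : 0 < w) (hn : 0 < n)
    (hg : Globals n σ) (hF : Nums n Q F σ) (hQ : Q * numWords w n < 2 ^ w) (hq : q < Q)
    (hq' : q' < Q) (hne : q' ≠ q) (h27 : σ.reg 27 = BitVec.ofNat w q)
    (h28 : σ.reg 28 = BitVec.ofNat w q') :
    wp addNum (numWords w n * 40 + 40) (fun τ => Keep 31 [3] σ τ ∧
      Nums n Q (Function.update F q (F q + F q')) τ) σ := by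
  have h := add_mul_le_of_lt (L := numWords w n) hq
  have h' := add_mul_le_of_lt (L := numWords w n) hq'
  have hk : Keep 31 [3] σ ((σ.setReg 31 (BitVec.ofNat w (q * numWords w n))).setReg 32
      (BitVec.ofNat w (q' * numWords w n))) :=
    ((Keep.refl σ).setReg (by norm_num) _).setReg (by norm_num) _
  refine wp.of_le (wp_assign_seq ((Ev.reg h27).mul (Ev.reg hg.reg_two)) (wp_assign_seq
    (m := q' * numWords w n) ((Ev.reg h28).mul (Ev.reg hg.reg_two)) (wp.mono
      (wp_addWords (Y := (F q').val) (Q := Q) (q := q) hw hn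
      (hg.keep hk (by norm_num)) hF hQ hq rfl rfl
      (fun j hj => hF q' hq' j hj) (Or.inr ⟨by omega, ?_⟩)) ?_ le_rfl))) ?_
  · rcases Nat.lt_or_gt_of_ne hne with h | h
    · exact Or.inr (add_mul_le_of_lt h)
    · exact Or.inl (add_mul_le_of_lt h)
  · rintro τ ⟨h1, h2⟩
    refine ⟨hk.trans (h1.mono (by norm_num) (by simp)), ?_⟩
    rwa [ZMod.natCast_zmod_val] at h2
  · simp only [Expr.cost]; omega

/-- Copies as many numbers as register 29 says from number register 28 on to number
register 27 on. -/
def copyNums : Program :=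
  assign 31 (reg 27 * reg 2) ;; assign 32 (reg 28 * reg 2) ;; assign 33 (reg 29 * reg 2) ;;
  copyWords 3 3

theorem wp_copyNums {q q' m Q : ℕ} {F : ℕ → ZMod (2 ^ n)} (hw : 0 < w) (hn : 0 < n)
    (hg : Globals n σ) (hF : Nums n Q F σ) (hQ : Q * numWords w n < 2 ^ w) (hq : q + m ≤ Q)
    (hq' : q' + m ≤ Q) (hne : q + m ≤ q' ∨ q' + m ≤ q) (h27 : σ.reg 27 = BitVec.ofNat w q)
    (h28 : σ.reg 28 = BitVec.ofNat w q') (h29 : σ.reg 29 = BitVec.ofNat w m) :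
    wp copyNums (m * numWords w n * 16 + 30) (fun τ => Keep 31 [3] σ τ ∧
      Nums n Q (fun i => if q ≤ i ∧ i < q + m then F (i - q + q') else F i) τ) σ := by
  set L := numWords w n with hL
  have hqL : q * L + m * L ≤ Q * L := by rw [← Nat.add_mul]; exact Nat.mul_le_mul_right _ hq
  have hqL' : q' * L + m * L ≤ Q * L := by rw [← Nat.add_mul]; exact Nat.mul_le_mul_right _ hq'
  have hLpos : 0 < L := numWords_pos hw hn
  have hk : Keep 31 [3] σ (((σ.setReg 31 (BitVec.ofNat w (q * L))).setReg 32
      (BitVec.ofNat w (q' * L))).setReg 33 (BitVec.ofNat w (m * L))) :=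
    (((Keep.refl σ).setReg (by norm_num) _).setReg (by norm_num) _).setReg (by norm_num) _
  refine wp.of_le (wp_assign_seq ((Ev.reg h27).mul (Ev.reg hg.reg_two)) (wp_assign_seq
    (m := q' * L) ((Ev.reg h28).mul (Ev.reg hg.reg_two)) (wp_assign_seq
    (m := m * L) ((Ev.reg h29).mul (Ev.reg hg.reg_two)) (wp.mono (wp_copyWords (o₁ := q * L)
      (o₂ := q' * L) (m := m * L) rfl rfl rfl (by omega) (by omega) (by omega) (Or.inr ?_)) ?_
        le_rfl)))) ?_
  · simp only [← Nat.add_mul]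
    exact hne.imp (Nat.mul_le_mul_right _) (Nat.mul_le_mul_right _)
  · rintro τ ⟨hr, hc, h1, h2⟩
    refine ⟨hk.trans ⟨fun x hx => hr x (by omega), fun a ha hA => hc a (by simpa using hA)⟩,
      fun i hi j hj => ?_⟩
    rw [← hL] at hj ⊢
    have hiL := add_mul_le_of_lt (L := L) hi
    dsimp only
    split_ifs with h
    · have hiq : i = q + (i - q) := by omega
      have h3 : (i - q) * L + L ≤ m * L := add_mul_le_of_lt (by omega)
      have h4 := h1 ((i - q) * L + j) (by omega)
      rw [← add_assoc, ← Nat.add_mul, ← hiq, ← add_assoc, ← Nat.add_mul, add_comm q'] at h4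
      rw [h4]
      exact hF _ (by omega) j hj
    · rw [h2 _ (by omega)]
      · exact hF i hi j hj
      · rw [← Nat.add_mul]
        by_cases hiq : i < q
        · have := add_mul_le_of_lt (L := L) hiq
          omega
        · have : (q + m) * L ≤ i * L := Nat.mul_le_mul_right _ (by omega)
          omega
  · simp only [Expr.cost]; omega

/-- `M` is a multiplication procedure for `n`-bit numbers on the machine with `w`-bit words that
takes at most `T` steps. -/
def MultipliesWithin (M : Program) (w n T : ℕ) : Prop :=
  ∀ (x y : ℕ) (σ : State w), x < 2 ^ n → y < 2 ^ n → σ.reg 0 = BitVec.ofNat w n →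
    σ.Stores 0 0 (numWords w n) x → σ.Stores 1 0 (numWords w n) y →
    ∃ (σ' : State w) (t : ℕ), Run M σ σ' t ∧ t ≤ T ∧ σ'.Stores 2 0 (2 * numWords w n) (x * y)

theorem wp_multiply {M : Program} {T x y : ℕ} (hM : MultipliesWithin M w n T) (hx : x < 2 ^ n)
    (hy : y < 2 ^ n) (h100 : σ.reg 100 = BitVec.ofNat w n)
    (hsx : σ.Stores 100 0 (numWords w n) x) (hsy : σ.Stores 101 0 (numWords w n) y) :
    wp (M.shift 100) T (fun τ => (∀ x < 100, τ.reg x = σ.reg x) ∧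
      (∀ a < 100, τ.mem a = σ.mem a) ∧ τ.Stores 102 0 (2 * numWords w n) (x * y)) σ := by
  obtain ⟨σ', t, hr, ht, hs⟩ := hM x y (σ.drop 100) hx hy h100 hsx hsy
  refine ⟨_, t, State.combine_drop 100 σ ▸ hr.shift 100 σ, ht, fun x hx => if_pos hx,
    fun a ha => if_pos ha, ?_⟩
  simpa [State.Stores, State.combine] using hs

/-- Adds the product of the numbers registers 28 and 29 to number register 27. -/
def mulAdd (M : Program) : Program :=
  assign 31 (lit 0) ;; assign 32 (reg 28 * reg 2) ;; assign 33 (reg 2) ;; copyWords 100 3 ;;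
  assign 32 (reg 29 * reg 2) ;; copyWords 101 3 ;; assign 100 (reg 0) ;; M.shift 100 ;;
  assign 31 (reg 27 * reg 2) ;; assign 32 (lit 0) ;; addWords 102

/-- The product has twice the length, but only its lower half is added, and the addition reduces
modulo `2 ^ n` anyway. The copies and the addition take time linear in the number of words, which
`hT` turns into a multiple of `T`. -/
theorem wp_mulAdd {M : Program} {T q q₁ q₂ Q : ℕ} {F : ℕ → ZMod (2 ^ n)} (hw : 0 < w)
    (hn : 0 < n) (hM : MultipliesWithin M w n T) (hT : numWords w n ≤ T)
    (hg : Globals n σ) (hF : Nums n Q F σ) (hQ : Q * numWords w n < 2 ^ w) (hq : q < Q)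
    (hq₁ : q₁ < Q) (hq₂ : q₂ < Q) (h27 : σ.reg 27 = BitVec.ofNat w q)
    (h28 : σ.reg 28 = BitVec.ofNat w q₁) (h29 : σ.reg 29 = BitVec.ofNat w q₂) :
    wp (mulAdd M) (T * 200) (fun τ => Keep 31 [3] σ τ ∧
      Nums n Q (Function.update F q (F q + F q₁ * F q₂)) τ) σ := by
  set L := numWords w n with hL
  have hLpos : 0 < L := numWords_pos hw hn
  have hqL := add_mul_le_of_lt (L := L) hq
  have hqL₁ := add_mul_le_of_lt (L := L) hq₁
  have hqL₂ := add_mul_le_of_lt (L := L) hq₂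
  have hpow : 2 ^ n ≤ 2 ^ (w * L) := Nat.pow_le_pow_right (by norm_num) (le_mul_numWords hw)
  have hv₁ := ZMod.val_lt (F q₁)
  have hv₂ := ZMod.val_lt (F q₂)
  refine wp.of_le (wp_assign_seq (Ev.lit 0) (wp_assign_seq ((Ev.reg h28).mul (Ev.reg hg.reg_two))
    (wp_assign_seq (Ev.reg hg.reg_two) (wp_seq (wp_copyWords (o₁ := 0) (o₂ := q₁ * L) (m := L)
      rfl rfl rfl (by omega) (by omega) (by omega) (by simp)) (T₂ := T + 56 * L + 70) ?_)))) ?_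
  · rintro τ₁ ⟨hr₁, hc₁, hd₁, -⟩
    have hF₁ : Nums n Q F τ₁ := hF.of_mem_eq (hc₁ 3 (by norm_num))
    refine wp.of_le (wp_assign_seq (m := q₂ * L) ((Ev.reg ?_).mul (Ev.reg ?_))
      (wp_seq (wp_copyWords (o₁ := 0) (o₂ := q₂ * L) (m := L) ?_ rfl ?_
      (by omega) (by omega) (by omega) (by simp)) (T₂ := T + 40 * L + 50) ?_)) ?_
    · exact (hr₁ 29 (by norm_num)).trans h29
    · exact (hr₁ 2 (by norm_num)).trans hg.reg_two
    · exact hr₁ 31 (by norm_num)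
    · exact hr₁ 33 (by norm_num)
    · rintro τ₂ ⟨hr₂, hc₂, hd₂, -⟩
      have hF₂ : Nums n Q F τ₂ := hF₁.of_mem_eq (hc₂ 3 (by norm_num))
      refine wp.of_le (wp_assign_seq (m := n) (Ev.reg ?_)
        (wp_seq (wp_multiply hM hv₁ hv₂ rfl ⟨hv₁.trans_le hpow, ?_⟩
          ⟨hv₂.trans_le hpow, ?_⟩)
          (T₂ := 40 * L + 40) ?_)) ?_
      · exact (hr₂ 0 (by norm_num)).trans ((hr₁ 0 (by norm_num)).trans hg.reg_zero)
      · intro j hj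
        rw [← hF q₁ hq₁ j hj, ← hL]
        refine (congrFun (hc₂ 100 (by norm_num)) _).trans (hd₁ j hj)
      · intro j hj
        rw [← hF q₂ hq₂ j hj, ← hL]
        exact (hd₂ j hj).trans (congrFun (hc₁ 3 (by norm_num)) _)
      · rintro τ₃ ⟨hr₃, hc₃, -, hs⟩
        have hk₃ : Keep 31 [3] σ τ₃ := by
          refine ⟨fun x hx => (hr₃ x (by omega)).trans ?_, fun a ha hA => (hc₃ a ha).trans ?_⟩
          · refine (setReg_reg_ne (by omega) _).trans ((hr₂ x (by omega)).trans ?_)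
            refine (setReg_reg_ne (by omega) _).trans ((hr₁ x (by omega)).trans ?_)
            rw [setReg_reg_ne (by omega), setReg_reg_ne (by omega), setReg_reg_ne (by omega)]
          · exact (hc₂ a (by omega)).trans (hc₁ a (by omega))
        have hF₃ : Nums n Q F τ₃ := hF₂.of_mem_eq (hc₃ 3 (by norm_num))
        -- The arrays 100 and 101 have been overwritten as well, but `Keep` makes no claim about
        -- arrays from 100 on.
        have hk₄ : Keep 31 [3] σ ((τ₃.setReg 31 (BitVec.ofNat w (q * L))).setReg 32
            (BitVec.ofNat w 0)) := (hk₃.setReg (by norm_num) _).setReg (by norm_num) _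
        refine wp.of_le (wp_assign_seq (m := q * L) ((Ev.reg ?_).mul (Ev.reg ?_)) (wp_assign_seq
          (Ev.lit 0) ((wp_addWords (Y := (F q₁).val * (F q₂).val) (q := q) (o := 0) hw hn
            (hg.keep hk₄ (by norm_num)) hF₃ hQ hq rfl rfl
            (fun j hj => hs j (by omega)) (by simp)).mono ?_ le_rfl))) ?_
        · exact (hk₃.reg 27 (by norm_num)).trans h27
        · exact (hk₃.reg 2 (by norm_num)).trans hg.reg_two
        · rintro τ ⟨h1, h2⟩
          refine ⟨hk₄.trans (h1.mono (by norm_num) (by simp)), ?_⟩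
          rwa [Nat.cast_mul, ZMod.natCast_zmod_val, ZMod.natCast_zmod_val] at h2
        · simp only [Expr.cost]; omega
      · simp only [Expr.cost]; omega
    · simp only [Expr.cost]; omega
  · simp only [Expr.cost]; omega

end Numbers

end WordRAM

namespace WordRAM

open Polynomial
open _root_.WordRAM.Expr (reg lit load)
open _root_.WordRAM.Program (assign store ite loop)

/-! ### Polynomials over `ZMod (2 ^ n)`, stored up to degree `n`. -/

section Slots

variable {w n : ℕ} {σ τ : State w}

/-- Array 3 holds the coefficients of degree at most `n` of the polynomials `P 0`, …,
`P (K - 1)`. -/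
def Slots (n K : ℕ) (P : ℕ → (ZMod (2 ^ n))[X]) (σ : State w) : Prop :=
  Nums n (K * (n + 1)) (fun q => (P (q / (n + 1))).coeff (q % (n + 1))) σ

variable {K : ℕ} {P P' : ℕ → (ZMod (2 ^ n))[X]}

theorem Slots.of_mem_eq (h : Slots n K P σ) (hm : τ.mem 3 = σ.mem 3) : Slots n K P τ :=
  Nums.of_mem_eq h hm

/-- Coefficients of degree above `n` are not stored, so a stored polynomial matters only modulo `X ^
(n + 1)`. This is why the specifications can use the operations of the polynomial ring, although the
program truncates. -/
theorem Slots.congr (h : Slots n K P σ)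
    (hP : ∀ s < K, ∀ κ ≤ n, (P s).coeff κ = (P' s).coeff κ) : Slots n K P' σ :=
  Nums.congr h fun q hq => hP _ (Nat.div_lt_of_lt_mul (by rwa [mul_comm])) _
    (Nat.lt_succ_iff.1 (Nat.mod_lt _ (Nat.succ_pos n)))

theorem slot_div {s κ : ℕ} (hκ : κ ≤ n) : (s * (n + 1) + κ) / (n + 1) = s := by
  rw [add_comm, Nat.add_mul_div_right _ _ (Nat.succ_pos n), Nat.div_eq_of_lt (by omega), zero_add]

theorem slot_mod {s κ : ℕ} (hκ : κ ≤ n) : (s * (n + 1) + κ) % (n + 1) = κ := by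
  rw [add_comm, Nat.add_mul_mod_self_right, Nat.mod_eq_of_lt (by omega)]

theorem slot_lt {s κ : ℕ} (hκ : κ ≤ n) (hs : s < K) : s * (n + 1) + κ < K * (n + 1) := by
  have := add_mul_le_of_lt (L := n + 1) hs
  omega

/-- Translates operations on single numbers into operations on polynomials: adding to one number is
adding a monomial to one slot. -/
theorem Slots.of_update {s κ : ℕ} {v : ZMod (2 ^ n)} (hκ : κ ≤ n)
    (h : Nums n (K * (n + 1)) (Function.update (fun q => (P (q / (n + 1))).coeff (q % (n + 1)))
      (s * (n + 1) + κ) ((P s).coeff κ + v)) σ) :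
    Slots n K (Function.update P s (P s + monomial κ v)) σ := by
  refine Nums.congr h fun q _ => ?_
  by_cases hq : q = s * (n + 1) + κ
  · subst hq
    rw [Function.update_self, slot_div hκ, slot_mod hκ, Function.update_self, coeff_add,
      coeff_monomial_same]
  · rw [Function.update_of_ne hq]
    by_cases hs : q / (n + 1) = s
    · rw [hs, Function.update_self, coeff_add, coeff_monomial_of_ne, add_zero]
      intro hκ'
      refine hq ?_
      rw [← hs, ← hκ', mul_comm, Nat.div_add_mod]
    · rw [Function.update_of_ne hs]

variable (hw : 0 < w) (hn : 0 < n) (hg : Globals n σ) (hP : Slots n K P σ)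
  (hK : K * (n + 1) * numWords w n < 2 ^ w)
include hw hn hg hP hK

theorem wp_addNum_slots {s κ s' κ' : ℕ} (hs : s < K) (hs' : s' < K) (hκ : κ ≤ n) (hκ' : κ' ≤ n)
    (hne : s' ≠ s) (h27 : σ.reg 27 = BitVec.ofNat w (s * (n + 1) + κ))
    (h28 : σ.reg 28 = BitVec.ofNat w (s' * (n + 1) + κ')) :
    wp addNum (numWords w n * 40 + 40) (fun τ => Keep 31 [3] σ τ ∧
      Slots n K (Function.update P s (P s + monomial κ ((P s').coeff κ'))) τ) σ := by
  refine (wp_addNum hw hn hg hP hK (slot_lt hκ hs) (slot_lt hκ' hs') ?_ h27 h28).mono ?_ le_rfl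
  · intro h
    apply hne
    rw [← slot_div (s := s') hκ', h, slot_div hκ]
  · rintro τ ⟨h1, h2⟩
    refine ⟨h1, Slots.of_update hκ ?_⟩
    rwa [slot_div hκ, slot_mod hκ, slot_div hκ', slot_mod hκ'] at h2

theorem wp_mulAdd_slots {M : Program} {T s κ s₁ κ₁ s₂ κ₂ : ℕ} (hM : MultipliesWithin M w n T)
    (hT : numWords w n ≤ T) (hs : s < K) (hs₁ : s₁ < K) (hs₂ : s₂ < K) (hκ : κ ≤ n)
    (hκ₁ : κ₁ ≤ n) (hκ₂ : κ₂ ≤ n) (h27 : σ.reg 27 = BitVec.ofNat w (s * (n + 1) + κ))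
    (h28 : σ.reg 28 = BitVec.ofNat w (s₁ * (n + 1) + κ₁))
    (h29 : σ.reg 29 = BitVec.ofNat w (s₂ * (n + 1) + κ₂)) :
    wp (mulAdd M) (T * 200) (fun τ => Keep 31 [3] σ τ ∧
      Slots n K (Function.update P s
        (P s + monomial κ ((P s₁).coeff κ₁ * (P s₂).coeff κ₂))) τ) σ := by
  refine (wp_mulAdd hw hn hM hT hg hP hK (slot_lt hκ hs) (slot_lt hκ₁ hs₁) (slot_lt hκ₂ hs₂)
    h27 h28 h29).mono ?_ le_rfl
  rintro τ ⟨h1, h2⟩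
  refine ⟨h1, Slots.of_update hκ ?_⟩
  rwa [slot_div hκ, slot_mod hκ, slot_div hκ₁, slot_mod hκ₁, slot_div hκ₂, slot_mod hκ₂] at h2

omit hw hn hg hP hK in
/-- Copies slot register 26 to slot register 25. -/
def polyCopy : Program :=
  assign 27 (reg 25 * reg 4) ;; assign 28 (reg 26 * reg 4) ;; assign 29 (reg 4) ;; copyNums

theorem wp_polyCopy {s s' : ℕ} (hs : s < K) (hs' : s' < K) (hne : s ≠ s')
    (h25 : σ.reg 25 = BitVec.ofNat w s) (h26 : σ.reg 26 = BitVec.ofNat w s') :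
    wp polyCopy ((n + 1) * numWords w n * 16 + 50) (fun τ => Keep 27 [3] σ τ ∧
      Slots n K (Function.update P s (P s')) τ) σ := by
  have hk : Keep 27 [3] σ (((σ.setReg 27 (BitVec.ofNat w (s * (n + 1)))).setReg 28
      (BitVec.ofNat w (s' * (n + 1)))).setReg 29 (BitVec.ofNat w (n + 1))) :=
    (((Keep.refl σ).setReg (by norm_num) _).setReg (by norm_num) _).setReg (by norm_num) _
  have h1 := add_mul_le_of_lt (L := n + 1) hs
  have h2 := add_mul_le_of_lt (L := n + 1) hs'
  refine wp.of_le (wp_assign_seq ((Ev.reg h25).mul (Ev.reg hg.reg_four)) (wp_assign_seq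
    (m := s' * (n + 1)) ((Ev.reg h26).mul (Ev.reg hg.reg_four)) (wp_assign_seq (m := n + 1)
      (Ev.reg hg.reg_four) (wp.mono (wp_copyNums (q := s * (n + 1)) (q' := s' * (n + 1))
        (m := n + 1) hw hn (hg.keep hk (by norm_num)) hP hK h1 h2 ?_ rfl rfl rfl) ?_ le_rfl)))) ?_
  · rcases Nat.lt_or_gt_of_ne hne with h | h
    · exact Or.inl (add_mul_le_of_lt h)
    · exact Or.inr (add_mul_le_of_lt h)
  · rintro τ ⟨h3, h4⟩
    refine ⟨hk.trans (h3.mono (by norm_num) (by simp)), Nums.congr h4 fun q _ => ?_⟩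
    have hdm := Nat.div_add_mod q (n + 1)
    have hm := Nat.mod_lt q (Nat.succ_pos n)
    rw [mul_comm] at hdm
    set d := q / (n + 1)
    set κ := q % (n + 1)
    split_ifs with h
    · have hds : d = s := by
        have : q = s * (n + 1) + (q - s * (n + 1)) := by omega
        show q / (n + 1) = s
        rw [this, slot_div (by omega)]
      rw [hds, Function.update_self, ← hdm, hds, Nat.add_sub_cancel_left, add_comm,
        slot_div (by omega), slot_mod (by omega)]
    · rw [Function.update_of_ne]
      rintro rfl
      exact h ⟨by omega, by omega⟩
  · simp only [Expr.cost]; omega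

omit hw hn hg hP hK in
/-- Puts `X ^ d` or `-X ^ d` into slot 0, where register 18 contains `d`, and register 17 contains
0 or 1; the slots 2, 3, 4 contain 1, -1 and 0. -/
def setMonomial : Program :=
  assign 25 (lit 0) ;; assign 26 (lit 4) ;; polyCopy ;;
  assign 27 (reg 18) ;; assign 28 ((reg 17 + lit 2) * reg 4) ;; assign 29 (lit 1) ;; copyNums

theorem wp_setMonomial {s d : ℕ} (hs : s + 2 < K) (hK5 : 5 ≤ K) (hd : d ≤ n) (h4 : P 4 = 0)
    (h17 : σ.reg 17 = BitVec.ofNat w s) (h18 : σ.reg 18 = BitVec.ofNat w d) :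
    wp setMonomial ((n + 1) * numWords w n * 32 + 200) (fun τ => Keep 25 [3] σ τ ∧
      Slots n K (Function.update P 0 (monomial d ((P (s + 2)).coeff 0))) τ) σ := by
  have hk : Keep 25 [3] σ ((σ.setReg 25 (BitVec.ofNat w 0)).setReg 26 (BitVec.ofNat w 4)) :=
    ((Keep.refl σ).setReg (by norm_num) _).setReg (by norm_num) _
  have hL : 1 * numWords w n ≤ (n + 1) * numWords w n := Nat.mul_le_mul_right _ (by omega)
  refine wp.of_le (wp_assign_seq (Ev.lit 0) (wp_assign_seq (Ev.lit 4) (wp_seq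
    (wp_polyCopy (s := 0) (s' := 4) hw hn (hg.keep hk (by norm_num)) (hP.of_mem_eq rfl) hK
      (by omega) (by omega) (by norm_num) rfl rfl)
      (T₂ := (n + 1) * numWords w n * 16 + 100) ?_))) ?_
  · rintro τ ⟨hkτ, hPτ⟩
    have hkτ' := hk.trans (hkτ.mono (by norm_num) (List.Subset.refl _))
    have hk₂ : Keep 25 [3] σ (((τ.setReg 27 (BitVec.ofNat w d)).setReg 28
      (BitVec.ofNat w ((s + 2) * (n + 1)))).setReg 29 (BitVec.ofNat w 1)) :=
      ((hkτ'.setReg (by norm_num) _).setReg (by norm_num) _).setReg (by norm_num) _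
    have h3 := slot_lt (n := n) (κ := d) (s := 0) hd (show 0 < K by omega)
    have h3' := slot_lt (n := n) (κ := 0) (Nat.zero_le n) hs
    refine wp.of_le (wp_assign_seq (Ev.reg ((hkτ'.reg 18 (by norm_num)).trans h18))
      (wp_assign_seq (m := (s + 2) * (n + 1)) (((Ev.reg ?_).add (Ev.lit 2)).mul (Ev.reg ?_))
        (wp_assign_seq (Ev.lit 1) (wp.mono (wp_copyNums (q := d) (q' := (s + 2) * (n + 1))
        (m := 1) hw hn (hg.keep hk₂ (by norm_num)) hPτ hK (by omega) (by omega) ?_ rfl rfl rfl)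
          ?_ le_rfl)))) ?_
    · exact (hkτ'.reg 17 (by norm_num)).trans h17
    · exact (hkτ'.reg 4 (by norm_num)).trans hg.reg_four
    · left
      rw [add_mul]
      have := Nat.zero_le (s * (n + 1))
      omega
    · rintro ρ ⟨h5, h6⟩
      refine ⟨hk₂.trans (h5.mono (by norm_num) (by simp)), Nums.congr h6 fun q _ => ?_⟩
      by_cases hq : q = d
      · subst hq
        have hdiv : q / (n + 1) = 0 := Nat.div_eq_of_lt (by omega)
        have hmod : q % (n + 1) = q := Nat.mod_eq_of_lt (by omega)
        have e := slot_div (n := n) (κ := 0) (s := s + 2) (Nat.zero_le n)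
        have e' := slot_mod (n := n) (κ := 0) (s := s + 2) (Nat.zero_le n)
        rw [if_pos (by omega), Nat.sub_self, zero_add]
        rw [add_zero] at e e'
        rw [e, e', Function.update_of_ne (by omega), hdiv, hmod, Function.update_self,
          coeff_monomial_same]
      · rw [if_neg (by omega)]
        by_cases h0 : q / (n + 1) = 0
        · have hlt : q < n + 1 := by
            rcases (Nat.div_eq_zero_iff).1 h0 with h | h <;> omega
          rw [h0, Function.update_self, Function.update_self, h4, coeff_zero, coeff_monomial_of_ne]
          rw [Nat.mod_eq_of_lt hlt]
          exact hq
        · rw [Function.update_of_ne h0, Function.update_of_ne h0]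
    · simp only [Expr.cost]; omega
  · simp only [Expr.cost]; omega

omit hw hn hg hP hK in
/-- Adds slot 0 to slot register 19. -/
def polyAdd : Program :=
  forUp 20 4 (assign 27 (reg 19 * reg 4 + reg 20) ;; assign 28 (reg 20) ;; addNum)

theorem wp_polyAdd {s : ℕ} (hs : s < K) (hs0 : s ≠ 0) (h19 : σ.reg 19 = BitVec.ofNat w s) :
    wp polyAdd ((n + 1) * (numWords w n * 40 + 60) + 6) (fun τ => Keep 20 [3] σ τ ∧
      Slots n K (Function.update P s (P s + P 0)) τ) σ := by
  have hL : 1 * (n + 1) ≤ K * (n + 1) := Nat.mul_le_mul_right _ (by omega)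
  have hL' : K * (n + 1) * 1 ≤ K * (n + 1) * numWords w n :=
    Nat.mul_le_mul_left _ (numWords_pos hw hn)
  refine wp.mono (wp_forUp (T := numWords w n * 40 + 52) (fun i τ => Keep 20 [3] σ τ ∧
      Slots n K (Function.update P s (P s + ∑ κ ∈ Finset.range i, monomial κ ((P 0).coeff κ))) τ)
      (by norm_num) (by omega) hg.reg_four ?_ ?_) ?_ le_rfl
  · refine ⟨(Keep.refl σ).setReg (by norm_num) _, ?_⟩
    refine (hP.of_mem_eq rfl).congr fun q _ κ _ => ?_
    rw [Finset.range_zero, Finset.sum_empty, add_zero, Function.update_eq_self]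
  · rintro i hi τ h20 h4 ⟨hk, hPτ⟩
    have hk₂ : Keep 20 [3] σ ((τ.setReg 27 (BitVec.ofNat w (s * (n + 1) + i))).setReg 28
      (BitVec.ofNat w i)) := (hk.setReg (by norm_num) _).setReg (by norm_num) _
    refine wp.of_le (wp_assign_seq (((Ev.reg ((hk.reg 19 (by norm_num)).trans h19)).mul
      (Ev.reg h4)).add (Ev.reg h20)) (wp_assign_seq (m := i) (Ev.reg h20) (wp.mono
        (wp_addNum_slots (s := s) (κ := i) (s' := 0) (κ' := i) hw hn (hg.keep hk₂ (by norm_num))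
          hPτ hK hs (by omega) (by omega) (by omega) hs0.symm rfl
          (by rw [zero_mul, zero_add]; rfl)) ?_ le_rfl))) ?_
    · rintro ρ ⟨h5, h6⟩
      refine ⟨(h5.reg 20 (by norm_num)).trans h20, (h5.reg 4 (by norm_num)).trans h4,
        (hk₂.trans (h5.mono (by norm_num) (by simp))).setReg (by norm_num) _, ?_⟩
      refine Slots.of_mem_eq (Slots.congr h6 fun q _ κ _ => ?_) rfl
      rw [Function.update_idem, Function.update_self, Function.update_of_ne hs0.symm,
        Finset.sum_range_succ, add_assoc]
    · simp only [Expr.cost]; omega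
  · rintro τ ⟨h1, h2⟩
    refine ⟨h1, h2.congr fun q _ κ hκ => ?_⟩
    by_cases hq : q = s
    · subst hq
      rw [Function.update_self, Function.update_self, coeff_add, coeff_add, finsetSum_coeff,
        Finset.sum_eq_single κ]
      · rw [coeff_monomial_same]
      · intro b _ hb; exact coeff_monomial_of_ne _ (Ne.symm hb)
      · intro h; exact absurd (Finset.mem_range.2 (by omega)) h
    · rw [Function.update_of_ne hq, Function.update_of_ne hq]

omit hw hn hg hP hK in
/-- Multiplies slot 0 by slot register 19, with slot 1 as a temporary place. -/
def polyMul (M : Program) : Program :=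
  assign 25 (lit 1) ;; assign 26 (lit 4) ;; polyCopy ;;
  forUp 20 4 (assign 22 (reg 20 + lit 1) ;;
    forUp 21 22 (assign 27 (lit 1 * reg 4 + reg 20) ;; assign 28 (lit 0 * reg 4 + reg 21) ;;
      assign 29 (reg 19 * reg 4 + (reg 20 - reg 21)) ;; mulAdd M)) ;;
  assign 25 (lit 0) ;; assign 26 (lit 1) ;; polyCopy

/-- Schoolbook multiplication, accumulated in a cleared slot 1. The coefficient of degree `i` needs
only coefficients of degree at most `i` of the factors, so the first `n + 1` coefficients of the
true product come out although nothing is known about higher degrees. -/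
theorem wp_polyMul_loop {M : Program} {T s : ℕ} (hM : MultipliesWithin M w n T)
    (hT : numWords w n ≤ T) (hs : s < K) (hs1 : 5 ≤ s) (h1 : P 1 = 0)
    (h19 : σ.reg 19 = BitVec.ofNat w s) :
    wp (forUp 20 4 (assign 22 (reg 20 + lit 1) ;;
      forUp 21 22 (assign 27 (lit 1 * reg 4 + reg 20) ;; assign 28 (lit 0 * reg 4 + reg 21) ;;
        assign 29 (reg 19 * reg 4 + (reg 20 - reg 21)) ;; mulAdd M)))
      ((n + 1) * ((n + 1) * (T * 200 + 40) + 20) + 6) (fun τ => Keep 20 [3] σ τ ∧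
      Slots n K (Function.update P 1 (P 0 * P s)) τ) σ := by
  have hL : 1 * (n + 1) ≤ K * (n + 1) := Nat.mul_le_mul_right _ (by omega)
  have hL' : K * (n + 1) * 1 ≤ K * (n + 1) * numWords w n :=
    Nat.mul_le_mul_left _ (numWords_pos hw hn)
  refine wp.mono (wp_forUp (T := (n + 1) * (T * 200 + 40) + 12) (fun i τ => Keep 20 [3] σ τ ∧
      Slots n K (Function.update P 1
        (∑ κ ∈ Finset.range i, monomial κ ((P 0 * P s).coeff κ))) τ)
      (by norm_num) (by omega) hg.reg_four ?_ ?_) ?_ le_rfl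
  · refine ⟨(Keep.refl σ).setReg (by norm_num) _, ?_⟩
    refine (hP.of_mem_eq rfl).congr fun q _ κ _ => ?_
    rw [Finset.range_zero, Finset.sum_empty, ← h1, Function.update_eq_self]
  · rintro i hi τ h20 h4 ⟨hk, hPτ⟩
    have hk₂ : Keep 20 [3] σ (τ.setReg 22 (BitVec.ofNat w (i + 1))) :=
      hk.setReg (by norm_num) _
    refine wp.of_le (wp_assign_seq ((Ev.reg h20).add (Ev.lit 1)) (wp.mono
      (wp_forUp (T := T * 200 + 25) (fun l ρ => Keep 20 [3] σ ρ ∧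
        ρ.reg 20 = BitVec.ofNat w i ∧ Slots n K (Function.update P 1
        (∑ κ ∈ Finset.range i, monomial κ ((P 0 * P s).coeff κ) +
          ∑ j ∈ Finset.range l, monomial i ((P 0).coeff j * (P s).coeff (i - j)))) ρ)
      (m := i + 1) (by norm_num) (by omega) rfl ?_ ?_) ?_ le_rfl)) ?_
    · refine ⟨hk₂.setReg (by norm_num) _, h20, ?_⟩
      rw [Finset.range_zero, Finset.sum_empty, add_zero]
      exact hPτ.of_mem_eq rfl
    · rintro l hl ρ h21 h22 ⟨hkρ, h20ρ, hPρ⟩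
      have hk₃ : Keep 20 [3] σ (((ρ.setReg 27 (BitVec.ofNat w (1 * (n + 1) + i))).setReg 28
        (BitVec.ofNat w (0 * (n + 1) + l))).setReg 29
          (BitVec.ofNat w (s * (n + 1) + (i - l)))) :=
        ((hkρ.setReg (by norm_num) _).setReg (by norm_num) _).setReg (by norm_num) _
      have h4ρ : ρ.reg 4 = BitVec.ofNat w (n + 1) := (hkρ.reg 4 (by norm_num)).trans hg.reg_four
      refine wp.of_le (wp_assign_seq (((Ev.lit 1).mul (Ev.reg h4ρ)).add (Ev.reg h20ρ))
        (wp_assign_seq (m := 0 * (n + 1) + l) (((Ev.lit 0).mul (Ev.reg h4ρ)).add (Ev.reg h21))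
        (wp_assign_seq (m := s * (n + 1) + (i - l)) (((Ev.reg ?_).mul (Ev.reg h4ρ)).add
          ((Ev.reg h20ρ).sub (Ev.reg h21) (by omega))) (wp.mono
        (wp_mulAdd_slots (s := 1) (κ := i) (s₁ := 0) (κ₁ := l) (s₂ := s) (κ₂ := i - l) hw hn
          (hg.keep hk₃ (by norm_num)) hPρ hK hM hT (by omega) (by omega) hs (by omega) (by omega)
          (by omega) rfl rfl rfl) ?_ le_rfl)))) ?_
      · exact (hkρ.reg 19 (by norm_num)).trans h19
      · rintro π ⟨h5, h6⟩
        refine ⟨(h5.reg 21 (by norm_num)).trans h21, (h5.reg 22 (by norm_num)).trans h22,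
          (hk₃.trans (h5.mono (by norm_num) (by simp))).setReg (by norm_num) _,
          (h5.reg 20 (by norm_num)).trans h20ρ, ?_⟩
        refine Slots.of_mem_eq (Slots.congr h6 fun q _ κ _ => ?_) rfl
        rw [Function.update_idem, Function.update_self,
          Function.update_of_ne (show (0 : ℕ) ≠ 1 by norm_num),
          Function.update_of_ne (show s ≠ 1 by omega), Finset.sum_range_succ _ l, add_assoc]
      · simp only [Expr.cost, Expr.cost_sub]; omega
    · rintro ρ ⟨h5, h6, h7⟩
      refine ⟨h6, (h5.reg 4 (by norm_num)).trans hg.reg_four, h5.setReg (by norm_num) _,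
        Slots.of_mem_eq (Slots.congr h7 fun q _ κ _ => ?_) rfl⟩
      have hc : (P 0 * P s).coeff i =
          ∑ j ∈ Finset.range (i + 1), (P 0).coeff j * (P s).coeff (i - j) := by
        rw [coeff_mul, Finset.Nat.sum_antidiagonal_eq_sum_range_succ_mk]
      rw [← map_sum, ← hc,
        Finset.sum_range_succ (fun κ => monomial κ ((P 0 * P s).coeff κ)) i]
    · simp only [Expr.cost]
      have : (i + 1) * (T * 200 + 25 + 8) ≤ (n + 1) * (T * 200 + 40) :=
        Nat.mul_le_mul (by omega) (by omega)
      omega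
  · rintro τ ⟨h5, h2⟩
    refine ⟨h5, h2.congr fun q _ κ hκ => ?_⟩
    by_cases hq : q = 1
    · subst hq
      rw [Function.update_self, Function.update_self, finsetSum_coeff, Finset.sum_eq_single κ]
      · rw [coeff_monomial_same]
      · intro b _ hb; exact coeff_monomial_of_ne _ (Ne.symm hb)
      · intro h; exact absurd (Finset.mem_range.2 (by omega)) h
    · rw [Function.update_of_ne hq, Function.update_of_ne hq]

/-- Slot 1 is cleared before each use, so its final content `p` can remain unspecified. -/
theorem wp_polyMul {M : Program} {T s : ℕ} (hM : MultipliesWithin M w n T)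
    (hT : numWords w n ≤ T) (hs : s < K) (hs1 : 5 ≤ s) (h4 : P 4 = 0)
    (h19 : σ.reg 19 = BitVec.ofNat w s) :
    wp (polyMul M) ((n + 1) * (n + 1) * T * 700) (fun τ => Keep 20 [3] σ τ ∧ ∃ p,
      Slots n K (Function.update (Function.update P 1 p) 0 (P 0 * P s)) τ) σ := by
  have hk : Keep 20 [3] σ ((σ.setReg 25 (BitVec.ofNat w 1)).setReg 26 (BitVec.ofNat w 4)) :=
    ((Keep.refl σ).setReg (by norm_num) _).setReg (by norm_num) _
  refine wp.of_le (wp_assign_seq (Ev.lit 1) (wp_assign_seq (Ev.lit 4) (wp_seq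
    (wp_polyCopy (s := 1) (s' := 4) hw hn (hg.keep hk (by norm_num)) (hP.of_mem_eq rfl) hK
      (by omega) (by omega) (by norm_num) rfl rfl) (T₂ := ?_) ?_))) ?_
  · exact (n + 1) * ((n + 1) * (T * 200 + 40) + 20) + (n + 1) * numWords w n * 16 + 100
  · rintro τ ⟨hkτ, hPτ⟩
    have hkτ' := hk.trans (hkτ.mono (by norm_num) (List.Subset.refl _))
    refine wp.of_le (wp_seq (wp_polyMul_loop (s := s) hw hn (hg.keep hkτ' (by norm_num)) hPτ hK
      hM hT hs hs1 ?_ ?_) (T₂ := (n + 1) * numWords w n * 16 + 60) ?_) (by omega)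
    · rw [Function.update_self, h4]
    · exact (hkτ'.reg 19 (by norm_num)).trans h19
    · rintro ρ ⟨hkρ, hPρ⟩
      have hkρ' := hkτ'.trans hkρ
      rw [Function.update_idem, Function.update_of_ne (by norm_num),
        Function.update_of_ne (by omega)] at hPρ
      have hk₂ : Keep 20 [3] σ ((ρ.setReg 25 (BitVec.ofNat w 0)).setReg 26 (BitVec.ofNat w 1)) :=
        (hkρ'.setReg (by norm_num) _).setReg (by norm_num) _
      refine wp.of_le (wp_assign_seq (Ev.lit 0) (wp_assign_seq (Ev.lit 1) (wp.mono
        (wp_polyCopy (s := 0) (s' := 1) hw hn (hg.keep hk₂ (by norm_num)) (hPρ.of_mem_eq rfl) hK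
        (by omega) (by omega) (by norm_num) rfl rfl) ?_ le_rfl))) ?_
      · rintro π ⟨h5, h6⟩
        refine ⟨hk₂.trans (h5.mono (by norm_num) (by simp)), P 0 * P s, ?_⟩
        rwa [Function.update_self] at h6
      · simp only [Expr.cost]; omega
  · simp only [Expr.cost]
    -- By `1 ≤ numWords w n ≤ T` every lower order term is at most a multiple of `(n + 1) * (n + 1)
    -- * T`.
    have h1 : 1 ≤ numWords w n := numWords_pos hw hn
    have h2 : (n + 1) * numWords w n ≤ (n + 1) * (n + 1) * T := by
      rw [mul_assoc]
      exact Nat.mul_le_mul_left _ (hT.trans (Nat.le_mul_of_pos_left _ (by omega)))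
    have h3 : (n + 1) * (n + 1) * 1 ≤ (n + 1) * (n + 1) * T :=
      Nat.mul_le_mul_left _ (by omega)
    have h4 : (n + 1) * 1 ≤ (n + 1) * (n + 1) := Nat.mul_le_mul_left _ (by omega)
    have h5 : (n + 1) * ((n + 1) * (T * 200 + 40) + 20) =
      (n + 1) * (n + 1) * T * 200 + (n + 1) * (n + 1) * 40 + (n + 1) * 20 := by ring
    omega

end Slots

end WordRAM

/-! ### Weighted sums over colourings by elimination of bags. -/

section Colourings

open Finset Polynomial

variable {V : Type*} [Fintype V] [DecidableEq V]

/-- The colouring that agrees with `f` on `S` and is `0` elsewhere. -/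
def restrictTo (S : Finset V) (f : V → Fin 3) : V → Fin 3 := fun v => if v ∈ S then f v else 0

/-- The colourings that are `0` outside `S`. -/
def colourings (S : Finset V) : Finset (V → Fin 3) := univ.filter fun f => ∀ v ∉ S, f v = 0

theorem mem_colourings {S : Finset V} {f : V → Fin 3} :
    f ∈ colourings S ↔ ∀ v ∉ S, f v = 0 := by
  simp [colourings]

theorem restrictTo_mem_colourings (S : Finset V) (f : V → Fin 3) :
    restrictTo S f ∈ colourings S :=
  mem_colourings.2 fun _ hv => if_neg hv

omit [Fintype V] in
theorem restrictTo_of_mem {S : Finset V} {f : V → Fin 3} {v : V} (hv : v ∈ S) :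
    restrictTo S f v = f v := if_pos hv

omit [Fintype V] in
theorem restrictTo_of_notMem {S : Finset V} {f : V → Fin 3} {v : V} (hv : v ∉ S) :
    restrictTo S f v = 0 := if_neg hv

omit [Fintype V] in
theorem restrictTo_congr {S : Finset V} {f g : V → Fin 3} (h : ∀ v ∈ S, f v = g v) :
    restrictTo S f = restrictTo S g := by
  funext v
  by_cases hv : v ∈ S
  · rw [restrictTo_of_mem hv, restrictTo_of_mem hv, h v hv]
  · rw [restrictTo_of_notMem hv, restrictTo_of_notMem hv]

variable {A : Type*} [CommRing A]

/-- One step of the dynamic program: splitting the sum over the colourings of `U ∪ X` according to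
their restrictions to `U`. -/
theorem sum_colourings_union {U X S W : Finset V} (hS : S = X ∩ U) (hW : W = U ∪ X)
    {wt : Fin 3 → A} (hwt : wt 0 = 1) (a b : (V → Fin 3) → A)
    (ha : ∀ f, a f = a (restrictTo U f)) (hb : ∀ f, b f = b (restrictTo X f)) :
    ∑ f ∈ colourings W, (∏ v, wt (f v)) * (a f * b f) =
      ∑ f ∈ colourings U, (∏ v, wt (f v)) * (a f *
        ∑ g ∈ (colourings X).filter (fun g => restrictTo S g = restrictTo S f),
          (∏ v ∈ X \ S, wt (g v)) * b g) := by
  subst hW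
  -- The colourings of `U ∪ X` are grouped by their restriction `f'` to `U`.
  rw [← sum_fiberwise_of_maps_to (s := colourings (U ∪ X)) (t := colourings U)
    (g := restrictTo U) (fun f _ => restrictTo_mem_colourings U f)]
  refine sum_congr rfl fun f' hf' => ?_
  rw [← mul_assoc, mul_sum]
  rw [mem_colourings] at hf'
  have key : ∀ f ∈ (colourings (U ∪ X)).filter (fun f => restrictTo U f = f'),
      (∀ v ∈ U, f v = f' v) ∧ ∀ v ∉ U, v ∉ X → f v = 0 := by
    intro f hf
    rw [mem_filter, mem_colourings] at hf
    refine ⟨fun v hv => ?_, fun v hv hv' => hf.1 v (by simp [hv, hv'])⟩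
    rw [← hf.2, restrictTo_of_mem hv]
  -- A member of the fibre is `f'` glued to a colouring `g` of `X`, and the two fit together exactly
  -- if they agree on `S = X ∩ U`.
  refine sum_nbij' (fun f => restrictTo X f) (fun g v => if v ∈ U then f' v else g v)
    ?_ ?_ ?_ ?_ ?_
  · intro f hf
    obtain ⟨h1, -⟩ := key f hf
    rw [mem_filter]
    refine ⟨restrictTo_mem_colourings X f, restrictTo_congr fun v hv => ?_⟩
    rw [hS, mem_inter] at hv
    rw [restrictTo_of_mem hv.1, h1 v hv.2]
  · intro g hg
    rw [mem_filter, mem_colourings] at hg ⊢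
    refine ⟨fun v hv => ?_, funext fun v => ?_⟩
    · rw [mem_union, not_or] at hv
      rw [if_neg hv.1, hg.1 v hv.2]
    · by_cases hv : v ∈ U
      · rw [restrictTo_of_mem hv, if_pos hv]
      · rw [restrictTo_of_notMem hv, hf' v hv]
  · intro f hf
    obtain ⟨h1, h2⟩ := key f hf
    funext v
    split_ifs with hv
    · rw [h1 v hv]
    · by_cases hv' : v ∈ X
      · rw [restrictTo_of_mem hv']
      · rw [restrictTo_of_notMem hv', h2 v hv hv']
  · intro g hg
    rw [mem_filter, mem_colourings] at hg
    funext v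
    by_cases hv : v ∈ X
    · rw [restrictTo_of_mem hv]
      split_ifs with hv'
      · have hvS : v ∈ S := by rw [hS, mem_inter]; exact ⟨hv, hv'⟩
        have := congrFun hg.2 v
        rw [restrictTo_of_mem hvS, restrictTo_of_mem hvS] at this
        exact this.symm
      · rfl
    · rw [restrictTo_of_notMem hv, hg.1 v hv]
  · intro f hf
    obtain ⟨h1, h2⟩ := key f hf
    have hr : restrictTo U f = f' := (mem_filter.1 hf).2
    -- The vertices of `S` are already counted in `f'`, so only those of `X \ S` bring new weights;
    -- vertices of colour 0 count 1 by `hwt`.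
    have hp : ∏ v, wt (f v) = (∏ v, wt (f' v)) * ∏ v ∈ X \ S, wt (restrictTo X f v) := by
      have hif : ∏ v ∈ X \ S, wt (restrictTo X f v) =
          ∏ v, if v ∈ X \ S then wt (restrictTo X f v) else 1 := by
        rw [← prod_subset (subset_univ (X \ S)) (fun v _ hv => if_neg hv)]
        exact prod_congr rfl fun v hv => (if_pos hv).symm
      rw [hif, ← prod_mul_distrib]
      refine prod_congr rfl fun v _ => ?_
      by_cases hv : v ∈ U
      · have : v ∉ X \ S := by simp [hS, hv]
        rw [if_neg this, mul_one, h1 v hv]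
      · rw [hf' v hv, hwt, one_mul]
        by_cases hv' : v ∈ X
        · have : v ∈ X \ S := by simp [hS, hv, hv']
          rw [if_pos this, restrictTo_of_mem hv']
        · have : v ∉ X \ S := by simp [hv']
          rw [if_neg this, h2 v hv hv', hwt]
    rw [hp, ha f, hr, hb f]
    ring

/-- Correctness of the dynamic program along an elimination order of the bags: the nodes are
`0, …, N - 1`, and `par j` is the parent of `j`. -/
theorem sum_colourings_eq_message {N : ℕ} (hN : 0 < N) {X S : ℕ → Finset V} {par : ℕ → ℕ}
    (hpar0 : N ≤ par 0) (hpar : ∀ j, 0 < j → j < N → par j < j)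
    (hS0 : S 0 = ∅) (hS : ∀ j, 0 < j → j < N → S j = X j ∩ X (par j))
    (hX : ∀ i j, i < j → j < N → X j ∩ X i ⊆ X (par j))
    {wt : Fin 3 → A} (hwt : wt 0 = 1) (val : ℕ → (V → Fin 3) → A)
    (hval : ∀ j f, val j f = val j (restrictTo (X j) f)) (M : ℕ → (V → Fin 3) → A)
    (hM : ∀ j < N, ∀ h ∈ colourings (S j), M j h =
      ∑ g ∈ (colourings (X j)).filter (fun g => restrictTo (S j) g = h),
        (∏ v ∈ X j \ S j, wt (g v)) * (val j g *
          ∏ l ∈ (range N).filter (fun l => par l = j), M l (restrictTo (S l) g))) :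
    M 0 0 = ∑ f ∈ colourings ((range N).biUnion X),
      (∏ v, wt (f v)) * ∏ j ∈ range N, val j f := by
  -- The interpolating quantity: the nodes below `i` are summed explicitly, and the others enter
  -- through the messages that cross the cut, from a node at or above `i` to a parent below `i`. `Z
  -- 1` is the message of the root, `Z N` the full sum, and `Z` is constant between them.
  set Z : ℕ → A := fun i => ∑ f ∈ colourings ((range i).biUnion X), (∏ v, wt (f v)) *
    ((∏ j ∈ range i, val j f) *
      ∏ l ∈ (range N).filter (fun l => i ≤ l ∧ par l < i), M l (restrictTo (S l) f)) with hZ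
  have hstep : ∀ i, 0 < i → i < N → Z (i + 1) = Z i := by
    intro i hi0 hi
    have hU : (range (i + 1)).biUnion X = (range i).biUnion X ∪ X i := by
      rw [range_add_one, biUnion_insert, union_comm]
    -- The running intersection property `hX`: what bag `i` shares with all earlier bags together it
    -- shares with its parent alone.
    have hSi : S i = X i ∩ (range i).biUnion X := by
      rw [hS i hi0 hi]
      ext v
      simp only [mem_inter, mem_biUnion, mem_range]
      constructor
      · rintro ⟨h1, h2⟩
        exact ⟨h1, _, hpar i hi0 hi, h2⟩
      · rintro ⟨h1, k, hk, h2⟩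
        exact ⟨h1, hX k i hk hi (mem_inter.2 ⟨h1, h2⟩)⟩
    have hsub : ∀ l < N, 0 < l → ∀ k, par l < k → S l ⊆ (range k).biUnion X := by
      intro l hl hl0 k hk v hv
      rw [hS l hl0 hl, mem_inter] at hv
      exact mem_biUnion.2 ⟨_, mem_range.2 hk, hv.2⟩
    have hL := sum_colourings_union (A := A) hSi hU hwt
      (fun f => (∏ j ∈ range i, val j f) *
        ∏ l ∈ (range N).filter (fun l => i + 1 ≤ l ∧ par l < i), M l (restrictTo (S l) f))
      (fun f => val i f * ∏ l ∈ (range N).filter (fun l => par l = i), M l (restrictTo (S l) f))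
      (fun f => ?_) (fun f => ?_)
    · rw [hZ]
      dsimp only
      -- Moving the cut past `i` trades the message of `i` for the messages of its children. A child
      -- of `i` lies above `i` because parents have smaller numbers; node 0 is nobody's child since
      -- `N ≤ par 0`.
      have h1 : ∀ f, ∏ l ∈ (range N).filter (fun l => i + 1 ≤ l ∧ par l < i + 1),
          M l (restrictTo (S l) f) =
          (∏ l ∈ (range N).filter (fun l => i + 1 ≤ l ∧ par l < i), M l (restrictTo (S l) f)) *
          ∏ l ∈ (range N).filter (fun l => par l = i), M l (restrictTo (S l) f) := by
        intro f
        rw [← prod_union]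
        · congr 1
          ext l
          simp only [mem_filter, mem_range, mem_union]
          constructor
          · rintro ⟨h1, h2, h3⟩
            omega
          · rintro (⟨h1, h2, h3⟩ | ⟨h1, h2⟩)
            · omega
            · have : 0 < l := by
                rcases Nat.eq_zero_or_pos l with rfl | h
                · omega
                · exact h
              have := hpar l this h1
              omega
        · refine disjoint_left.2 fun l hl hl' => ?_
          simp only [mem_filter] at hl hl'
          omega
      have h2 : ∀ f, ∏ l ∈ (range N).filter (fun l => i ≤ l ∧ par l < i),
          M l (restrictTo (S l) f) = M i (restrictTo (S i) f) *
          ∏ l ∈ (range N).filter (fun l => i + 1 ≤ l ∧ par l < i), M l (restrictTo (S l) f) := by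
        intro f
        rw [← prod_insert (f := fun l => M l (restrictTo (S l) f)) (a := i)
          (s := (range N).filter (fun l => i + 1 ≤ l ∧ par l < i)) (by simp)]
        congr 1
        ext l
        simp only [mem_filter, mem_range, mem_insert]
        constructor
        · rintro ⟨h1, h2, h3⟩
          omega
        · rintro (rfl | h)
          · exact ⟨hi, le_rfl, hpar _ hi0 hi⟩
          · omega
      refine Eq.trans (sum_congr rfl fun f _ => ?_) (hL.trans (sum_congr rfl fun f _ => ?_))
      · rw [prod_range_succ, h1]; ring
      · rw [h2, hM i hi _ (restrictTo_mem_colourings _ _)]; ring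
    · congr 1
      · refine prod_congr rfl fun j hj => ?_
        rw [hval j f, hval j (restrictTo ((range i).biUnion X) f)]
        congr 1
        refine restrictTo_congr fun v hv => (restrictTo_of_mem ?_).symm
        exact mem_biUnion.2 ⟨j, hj, hv⟩
      · refine prod_congr rfl fun l hl => ?_
        rw [mem_filter, mem_range] at hl
        congr 1
        refine restrictTo_congr fun v hv => (restrictTo_of_mem ?_).symm
        exact hsub l hl.1 (by omega) i hl.2.2 hv
    · rw [← hval]
      congr 1
      refine prod_congr rfl fun l hl => ?_
      rw [mem_filter, mem_range] at hl
      congr 1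
      refine restrictTo_congr fun v hv => (restrictTo_of_mem ?_).symm
      have hl0 : 0 < l := by
        rcases Nat.eq_zero_or_pos l with rfl | h
        · omega
        · exact h
      rw [hS l hl0 hl.1, mem_inter, hl.2] at hv
      exact hv.2
  have hconst : ∀ d, 1 + d ≤ N → Z (1 + d) = Z 1 := by
    intro d
    induction d with
    | zero => intro _; rfl
    | succ d ih => intro hd; rw [← ih (by omega)]; exact hstep (1 + d) (by omega) (by omega)
  have hZ1 : Z 1 = M 0 0 := by
    rw [hM 0 hN 0 (mem_colourings.2 fun _ _ => rfl), hZ]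
    dsimp only
    have hr : ∀ g : V → Fin 3, restrictTo (S 0) g = 0 := fun g => by
      rw [hS0]; funext v; exact restrictTo_of_notMem (by simp)
    simp only [hr, filter_true, range_one, singleton_biUnion, prod_singleton]
    refine sum_congr rfl fun f hf => ?_
    congr 1
    · rw [hS0, sdiff_empty]
      refine (prod_subset (subset_univ _) fun v _ hv => ?_).symm
      rw [mem_colourings.1 hf v hv, hwt]
    · congr 2
      ext l
      simp only [mem_filter, mem_range]
      constructor
      · rintro ⟨h1, h2, h3⟩; omega
      · rintro ⟨h1, h2⟩
        rcases Nat.eq_zero_or_pos l with rfl | h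
        · omega
        · omega
  have hZN : Z N = ∑ f ∈ colourings ((range N).biUnion X),
      (∏ v, wt (f v)) * ∏ j ∈ range N, val j f := by
    refine sum_congr rfl fun f _ => ?_
    rw [filter_false_of_mem, prod_empty, mul_one]
    intro l hl
    rw [mem_range] at hl
    omega
  rw [← hZ1, ← hZN, ← hconst (N - 1) (by omega), Nat.add_sub_cancel' hN]

end Colourings

/-! ### Dominating sets and separated colourings. -/

section InclusionExclusion

open Finset Polynomial

variable {V : Type*} [Fintype V] [DecidableEq V]

/-- No vertex of colour 2 has a neighbour of colour 1. -/
def IsSeparated (G : SimpleGraph V) (f : V → Fin 3) : Prop :=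
  ∀ u v, G.Adj u v → f u = 1 → f v ≠ 2

/-- The weights of the colours. -/
noncomputable def colourWeight (R : Type*) [CommRing R] : Fin 3 → R[X] := ![1, X, -1]

open Classical in
/-- Counting dominating sets by inclusion and exclusion: colour 1 is the set, colour 2 is a set of
vertices that it does not dominate. -/
theorem sum_isSeparated (R : Type*) [CommRing R] (G : SimpleGraph V) :
    ∑ f : V → Fin 3, (∏ v, colourWeight R (f v)) * (if IsSeparated G f then 1 else 0) =
      ∑ D : Finset V, if IsDominatingSet G D then (X : R[X]) ^ D.card else 0 := by
  -- A weight per vertex that vanishes unless colour 1 is used exactly on `D` and colour 2 only at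
  -- vertices without neighbours in `D`. For fixed `D` the vertices become independent.
  set h : Finset V → V → Fin 3 → R[X] := fun D v c =>
    if v ∈ D then (if c = 1 then X else 0)
    else if c = 1 then 0 else if c = 2 then (if ∃ d ∈ D, G.Adj v d then 0 else -1) else 1 with hh
  have h1 : ∀ f : V → Fin 3,
      (∏ v, colourWeight R (f v)) * (if IsSeparated G f then 1 else 0) =
        ∑ D : Finset V, ∏ v, h D v (f v) := by
    intro f
    -- For every other `D` some vertex has the wrong membership, and its factor is 0.
    rw [sum_eq_single (univ.filter fun v => f v = 1)]
    · split_ifs with hs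
      · rw [mul_one]
        refine prod_congr rfl fun v _ => ?_
        have : f v = 0 ∨ f v = 1 ∨ f v = 2 := by
          generalize f v = c; fin_cases c <;> simp
        rcases this with hv | hv | hv
        · simp [hh, hv, colourWeight]
        · simp [hh, hv, colourWeight]
        · have : ¬ ∃ d, f d = 1 ∧ G.Adj v d := by
            rintro ⟨d, hd, hvd⟩
            exact hs d v hvd.symm hd hv
          simp [hh, hv, colourWeight, this]
      · rw [mul_zero]
        unfold IsSeparated at hs
        push Not at hs
        obtain ⟨u, v, huv, hu, hv⟩ := hs
        refine (prod_eq_zero (mem_univ v) ?_).symm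
        have : ∃ d, f d = 1 ∧ G.Adj v d := ⟨u, hu, huv.symm⟩
        simp [hh, hv, this]
    · intro D _ hD
      by_contra hne
      refine hD ?_
      ext v
      have hv : h D v (f v) ≠ 0 := fun h0 => hne (prod_eq_zero (mem_univ v) h0)
      simp only [mem_filter, mem_univ, true_and]
      by_contra hc
      refine hv ?_
      by_cases hvD : v ∈ D
      · have : f v ≠ 1 := fun h => hc ⟨fun _ => h, fun _ => hvD⟩
        simp [hh, hvD, this]
      · have : f v = 1 := by
          by_contra h
          exact hc ⟨fun h' => absurd h' hvD, fun h' => absurd h' h⟩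
        simp [hh, hvD, this]
    · intro hD; exact absurd (mem_univ _) hD
  rw [sum_congr rfl fun f _ => h1 f, sum_comm]
  refine sum_congr rfl fun D _ => ?_
  have h2 : ∑ f : V → Fin 3, ∏ v, h D v (f v) = ∏ v, ∑ c, h D v c := by
    rw [prod_univ_sum, Fintype.piFinset_univ]
  -- For an undominated vertex the colours 0 and 2 cancel: 1 - 1 = 0.
  have h3 : ∀ v, ∑ c, h D v c = if v ∈ D then X else if ∃ d ∈ D, G.Adj v d then 1 else 0 := by
    intro v
    rw [Fin.sum_univ_three]
    by_cases hv : v ∈ D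
    · simp [hh, hv]
    · by_cases hd : ∃ d ∈ D, G.Adj v d <;> simp [hh, hv, hd]
  rw [h2, prod_congr rfl fun v _ => h3 v]
  split_ifs with hD
  · rw [← prod_const, ← prod_subset (subset_univ D)]
    · exact prod_congr rfl fun v hv => if_pos hv
    · intro v _ hv
      rw [if_neg hv, if_pos (hD v hv)]
  · unfold IsDominatingSet at hD
    push Not at hD
    obtain ⟨v, hv, hd⟩ := hD
    refine prod_eq_zero (mem_univ v) ?_
    rw [if_neg hv, if_neg]
    rintro ⟨d, hdD, hvd⟩
    exact hd d hdD hvd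

omit [DecidableEq V] in
open Classical in
theorem coeff_sum_isDominatingSet (R : Type*) [CommRing R] (G : SimpleGraph V) (κ : ℕ) :
    (∑ D : Finset V, if IsDominatingSet G D then (X : R[X]) ^ D.card else 0).coeff κ =
      (numDominatingSets G κ : R) := by
  rw [finsetSum_coeff, numDominatingSets, Set.ncard_eq_toFinset_card', Set.toFinset_ofPred,
    card_filter, Nat.cast_sum]
  refine sum_congr rfl fun D _ => ?_
  by_cases hD : IsDominatingSet G D
  · simp only [hD, if_true, coeff_X_pow, and_true, eq_comm]
    split_ifs <;> simp
  · simp [hD]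

/-- A graph with a vertex is not dominated by the empty set, so at least one of the `2 ^ n` subsets
is missing. Therefore the residue modulo `2 ^ n` determines the number. -/
theorem numDominatingSets_lt {n : ℕ} (hn : 0 < n) (G : SimpleGraph (Fin n)) (κ : ℕ) :
    numDominatingSets G κ < 2 ^ n := by
  classical
  have hsub : {D : Finset (Fin n) | D.card = κ ∧ IsDominatingSet G D} ⊆
      {∅}ᶜ := by
    rintro D ⟨-, hD⟩ rfl
    obtain ⟨d, hd, -⟩ := hD ⟨0, hn⟩ (by simp)
    simp at hd
  have h1 := Set.ncard_le_ncard hsub (Set.toFinite _)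
  have h2 := Set.ncard_add_ncard_compl ({∅} : Set (Finset (Fin n)))
  rw [Set.ncard_singleton, Nat.card_eq_fintype_card, Fintype.card_finset, Fintype.card_fin] at h2
  unfold numDominatingSets
  omega

end InclusionExclusion

/-! ### Numbering the colourings of a bag in base three. -/

section Digits

open Finset

theorem sum_filter_lt_succ {M : Type*} [AddCommMonoid M] {n v : ℕ} (hv : v < n)
    (f : Fin n → M) :
    ∑ u ∈ univ.filter (fun u : Fin n => u.val < v + 1), f u =
      ∑ u ∈ univ.filter (fun u : Fin n => u.val < v), f u + f ⟨v, hv⟩ := by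
  rw [add_comm (∑ u ∈ _, f u), ← sum_insert (f := f) (a := ⟨v, hv⟩) (by simp)]
  congr 1
  ext u
  simp only [mem_filter, mem_univ, true_and, mem_insert, Fin.ext_iff]
  omega

theorem sum_filter_lt_self {M : Type*} [AddCommMonoid M] {n : ℕ} (f : Fin n → M) :
    ∑ u ∈ univ.filter (fun u : Fin n => u.val < n), f u = ∑ u, f u := by
  rw [filter_true_of_mem fun u _ => u.isLt]

theorem sum_filter_lt_zero {M : Type*} [AddCommMonoid M] {n : ℕ} (f : Fin n → M) :
    ∑ u ∈ univ.filter (fun u : Fin n => u.val < 0), f u = 0 := by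
  simp

variable {n : ℕ}

/-- The power of three whose exponent is the number of elements of `Y` below `v`. -/
def placePower (Y : Finset (Fin n)) (v : ℕ) : ℕ := 3 ^ (Y.filter fun u => u.val < v).card

/-- The place value of `v` in the base three numeral of a colouring of `Y`. -/
def placeValue (Y : Finset (Fin n)) (v : Fin n) : ℕ := if v ∈ Y then placePower Y v else 0

/-- The colouring of `Y` with number `c`. -/
def digitColouring (Y : Finset (Fin n)) (c : ℕ) : Fin n → Fin 3 :=
  fun v => if v ∈ Y then Fin.ofNat 3 (c / placePower Y v) else 0

/-- The number of a colouring. -/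
def colouringIndex (Y : Finset (Fin n)) (g : Fin n → Fin 3) : ℕ :=
  ∑ v, (g v).val * placeValue Y v

theorem placePower_zero (Y : Finset (Fin n)) : placePower Y 0 = 1 := by simp [placePower]

theorem placePower_last (Y : Finset (Fin n)) : placePower Y n = 3 ^ Y.card := by
  rw [placePower, filter_true_of_mem fun u _ => u.isLt]

theorem placePower_succ (Y : Finset (Fin n)) {v : ℕ} (hv : v < n) :
    placePower Y (v + 1) = if (⟨v, hv⟩ : Fin n) ∈ Y then placePower Y v * 3 else placePower Y v := by
  unfold placePower
  split_ifs with h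
  · rw [← pow_succ, ← card_insert_of_notMem (a := (⟨v, hv⟩ : Fin n))
      (s := Y.filter fun u => u.val < v) (by simp)]
    congr 2
    ext u
    simp only [mem_filter, mem_insert, Fin.ext_iff]
    constructor
    · rintro ⟨h1, h2⟩
      by_cases hu : u.val = v
      · exact Or.inl hu
      · exact Or.inr ⟨h1, by omega⟩
    · rintro (h1 | h1)
      · have : u = ⟨v, hv⟩ := Fin.ext h1
        exact ⟨this ▸ h, by omega⟩
      · exact ⟨h1.1, by omega⟩
  · congr 2
    ext u
    simp only [mem_filter]
    refine and_congr_right fun h1 => ?_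
    have : u.val ≠ v := fun h2 => h ((Fin.ext h2 : u = ⟨v, hv⟩) ▸ h1)
    omega

theorem placePower_mono (Y : Finset (Fin n)) {u v : ℕ} (h : u ≤ v) :
    placePower Y u ≤ placePower Y v := by
  refine Nat.pow_le_pow_right (by norm_num) (card_le_card fun x => ?_)
  simp only [mem_filter]
  exact fun hx => ⟨hx.1, by omega⟩

theorem placeValue_le (Y : Finset (Fin n)) (v : Fin n) : placeValue Y v ≤ 3 ^ Y.card := by
  unfold placeValue
  split_ifs
  · rw [← placePower_last]
    exact placePower_mono Y v.isLt.le
  · positivity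

/-- Digits are at most 2, so the digits below a place never add up to the power of three at that
place. -/
theorem partialIndex_lt (Y : Finset (Fin n)) (g : Fin n → Fin 3) {v : ℕ} (hv : v ≤ n) :
    ∑ u ∈ univ.filter (fun u : Fin n => u.val < v), (g u).val * placeValue Y u <
      placePower Y v := by
  induction v with
  | zero => simp [placePower_zero]
  | succ v ih =>
    rw [sum_filter_lt_succ (by omega), placePower_succ Y (show v < n by omega), placeValue]
    have h1 := ih (by omega)
    have h2 := (g ⟨v, by omega⟩).isLt
    split_ifs with h
    · have : (g ⟨v, by omega⟩).val * placePower Y v ≤ 2 * placePower Y v :=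
        Nat.mul_le_mul_right _ (by omega)
      show _ + (g ⟨v, _⟩).val * placePower Y v < _
      omega
    · omega

theorem colouringIndex_lt (Y : Finset (Fin n)) (g : Fin n → Fin 3) :
    colouringIndex Y g < 3 ^ Y.card := by
  have := partialIndex_lt Y g le_rfl
  rwa [sum_filter_lt_self, placePower_last] at this

theorem partialIndex_digitColouring (Y : Finset (Fin n)) (c : ℕ) {v : ℕ} (hv : v ≤ n) :
    ∑ u ∈ univ.filter (fun u : Fin n => u.val < v), (digitColouring Y c u).val * placeValue Y u =
      c % placePower Y v := by
  induction v with
  | zero => simp [placePower_zero, Nat.mod_one]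
  | succ v ih =>
    rw [sum_filter_lt_succ (by omega), placePower_succ Y (show v < n by omega), placeValue,
      ih (by omega)]
    split_ifs with h
    · rw [Nat.mod_mul, digitColouring, if_pos h, mul_comm]
      rfl
    · rw [mul_zero, add_zero]

theorem colouringIndex_digitColouring {Y : Finset (Fin n)} {c : ℕ} (hc : c < 3 ^ Y.card) :
    colouringIndex Y (digitColouring Y c) = c := by
  have := partialIndex_digitColouring Y c le_rfl
  rwa [sum_filter_lt_self, placePower_last, Nat.mod_eq_of_lt hc] at this

theorem digitColouring_mem (Y : Finset (Fin n)) (c : ℕ) :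
    digitColouring Y c ∈ colourings Y :=
  mem_colourings.2 fun _ hv => if_neg hv

theorem card_colourings (Y : Finset (Fin n)) : (colourings Y).card = 3 ^ Y.card := by
  have : colourings Y = Fintype.piFinset fun v => if v ∈ Y then (univ : Finset (Fin 3)) else {0} := by
    ext f
    rw [mem_colourings, Fintype.mem_piFinset]
    refine forall_congr' fun v => ?_
    split_ifs with h <;> simp [h]
  rw [this, Fintype.card_piFinset, ← prod_const, ← prod_subset (subset_univ Y)]
  · exact prod_congr rfl fun v hv => by rw [if_pos hv]; rfl
  · intro v _ hv
    rw [if_neg hv, card_singleton]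

/-- `digitColouring Y` is injective below `3 ^ Y.card`, having a left inverse there, and `colourings
Y` has just this many elements; so it is also surjective, and the inverse is two-sided. -/
theorem digitColouring_colouringIndex {Y : Finset (Fin n)} {g : Fin n → Fin 3}
    (hg : g ∈ colourings Y) : digitColouring Y (colouringIndex Y g) = g := by
  have himg : (range (3 ^ Y.card)).image (digitColouring Y) = colourings Y := by
    refine eq_of_subset_of_card_le ?_ ?_
    · intro f hf
      obtain ⟨c, -, rfl⟩ := mem_image.1 hf
      exact digitColouring_mem Y c
    · rw [card_colourings, card_image_of_injOn, card_range]
      intro c hc d hd h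
      rw [coe_range, Set.mem_Iio] at hc hd
      rw [← colouringIndex_digitColouring hc, ← colouringIndex_digitColouring hd]
      exact congrArg _ h
  rw [← himg] at hg
  obtain ⟨c, hc, rfl⟩ := mem_image.1 hg
  rw [colouringIndex_digitColouring (mem_range.1 hc)]

theorem sum_range_digitColouring {A : Type*} [AddCommMonoid A] (Y : Finset (Fin n))
    (Φ : (Fin n → Fin 3) → A) :
    ∑ c ∈ range (3 ^ Y.card), Φ (digitColouring Y c) = ∑ g ∈ colourings Y, Φ g := by
  refine sum_nbij' (digitColouring Y) (colouringIndex Y) ?_ ?_ ?_ ?_ ?_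
  · intro c _; exact digitColouring_mem Y c
  · intro g _; exact mem_range.2 (colouringIndex_lt Y g)
  · intro c hc; exact colouringIndex_digitColouring (mem_range.1 hc)
  · intro g hg; exact digitColouring_colouringIndex hg
  · intro c _; rfl

/-- What the digits of a number tell about the digits below a place and at this place. -/
theorem digit_eq {Y : Finset (Fin n)} (g : Fin n → Fin 3) (v : Fin n) (hv : v ∈ Y) :
    let rem := ∑ u ∈ univ.filter (fun u : Fin n => u.val < v.val + 1), (g u).val * placeValue Y u
    (g v).val = (1 - if rem < placeValue Y v then 1 else 0) +
      (1 - if rem < 2 * placeValue Y v then 1 else 0) := by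
  intro rem
  have h1 := partialIndex_lt Y g v.isLt.le
  have h2 : rem = _ := sum_filter_lt_succ v.isLt _
  have h3 : placeValue Y v = placePower Y v := if_pos hv
  simp only [Fin.eta, h3] at h2 ⊢
  have h4 := (g v).isLt
  rw [h2]
  obtain h | h | h : (g v).val = 0 ∨ (g v).val = 1 ∨ (g v).val = 2 := by omega
  · rw [h, if_pos (by omega), if_pos (by omega)]
  · rw [h, if_neg (by omega), if_pos (by omega)]
  · rw [h, if_neg (by omega), if_neg (by omega)]

end Digits

/-! ### The recursion for tables indexed by numbers of colourings. -/

section Tables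

open Finset Polynomial

variable {n : ℕ}

/-- Every weight is a sign times a power of `X`, so the program needs only a parity and a count to
produce it. -/
theorem prod_colourWeight (R : Type*) [CommRing R] {Y S : Finset (Fin n)} {g : Fin n → Fin 3}
    (hg : g ∈ colourings Y) :
    ∏ v ∈ Y \ S, colourWeight R (g v) =
      (-1) ^ (univ.filter fun v => v ∉ S ∧ g v = 2).card *
        X ^ (univ.filter fun v => v ∉ S ∧ g v = 1).card := by
  have h1 : ∏ v ∈ Y \ S, colourWeight R (g v) =
      ∏ v, (if v ∉ S ∧ g v = 2 then (-1 : R[X]) else 1) * (if v ∉ S ∧ g v = 1 then X else 1) := by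
    rw [← prod_subset (subset_univ (Y \ S))]
    · refine prod_congr rfl fun v hv => ?_
      rw [mem_sdiff] at hv
      generalize g v = c
      fin_cases c <;> simp [colourWeight, hv.2]
    · intro v _ hv
      by_cases hS : v ∈ S
      · simp [hS]
      · rw [mem_colourings.1 hg v (by simpa [hS] using hv)]
        simp
  simp only [h1, prod_mul_distrib, prod_ite, prod_const, one_pow, mul_one]

open Classical in
/-- A table that satisfies the recursion of the dynamic program counts the dominating sets. -/
theorem table_eq (R : Type*) [CommRing R] (G : SimpleGraph (Fin n)) {N : ℕ} (hN : 0 < N)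
    {X S : ℕ → Finset (Fin n)} {par : ℕ → ℕ}
    (hpar0 : N ≤ par 0) (hpar : ∀ j, 0 < j → j < N → par j < j)
    (hS0 : S 0 = ∅) (hS : ∀ j, 0 < j → j < N → S j = X j ∩ X (par j))
    (hX : ∀ i j, i < j → j < N → X j ∩ X i ⊆ X (par j))
    (hcov : ∀ v, ∃ j < N, v ∈ X j) (hadj : ∀ u v, G.Adj u v → ∃ j < N, u ∈ X j ∧ v ∈ X j)
    (T : ℕ → ℕ → R[X])
    (hT : ∀ j < N, ∀ r, T j r = ∑ c ∈ range (3 ^ (X j).card),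
      if IsSeparated G (digitColouring (X j) c) ∧
          colouringIndex (X j) (restrictTo (S j) (digitColouring (X j) c)) = r then
        (∏ v ∈ X j \ S j, colourWeight R (digitColouring (X j) c v)) *
          ∏ l ∈ (range N).filter (fun l => par l = j),
            T l (colouringIndex (X l) (digitColouring (X j) c))
      else 0) :
    T 0 0 = ∑ D : Finset (Fin n), if IsDominatingSet G D then Polynomial.X ^ D.card else 0 := by
  have hSX : ∀ j < N, S j ⊆ X j := by
    intro j hj
    rcases Nat.eq_zero_or_pos j with rfl | h0
    · rw [hS0]; exact empty_subset _
    · rw [hS j h0 hj]; exact inter_subset_left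
  have hsub : ∀ {S' Y : Finset (Fin n)} {f : Fin n → Fin 3}, S' ⊆ Y → f ∈ colourings S' →
      f ∈ colourings Y := fun h hf => mem_colourings.2 fun v hv =>
    mem_colourings.1 hf v fun hv' => hv (h hv')
  have hmain := sum_colourings_eq_message (A := R[X]) hN hpar0 hpar hS0 hS hX
    (wt := colourWeight R) rfl (fun j f => if IsSeparated G (restrictTo (X j) f) then 1 else 0)
    (fun j f => ?_) (fun j h => T j (colouringIndex (X j) h)) ?_
  · have h0 : colouringIndex (X 0) (0 : Fin n → Fin 3) = 0 := by simp [colouringIndex]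
    rw [h0] at hmain
    rw [hmain, ← sum_isSeparated]
    have hU : (range N).biUnion X = univ := by
      ext v
      simpa using hcov v
    rw [hU]
    have hC : colourings (univ : Finset (Fin n)) = univ := by
      ext f; simp [mem_colourings]
    rw [hC]
    refine sum_congr rfl fun f _ => ?_
    congr 1
    rw [prod_ite_zero]
    simp only [prod_const_one]
    refine if_congr ?_ rfl rfl
    -- Every edge lies in a bag, so the local conditions imply the global one. Conversely, vertices
    -- outside the bag are restricted to colour 0, which violates nothing.
    constructor
    · intro h u v huv hu hv
      obtain ⟨j, hj, hju, hjv⟩ := hadj u v huv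
      refine h j (mem_range.2 hj) u v huv ?_ ?_
      · rwa [restrictTo_of_mem hju]
      · rwa [restrictTo_of_mem hjv]
    · intro h j _ u v huv hu hv
      by_cases hju : u ∈ X j
      · by_cases hjv : v ∈ X j
        · rw [restrictTo_of_mem hju] at hu
          rw [restrictTo_of_mem hjv] at hv
          exact h u v huv hu hv
        · rw [restrictTo_of_notMem hjv] at hv
          exact absurd hv (by decide)
      · rw [restrictTo_of_notMem hju] at hu
        exact absurd hu (by decide)
  · congr 2
    exact restrictTo_congr fun v hv => (restrictTo_of_mem hv).symm
  · intro j hj h hh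
    rw [hT j hj, sum_range_digitColouring (X j) (fun g => if IsSeparated G g ∧
        colouringIndex (X j) (restrictTo (S j) g) = colouringIndex (X j) h then
        (∏ v ∈ X j \ S j, colourWeight R (g v)) *
          ∏ l ∈ (range N).filter (fun l => par l = j), T l (colouringIndex (X l) g)
      else 0), sum_filter]
    refine sum_congr rfl fun g hg => ?_
    have hgX : restrictTo (X j) g = g := by
      funext v
      by_cases hv : v ∈ X j
      · rw [restrictTo_of_mem hv]
      · rw [restrictTo_of_notMem hv, mem_colourings.1 hg v hv]
    -- Colourings of the separator are colourings of the bag, where the numbering is injective. So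
    -- entries for the separator can be addressed by numerals of the whole bag, and no second
    -- numbering is needed.
    have hidx : colouringIndex (X j) (restrictTo (S j) g) = colouringIndex (X j) h ↔
        restrictTo (S j) g = h := by
      constructor
      · intro he
        rw [← digitColouring_colouringIndex (hsub (hSX j hj) (restrictTo_mem_colourings (S j) g)),
          he, digitColouring_colouringIndex (hsub (hSX j hj) hh)]
      · intro he; rw [he]
    -- The place values of the child vanish outside its bag and `g` vanishes outside the bag of the
    -- parent; only the digits on the separator remain.
    have hchild : ∏ l ∈ (range N).filter (fun l => par l = j), T l (colouringIndex (X l) g) =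
        ∏ l ∈ (range N).filter (fun l => par l = j),
          T l (colouringIndex (X l) (restrictTo (S l) g)) := by
      refine prod_congr rfl fun l hl => ?_
      rw [mem_filter, mem_range] at hl
      have hl0 : 0 < l := by
        rcases Nat.eq_zero_or_pos l with rfl | h'
        · omega
        · exact h'
      congr 1
      refine sum_congr rfl fun v _ => ?_
      by_cases hvl : v ∈ X l
      · by_cases hvj : v ∈ X j
        · rw [restrictTo_of_mem]
          rw [hS l hl0 hl.1, hl.2, mem_inter]
          exact ⟨hvl, hvj⟩
        · rw [restrictTo_of_notMem, mem_colourings.1 hg v hvj]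
          rw [hS l hl0 hl.1, hl.2, mem_inter]
          exact fun h' => hvj h'.2
      · rw [placeValue, if_neg hvl, mul_zero, mul_zero]
    simp only [hidx, hgX, hchild]
    by_cases h1 : IsSeparated G g <;> by_cases h2 : restrictTo (S j) g = h <;> simp [h1, h2]

end Tables

namespace WordRAM

open Polynomial
open _root_.WordRAM.Expr (reg lit load)
open _root_.WordRAM.Program (assign store ite loop)

/-! ### Polynomial operations on the stored tables. -/

section Tables

variable {w n N S : ℕ} {σ τ : State w}

/-- Slot 0 holds `p`, the slots 2, 3, 4 hold 1, -1, 0, and the slots from 5 on hold the table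
`E`, row by row. -/
def Tables (n N S : ℕ) (p : (ZMod (2 ^ n))[X]) (E : ℕ → ℕ → (ZMod (2 ^ n))[X])
    (σ : State w) : Prop :=
  ∃ P, Slots n (5 + N * S) P σ ∧ P 0 = p ∧ P 2 = 1 ∧ P 3 = -1 ∧ P 4 = 0 ∧
    ∀ j < N, ∀ r < S, P (5 + (j * S + r)) = E j r

variable {p : (ZMod (2 ^ n))[X]} {E E' : ℕ → ℕ → (ZMod (2 ^ n))[X]}

theorem Tables.of_mem_eq (h : Tables n N S p E σ) (hm : τ.mem 3 = σ.mem 3) :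
    Tables n N S p E τ := by
  obtain ⟨P, h, h'⟩ := h
  exact ⟨P, h.of_mem_eq hm, h'⟩

theorem Tables.keep {b : ℕ} {A : List ℕ} (h : Tables n N S p E σ) (hk : Keep b A σ τ)
    (hA : 3 ∉ A) : Tables n N S p E τ :=
  h.of_mem_eq (hk.mem 3 (by norm_num) hA)

theorem Tables.congr (h : Tables n N S p E σ) (hE : ∀ j < N, ∀ r < S, E j r = E' j r) :
    Tables n N S p E' σ := by
  obtain ⟨P, h0, h1, h2, h3, h4, h5⟩ := h
  exact ⟨P, h0, h1, h2, h3, h4, fun j hj r hr => (h5 j hj r hr).trans (hE j hj r hr)⟩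

theorem table_slot_lt {j r : ℕ} (hj : j < N) (hr : r < S) : 5 + (j * S + r) < 5 + N * S := by
  have := add_mul_le_of_lt (L := S) hj
  omega

theorem table_slot_inj {j r j' r' : ℕ} (hr : r < S) (hr' : r' < S)
    (h : 5 + (j * S + r) = 5 + (j' * S + r')) : j = j' ∧ r = r' := by
  rcases lt_trichotomy j j' with h1 | h1 | h1
  · have := add_mul_le_of_lt (L := S) h1
    omega
  · subst h1
    exact ⟨rfl, by omega⟩
  · have := add_mul_le_of_lt (L := S) h1
    omega

variable (hw : 0 < w) (hn : 0 < n) (hg : Globals n σ)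
  (hK : (5 + N * S) * (n + 1) * numWords w n < 2 ^ w)

include hw hn hg hK

theorem wp_setMonomial_tables {s d : ℕ} (hT : Tables n N S p E σ) (hs : s < 2) (hd : d ≤ n)
    (h17 : σ.reg 17 = BitVec.ofNat w s) (h18 : σ.reg 18 = BitVec.ofNat w d) :
    wp setMonomial ((n + 1) * numWords w n * 32 + 200) (fun τ => Keep 25 [3] σ τ ∧
      Tables n N S ((-1) ^ s * X ^ d) E τ) σ := by
  obtain ⟨P, hP, h0, h2, h3, h4, h5⟩ := hT
  refine (wp_setMonomial hw hn hg hP hK (by omega) (by omega) hd h4 h17 h18).mono ?_ le_rfl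
  rintro τ ⟨hk, hτ⟩
  refine ⟨hk, _, hτ, ?_, ?_, ?_, ?_, fun j hj r hr => ?_⟩
  · rw [Function.update_self]
    obtain rfl | rfl : s = 0 ∨ s = 1 := by omega
    · rw [zero_add, h2, coeff_one_zero, pow_zero, one_mul, X_pow_eq_monomial]
    · rw [show 1 + 2 = 3 from rfl, h3, coeff_neg, coeff_one_zero, pow_one, neg_one_mul,
        X_pow_eq_monomial, monomial_neg]
  all_goals rw [Function.update_of_ne (by omega)]
  · exact h2
  · exact h3
  · exact h4
  · exact h5 j hj r hr

theorem wp_polyMul_tables {M : Program} {T j r : ℕ} (hM : MultipliesWithin M w n T)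
    (hT : numWords w n ≤ T) (hE : Tables n N S p E σ) (hj : j < N) (hr : r < S)
    (h19 : σ.reg 19 = BitVec.ofNat w (5 + (j * S + r))) :
    wp (polyMul M) ((n + 1) * (n + 1) * T * 700) (fun τ => Keep 20 [3] σ τ ∧
      Tables n N S (p * E j r) E τ) σ := by
  obtain ⟨P, hP, h0, h2, h3, h4, h5⟩ := hE
  refine (wp_polyMul hw hn hg hP hK hM hT (table_slot_lt hj hr) (by omega) h4 h19).mono ?_ le_rfl
  rintro τ ⟨hk, q, hτ⟩
  refine ⟨hk, _, hτ, ?_, ?_, ?_, ?_, fun j hj r hr => ?_⟩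
  · rw [Function.update_self, h0, h5 j hj r hr]
  all_goals rw [Function.update_of_ne (by omega), Function.update_of_ne (by omega)]
  · exact h2
  · exact h3
  · exact h4
  · exact h5 j hj r hr

theorem wp_polyAdd_tables {j r : ℕ} (hE : Tables n N S p E σ) (hj : j < N) (hr : r < S)
    (h19 : σ.reg 19 = BitVec.ofNat w (5 + (j * S + r))) :
    wp polyAdd ((n + 1) * (numWords w n * 40 + 60) + 6) (fun τ => Keep 20 [3] σ τ ∧
      Tables n N S p (fun j' r' => if j' = j ∧ r' = r then E j r + p else E j' r') τ) σ := by
  obtain ⟨P, hP, h0, h2, h3, h4, h5⟩ := hE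
  refine (wp_polyAdd hw hn hg hP hK (table_slot_lt hj hr) (by omega) h19).mono ?_ le_rfl
  rintro τ ⟨hk, hτ⟩
  refine ⟨hk, _, hτ, ?_, ?_, ?_, ?_, fun j' hj' r' hr' => ?_⟩
  · rw [Function.update_of_ne (by omega), h0]
  · rw [Function.update_of_ne (by omega), h2]
  · rw [Function.update_of_ne (by omega), h3]
  · rw [Function.update_of_ne (by omega), h4]
  · beta_reduce
    split_ifs with h
    · rw [h.1, h.2, Function.update_self, h0, h5 j hj r hr]
    · rw [Function.update_of_ne, h5 j' hj' r' hr']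
      intro h'
      exact h (table_slot_inj hr' hr h')

end Tables

/-! ### Loading a separator and decoding a colouring. -/

section NodeLoops

variable {w n N S : ℕ} {σ τ : State w} {G : SimpleGraph (Fin n)} {Y : ℕ → Finset (Fin n)}
  {ord par : ℕ → ℕ}

/-- Gives a value to loads from cells about which nothing is known. -/
theorem Ev.self (σ : State w) (e : Expr) : Ev σ e (e.eval σ).toNat :=
  (ofNat_toNat_self _).symm

open Classical in
/-- The constant data of the dynamic program: the graph, and the nodes in the order `ord`, with
their parents and bags and with the place values of the vertices in the bags. -/
structure Context (G : SimpleGraph (Fin n)) (N S : ℕ) (Y : ℕ → Finset (Fin n)) (ord par : ℕ → ℕ)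
    (σ : State w) : Prop where
  globals : Globals n σ
  reg_one : σ.reg 1 = BitVec.ofNat w N
  reg_five : σ.reg 5 = BitVec.ofNat w S
  graph : ∀ u v : Fin n,
    σ.mem 0 (BitVec.ofNat w (u * n + v)) = BitVec.ofNat w (if G.Adj u v then 1 else 0)
  bags : ∀ j < N, ∀ v : Fin n,
    σ.mem 2 (BitVec.ofNat w (ord j * n + v)) = BitVec.ofNat w (if v ∈ Y j then 1 else 0)
  order : ∀ j < N, σ.mem 5 (BitVec.ofNat w j) = BitVec.ofNat w (ord j)
  parents : ∀ j < N, σ.mem 6 (BitVec.ofNat w j) = BitVec.ofNat w (par j)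
  places : ∀ j < N, ∀ v : Fin n,
    σ.mem 7 (BitVec.ofNat w (ord j * n + v)) = BitVec.ofNat w (placeValue (Y j) v)
  sizes : ∀ j < N, σ.mem 8 (BitVec.ofNat w (ord j)) = BitVec.ofNat w (3 ^ (Y j).card)

theorem Context.keep {b : ℕ} {A : List ℕ} (h : Context G N S Y ord par σ) (hk : Keep b A σ τ)
    (hb : 6 ≤ b) (hA : ∀ a ∈ A, a = 3 ∨ 9 ≤ a) : Context G N S Y ord par τ := by
  have hm : ∀ a, a ≠ 3 → a < 9 → τ.mem a = σ.mem a := fun a h3 h9 =>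
    hk.mem a (by omega) fun h' => by have := hA a h'; omega
  constructor
  · exact h.globals.keep hk (by omega)
  · exact (hk.reg 1 (by omega)).trans h.reg_one
  · exact (hk.reg 5 (by omega)).trans h.reg_five
  · rw [hm 0 (by norm_num) (by norm_num)]; exact h.graph
  · rw [hm 2 (by norm_num) (by norm_num)]; exact h.bags
  · rw [hm 5 (by norm_num) (by norm_num)]; exact h.order
  · rw [hm 6 (by norm_num) (by norm_num)]; exact h.parents
  · rw [hm 7 (by norm_num) (by norm_num)]; exact h.places
  · rw [hm 8 (by norm_num) (by norm_num)]; exact h.sizes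

/-- Array 10 becomes the characteristic function of the intersection of the bag of the node
register 10 and the bag of its parent. -/
def loadSeparator : Program :=
  forUp 20 0 (store 10 (reg 20) (.op .lt (lit 0) (reg 10) *
    load 2 (load 5 (load 6 (reg 10)) * reg 0 + reg 20) * load 2 (reg 11 * reg 0 + reg 20)))

theorem wp_loadSeparator {Z : ℕ → Finset (Fin n)} {i : ℕ} (hc : Context G N S Y ord par σ)
    (hnw : n < 2 ^ w) (hNw : N < 2 ^ w) (hpar : ∀ j, 0 < j → j < N → par j < j)
    (hZ0 : Z 0 = ∅) (hZ : ∀ j, 0 < j → j < N → Z j = Y j ∩ Y (par j)) (hi : i < N)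
    (h10 : σ.reg 10 = BitVec.ofNat w i) (h11 : σ.reg 11 = BitVec.ofNat w (ord i)) :
    wp loadSeparator (n * 40 + 6) (fun τ => Keep 20 [10] σ τ ∧ ∀ v : Fin n,
      τ.mem 10 (BitVec.ofNat w v) = BitVec.ofNat w (if v ∈ Z i then 1 else 0)) σ := by
  refine wp.mono (wp_forUp (T := 25) (fun l τ => Keep 20 [10] σ τ ∧ ∀ v : Fin n, v.val < l →
      τ.mem 10 (BitVec.ofNat w v) = BitVec.ofNat w (if v ∈ Z i then 1 else 0))
      (by norm_num) hnw hc.globals.reg_zero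
      ⟨(Keep.refl σ).setReg (by norm_num) _, fun v hv => absurd hv (by omega)⟩ ?_)
      (fun τ ⟨h1, h2⟩ => ⟨h1, fun v => h2 v v.isLt⟩) (by omega)
  rintro l hl τ h20 h0 ⟨hk, hd⟩
  have hcτ : Context G N S Y ord par τ := hc.keep hk (by norm_num) (by simp)
  have h10' : τ.reg 10 = BitVec.ofNat w i := (hk.reg 10 (by norm_num)).trans h10
  have h11' : τ.reg 11 = BitVec.ofNat w (ord i) := (hk.reg 11 (by norm_num)).trans h11
  have e1 : Ev τ (load 2 (reg 11 * reg 0 + reg 20))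
      (if (⟨l, hl⟩ : Fin n) ∈ Y i then 1 else 0) :=
    (((Ev.reg h11').mul (Ev.reg h0)).add (Ev.reg h20)).load (hcτ.bags i hi ⟨l, hl⟩)
  have e : Ev τ (.op .lt (lit 0) (reg 10) *
      load 2 (load 5 (load 6 (reg 10)) * reg 0 + reg 20) * load 2 (reg 11 * reg 0 + reg 20))
      (if (⟨l, hl⟩ : Fin n) ∈ Z i then 1 else 0) := by
    have e0 := (Ev.lit (σ := τ) 0).lt (Ev.reg h10') (by omega) (by omega)
    -- The root has no parent, so the load through its parent entry gives an arbitrary word; the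
    -- factor `0 < i` annihilates it.
    rcases Nat.eq_zero_or_pos i with rfl | hi0
    · have := (e0.mul (Ev.self τ (load 2 (load 5 (load 6 (reg 10)) * reg 0 + reg 20)))).mul e1
      rw [if_neg (by omega), zero_mul, zero_mul] at this
      rw [hZ0, if_neg (by simp)]
      exact this
    · have hp := hpar i hi0 hi
      have := (e0.mul ((((((Ev.reg h10').load (hcτ.parents i hi)).load
        (hcτ.order (par i) (by omega))).mul (Ev.reg h0)).add (Ev.reg h20)).load
          (hcτ.bags (par i) (by omega) ⟨l, hl⟩))).mul e1
      rw [if_pos hi0, one_mul] at this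
      convert this using 1
      rw [hZ i hi0 hi]
      simp only [Finset.mem_inter]
      by_cases h1 : (⟨l, hl⟩ : Fin n) ∈ Y i <;> by_cases h2 : (⟨l, hl⟩ : Fin n) ∈ Y (par i) <;>
        simp [h1, h2]
  refine wp.of_le (wp_store (Ev.reg h20) e ⟨h20, h0,
    (hk.setMem (by simp) _ _).setReg (by norm_num) _, fun v hv => ?_⟩) ?_
  · rcases Nat.lt_succ_iff_lt_or_eq.1 hv with hv | hv
    · exact (setMem_mem_ne (by omega) (by omega) (by omega) _).trans (hd v hv)
    · have : v = ⟨l, hl⟩ := Fin.ext hv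
      subst this
      simp only [State.setReg, State.setMem, Function.update_self]
  · simp [Expr.cost]

/-- Array 9 becomes the colouring of the bag of node register 11 whose number is in
register 12. -/
def decodeColouring : Program :=
  assign 21 (reg 12) ;;
  forUp 20 0
    (assign 22 (reg 0 - (reg 20 + lit 1)) ;;
      assign 23 (load 7 (reg 11 * reg 0 + reg 22)) ;;
      assign 24 (load 2 (reg 11 * reg 0 + reg 22) *
        ((lit 1 - .op .lt (reg 21) (reg 23)) + (lit 1 - .op .lt (reg 21) (lit 2 * reg 23)))) ;;
      assign 21 (reg 21 - reg 24 * reg 23) ;;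
      store 9 (reg 22) (reg 24))

theorem wp_decodeColouring {i c : ℕ} {g : Fin n → Fin 3} (hc : Context G N S Y ord par σ)
    (hnw : n < 2 ^ w) (hcw : 2 * 3 ^ (Y i).card < 2 ^ w) (hi : i < N)
    (h11 : σ.reg 11 = BitVec.ofNat w (ord i)) (h12 : σ.reg 12 = BitVec.ofNat w c)
    (hg : g ∈ colourings (Y i)) (hgc : colouringIndex (Y i) g = c) :
    wp decodeColouring (n * 70 + 20) (fun τ => Keep 20 [9] σ τ ∧ ∀ v : Fin n,
      τ.mem 9 (BitVec.ofNat w v) = BitVec.ofNat w (g v)) σ := by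
  -- The digits are read from the highest place down, because the machine has no division: comparing
  -- the remainder with once and twice the place value gives the digit. After `l` rounds register 21
  -- contains the part of the number below place `n - l`.
  refine wp.mono (wp_assign_seq (Ev.reg h12) (wp_forUp (T := 62)
    (fun l τ => Keep 20 [9] σ τ ∧ (τ.reg 21 = BitVec.ofNat w (∑ u ∈ Finset.univ.filter
      (fun u : Fin n => u.val < n - l), (g u).val * placeValue (Y i) u)) ∧
      ∀ v : Fin n, n - l ≤ v.val → τ.mem 9 (BitVec.ofNat w v) = BitVec.ofNat w (g v))
      (by norm_num) hnw ((setReg_reg_ne (by norm_num) _).trans hc.globals.reg_zero)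
      ⟨((Keep.refl σ).setReg (by norm_num) _).setReg (by norm_num) _, ?_,
        fun v hv => absurd v.isLt (by omega)⟩ ?_))
      (fun τ ⟨h1, _, h2⟩ => ⟨h1, fun v => h2 v (by omega)⟩) ?_
  · rw [Nat.sub_zero, sum_filter_lt_self]
    change BitVec.ofNat w c = _
    rw [← hgc, colouringIndex]
  · rintro l hl τ h20 h0 ⟨hk, h21, hd⟩
    have hcτ : Context G N S Y ord par τ := hc.keep hk (by norm_num) (by simp)
    have h11' : τ.reg 11 = BitVec.ofNat w (ord i) := (hk.reg 11 (by norm_num)).trans h11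
    obtain ⟨v, hv⟩ : ∃ v, v = n - (l + 1) := ⟨_, rfl⟩
    have hvn : v < n := by omega
    set rem := ∑ u ∈ Finset.univ.filter (fun u : Fin n => u.val < n - l),
      (g u).val * placeValue (Y i) u with hrem
    have hlv : n - l = v + 1 := by omega
    rw [hlv] at hrem
    have hrem' := hrem
    rw [sum_filter_lt_succ hvn] at hrem'
    have hremlt : rem < 3 ^ (Y i).card := by
      rw [hrem]
      exact (partialIndex_lt _ _ (by omega)).trans_le
        ((placePower_mono _ (show v + 1 ≤ n by omega)).trans (placePower_last _).le)
    have hpl := placeValue_le (Y i) ⟨v, hvn⟩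
    have hdig : (g ⟨v, hvn⟩).val = (if (⟨v, hvn⟩ : Fin n) ∈ Y i then 1 else 0) *
        ((1 - if rem < placeValue (Y i) ⟨v, hvn⟩ then 1 else 0) +
          (1 - if rem < 2 * placeValue (Y i) ⟨v, hvn⟩ then 1 else 0)) := by
      by_cases hY : (⟨v, hvn⟩ : Fin n) ∈ Y i
      · rw [if_pos hY, one_mul, hrem]
        exact digit_eq g ⟨v, hvn⟩ hY
      · rw [if_neg hY, zero_mul, mem_colourings.1 hg _ hY]
        rfl
    have hle1 : ∀ q : Prop, [Decidable q] → (if q then 1 else 0) ≤ 1 := fun q _ => by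
      split_ifs <;> omega
    apply wp.of_le
    · apply wp_assign_seq (m := v)
      · rw [hv]
        exact (Ev.reg h0).sub ((Ev.reg h20).add (Ev.lit 1)) (by omega)
      apply wp_assign_seq (m := placeValue (Y i) ⟨v, hvn⟩)
      · exact Ev.load (Ev.add (Ev.mul (Ev.reg h11') (Ev.reg h0)) (Ev.reg rfl))
          (hcτ.places i hi ⟨v, hvn⟩)
      apply wp_assign_seq (m := (g ⟨v, hvn⟩).val)
      · rw [hdig]
        refine Ev.mul (Ev.load (Ev.add (Ev.mul (Ev.reg h11') (Ev.reg h0)) (Ev.reg rfl))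
          (hcτ.bags i hi ⟨v, hvn⟩)) (Ev.add ?_ ?_)
        · exact Ev.sub (Ev.lit 1) (Ev.lt (Ev.reg h21) (Ev.reg rfl) (by omega) (by omega)) (hle1 _)
        · exact Ev.sub (Ev.lit 1) (Ev.lt (Ev.reg h21) (Ev.mul (Ev.lit 2) (Ev.reg rfl)) (by omega)
            (by omega)) (hle1 _)
      apply wp_assign_seq (m := ∑ u ∈ Finset.univ.filter
        (fun u : Fin n => u.val < n - (l + 1)), (g u).val * placeValue (Y i) u)
      · rw [← hv]
        have : Ev (((τ.setReg 22 (BitVec.ofNat w v)).setReg 23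
          (BitVec.ofNat w (placeValue (Y i) ⟨v, hvn⟩))).setReg 24
          (BitVec.ofNat w (g ⟨v, hvn⟩).val)) (reg 21 - reg 24 * reg 23)
          (rem - (g ⟨v, hvn⟩).val * placeValue (Y i) ⟨v, hvn⟩) :=
          Ev.sub (Ev.reg h21) (Ev.mul (Ev.reg rfl) (Ev.reg rfl)) (by omega)
        rwa [hrem', Nat.add_sub_cancel] at this
      · refine wp_store (k := v) (m := (g ⟨v, hvn⟩).val) (Ev.reg rfl) (Ev.reg rfl)
          ⟨h20, h0, ?_, rfl, fun u hu => ?_⟩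
        · exact (((((hk.setReg (by norm_num) _).setReg (by norm_num) _).setReg
            (by norm_num) _).setReg (by norm_num) _).setMem (by simp) _ _).setReg (by norm_num) _
        · by_cases huv : u.val = v
          · have : u = ⟨v, hvn⟩ := Fin.ext huv
            subst this
            simp only [State.setReg, State.setMem, Function.update_self]
          · exact (setMem_mem_ne (by omega) (by omega) (by omega) _).trans (hd u (by omega))
    · simp [Expr.cost, Expr.cost_sub]
  · simp only [Expr.cost]; omega

end NodeLoops

end WordRAM

namespace WordRAM

open Polynomial
open _root_.WordRAM.Expr (reg lit load)
open _root_.WordRAM.Program (assign store ite loop)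

/-! ### The contribution of one colouring: test, weight and product over the children. -/

section NodeBody

variable {w n N S : ℕ} {σ τ : State w} {G : SimpleGraph (Fin n)} {Y : ℕ → Finset (Fin n)}
  {ord par : ℕ → ℕ}

theorem ite_one_zero_le (q : Prop) [Decidable q] : (if q then 1 else 0) ≤ 1 := by
  split_ifs <;> omega

/-- Register 16 becomes 1 or 0 according to whether the colouring in array 9 is separated. -/
def checkSeparated : Program :=
  assign 16 (lit 1) ;;
  forUp 20 0 (forUp 21 0 (assign 16 (reg 16 * (lit 1 - load 0 (reg 20 * reg 0 + reg 21) *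
    (.op .eq (load 9 (reg 20)) (lit 1) * .op .eq (load 9 (reg 21)) (lit 2))))))

open Classical in
theorem wp_checkSeparated {g : Fin n → Fin 3} (hc : Context G N S Y ord par σ)
    (hnw : n < 2 ^ w) (hw : 2 ≤ w)
    (hcol : ∀ v : Fin n, σ.mem 9 (BitVec.ofNat w v) = BitVec.ofNat w (g v)) :
    wp checkSeparated (n * (n * 40 + 20) + 10) (fun τ => Keep 16 [] σ τ ∧
      τ.reg 16 = BitVec.ofNat w (if IsSeparated G g then 1 else 0)) σ := by
  have h4w : 4 ≤ 2 ^ w := by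
    calc 4 = 2 ^ 2 := rfl
      _ ≤ 2 ^ w := Nat.pow_le_pow_right (by norm_num) hw
  set B : Fin n → Fin n → Prop := fun u v => G.Adj u v → g u = 1 → g v ≠ 2 with hB
  refine wp.mono (wp_assign_seq (Ev.lit 1) (wp_forUp (T := n * 40 + 10)
    (fun l τ => Keep 16 [] σ τ ∧ τ.reg 16 = BitVec.ofNat w
      (if ∀ u : Fin n, u.val < l → ∀ v, B u v then 1 else 0)) (by norm_num) hnw
      ((setReg_reg_ne (by norm_num) _).trans hc.globals.reg_zero)
      ⟨((Keep.refl σ).setReg (by norm_num) _).setReg (by norm_num) _, ?_⟩ ?_)) ?_ ?_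
  · rw [if_pos fun u hu => absurd hu (by omega)]
    rfl
  · rintro l hl τ h20 h0 ⟨hk, h16⟩
    refine wp.mono (wp_forUp (T := 30) (fun m τ => Keep 16 [] σ τ ∧ τ.reg 20 = BitVec.ofNat w l ∧
      τ.reg 16 = BitVec.ofNat w (if (∀ u : Fin n, u.val < l → ∀ v, B u v) ∧
        ∀ v : Fin n, v.val < m → B ⟨l, hl⟩ v then 1 else 0)) (by norm_num) hnw h0
        ⟨hk.setReg (by norm_num) _, h20, ?_⟩ ?_) ?_ (by omega)
    · refine h16.trans ?_
      congr 1
      refine if_congr ?_ rfl rfl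
      exact ⟨fun h => ⟨h, fun v hv => absurd hv (by omega)⟩, fun h => h.1⟩
    · rintro m hm ρ h21 h0 ⟨hkρ, h20, h16⟩
      have hcρ : Context G N S Y ord par ρ := hc.keep hkρ (by norm_num) (by simp)
      have hcol' : ∀ v : Fin n, ρ.mem 9 (BitVec.ofNat w v) = BitVec.ofNat w (g v) := fun v => by
        rw [hkρ.mem 9 (by norm_num) (by simp)]; exact hcol v
      have hgl : ∀ v, (g v).val < 2 ^ w := fun v => by have := (g v).isLt; omega
      have e := Ev.mul (Ev.reg h16) (Ev.sub (Ev.lit 1) (Ev.mul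
        (Ev.load (Ev.add (Ev.mul (Ev.reg h20) (Ev.reg h0)) (Ev.reg h21))
          (hcρ.graph ⟨l, hl⟩ ⟨m, hm⟩))
        (Ev.mul (Ev.eq (Ev.load (Ev.reg h20) (hcol' ⟨l, hl⟩)) (Ev.lit 1) (hgl _) (by omega))
          (Ev.eq (Ev.load (Ev.reg h21) (hcol' ⟨m, hm⟩)) (Ev.lit 2) (hgl _) (by omega))))
        (Nat.mul_le_mul (ite_one_zero_le _) (Nat.mul_le_mul (ite_one_zero_le _)
          (ite_one_zero_le _))))
      refine wp.of_le (wp_assign e ⟨h21, h0, (hkρ.setReg (by norm_num) _).setReg (by norm_num) _,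
        h20, ?_⟩) (by simp [Expr.cost, Expr.cost_sub])
      rw [setReg_reg_ne (by norm_num), setReg_reg_self]
      congr 1
      -- The scan goes row by row, and each pair multiplies the flag by its own indicator.
      have hstep : ((∀ u : Fin n, u.val < l → ∀ v, B u v) ∧
          ∀ v : Fin n, v.val < m + 1 → B ⟨l, hl⟩ v) ↔
          ((∀ u : Fin n, u.val < l → ∀ v, B u v) ∧ ∀ v : Fin n, v.val < m → B ⟨l, hl⟩ v) ∧
          B ⟨l, hl⟩ ⟨m, hm⟩ := by
        rw [and_assoc]
        refine and_congr_right fun _ => ⟨fun h => ⟨fun v hv => h v (by omega),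
          h ⟨m, hm⟩ (by simp)⟩, fun h v hv => ?_⟩
        rcases Nat.lt_succ_iff_lt_or_eq.1 hv with hv | hv
        · exact h.1 v hv
        · have : v = ⟨m, hm⟩ := Fin.ext hv
          rw [this]; exact h.2
      rw [if_congr hstep rfl rfl]
      have e1 : ((g ⟨l, hl⟩).val = 1) = (g ⟨l, hl⟩ = 1) := by rw [Fin.ext_iff]; rfl
      have e2 : ((g ⟨m, hm⟩).val = 2) = (g ⟨m, hm⟩ = 2) := by rw [Fin.ext_iff]; rfl
      simp only [hB, e1, e2]
      by_cases h1 : G.Adj ⟨l, hl⟩ ⟨m, hm⟩ <;> by_cases h2 : g ⟨l, hl⟩ = 1 <;>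
        by_cases h3 : g ⟨m, hm⟩ = 2 <;> simp [h1, h2, h3]
    · rintro ρ ⟨h1, h2, h3⟩
      refine ⟨h2, (h1.reg 0 (by norm_num)).trans hc.globals.reg_zero, h1.setReg (by norm_num) _, ?_⟩
      refine h3.trans ?_
      congr 1
      refine if_congr ?_ rfl rfl
      constructor
      · rintro ⟨h4, h5⟩ u hu v
        rcases Nat.lt_succ_iff_lt_or_eq.1 hu with hu | hu
        · exact h4 u hu v
        · have : u = ⟨l, hl⟩ := Fin.ext hu
          rw [this]; exact h5 v v.isLt
      · exact fun h => ⟨fun u hu => h u (by omega), fun v _ => h ⟨l, hl⟩ (by simp) v⟩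
  · rintro τ ⟨h1, h2⟩
    refine ⟨h1, h2.trans ?_⟩
    congr 1
    exact if_congr ⟨fun h u v => h u u.isLt v, fun h u _ v => h u v⟩ rfl rfl
  · have := Nat.mul_le_mul_left n (show n * 40 + 10 + 8 ≤ n * 40 + 20 by omega)
    simp only [Expr.cost]; omega

/-- For the colouring in array 9, register 18 becomes the number of vertices of colour 1 outside
the separator, register 17 the parity of the number of those of colour 2, and register 14 the
number of the restriction to the separator. -/
def summarizeColouring : Program :=
  assign 18 (lit 0) ;; assign 17 (lit 0) ;; assign 14 (lit 0) ;;
  forUp 20 0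
    (assign 22 (load 9 (reg 20)) ;; assign 23 (load 10 (reg 20)) ;;
      assign 18 (reg 18 + (lit 1 - reg 23) * .op .eq (reg 22) (lit 1)) ;;
      assign 17 (lit 1 - .op .eq (reg 17) ((lit 1 - reg 23) * .op .eq (reg 22) (lit 2))) ;;
      assign 14 (reg 14 + reg 23 * reg 22 * load 7 (reg 11 * reg 0 + reg 20)))

theorem wp_summarizeColouring {g : Fin n → Fin 3} {Z : Finset (Fin n)} {i : ℕ}
    (hc : Context G N S Y ord par σ) (hnw : n < 2 ^ w) (hw : 2 ≤ w) (hi : i < N)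
    (h11 : σ.reg 11 = BitVec.ofNat w (ord i))
    (hcol : ∀ v : Fin n, σ.mem 9 (BitVec.ofNat w v) = BitVec.ofNat w (g v))
    (hZ : ∀ v : Fin n, σ.mem 10 (BitVec.ofNat w v) = BitVec.ofNat w (if v ∈ Z then 1 else 0)) :
    wp summarizeColouring (n * 70 + 20) (fun τ => Keep 14 [] σ τ ∧
      τ.reg 18 = BitVec.ofNat w (Finset.univ.filter fun v => v ∉ Z ∧ g v = 1).card ∧
      τ.reg 17 = BitVec.ofNat w ((Finset.univ.filter fun v => v ∉ Z ∧ g v = 2).card % 2) ∧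
      τ.reg 14 = BitVec.ofNat w (colouringIndex (Y i) (restrictTo Z g))) σ := by
  have h4w : 4 ≤ 2 ^ w := by
    calc 4 = 2 ^ 2 := rfl
      _ ≤ 2 ^ w := Nat.pow_le_pow_right (by norm_num) hw
  refine wp.mono (wp_assign_seq (Ev.lit 0) (wp_assign_seq (Ev.lit 0) (wp_assign_seq (Ev.lit 0)
    (wp_forUp (T := 55) (fun l τ => Keep 14 [] σ τ ∧
      τ.reg 18 = BitVec.ofNat w (∑ u ∈ Finset.univ.filter (fun u : Fin n => u.val < l),
        if u ∉ Z ∧ g u = 1 then 1 else 0) ∧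
      τ.reg 17 = BitVec.ofNat w ((∑ u ∈ Finset.univ.filter (fun u : Fin n => u.val < l),
        if u ∉ Z ∧ g u = 2 then 1 else 0) % 2) ∧
      τ.reg 14 = BitVec.ofNat w (∑ u ∈ Finset.univ.filter (fun u : Fin n => u.val < l),
        (restrictTo Z g u).val * placeValue (Y i) u)) (by norm_num) hnw
      (by simpa [setReg_reg_ne] using hc.globals.reg_zero)
      ⟨((((Keep.refl σ).setReg (by norm_num) _).setReg (by norm_num) _).setReg
        (by norm_num) _).setReg (by norm_num) _, ?_, ?_, ?_⟩ ?_)))) ?_ ?_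
  · rw [sum_filter_lt_zero]; rfl
  · rw [sum_filter_lt_zero]; rfl
  · rw [sum_filter_lt_zero]; rfl
  · rintro l hl τ h20 h0 ⟨hk, h18, h17, h14⟩
    have hcτ : Context G N S Y ord par τ := hc.keep hk (by norm_num) (by simp)
    have hcol' : τ.mem 9 (BitVec.ofNat w l) = BitVec.ofNat w (g ⟨l, hl⟩) := by
      rw [hk.mem 9 (by norm_num) (by simp)]; exact hcol ⟨l, hl⟩
    have hZ' : τ.mem 10 (BitVec.ofNat w l) =
        BitVec.ofNat w (if (⟨l, hl⟩ : Fin n) ∈ Z then 1 else 0) := by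
      rw [hk.mem 10 (by norm_num) (by simp)]; exact hZ ⟨l, hl⟩
    have hgl : (g ⟨l, hl⟩).val < 2 ^ w := by have := (g ⟨l, hl⟩).isLt; omega
    set a := ∑ u ∈ Finset.univ.filter (fun u : Fin n => u.val < l),
        if u ∉ Z ∧ g u = 1 then 1 else 0 with ha
    set b := ∑ u ∈ Finset.univ.filter (fun u : Fin n => u.val < l),
        if u ∉ Z ∧ g u = 2 then 1 else 0 with hb
    have hb2 : b % 2 < 2 := Nat.mod_lt _ (by norm_num)
    have e1 : ((g ⟨l, hl⟩).val = 1) = (g ⟨l, hl⟩ = 1) := by rw [Fin.ext_iff]; rfl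
    have e2 : ((g ⟨l, hl⟩).val = 2) = (g ⟨l, hl⟩ = 2) := by rw [Fin.ext_iff]; rfl
    apply wp.of_le
    · apply wp_assign_seq (m := (g ⟨l, hl⟩).val)
      · exact Ev.load (Ev.reg h20) hcol'
      apply wp_assign_seq (m := if (⟨l, hl⟩ : Fin n) ∈ Z then 1 else 0)
      · exact Ev.load (Ev.reg h20) hZ'
      apply wp_assign_seq (m := a + if (⟨l, hl⟩ : Fin n) ∉ Z ∧ g ⟨l, hl⟩ = 1 then 1 else 0)
      · have : (if (⟨l, hl⟩ : Fin n) ∉ Z ∧ g ⟨l, hl⟩ = 1 then 1 else 0) =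
          (1 - if (⟨l, hl⟩ : Fin n) ∈ Z then 1 else 0) * if (g ⟨l, hl⟩).val = 1 then 1 else 0 := by
          simp only [e1]
          by_cases h1 : (⟨l, hl⟩ : Fin n) ∈ Z <;> by_cases h2 : g ⟨l, hl⟩ = 1 <;> simp [h1, h2]
        rw [this]
        exact Ev.add (Ev.reg h18) (Ev.mul (Ev.sub (Ev.lit 1) (Ev.reg rfl) (ite_one_zero_le _))
          (Ev.eq (Ev.reg rfl) (Ev.lit 1) hgl (by omega)))
      apply wp_assign_seq
        (m := (b + if (⟨l, hl⟩ : Fin n) ∉ Z ∧ g ⟨l, hl⟩ = 2 then 1 else 0) % 2)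
      -- Addition of bits modulo 2 is the negation of equality.
      · have : (b + if (⟨l, hl⟩ : Fin n) ∉ Z ∧ g ⟨l, hl⟩ = 2 then 1 else 0) % 2 =
          1 - if b % 2 = (1 - if (⟨l, hl⟩ : Fin n) ∈ Z then 1 else 0) *
            (if (g ⟨l, hl⟩).val = 2 then 1 else 0) then 1 else 0 := by
          simp only [e2]
          by_cases h1 : (⟨l, hl⟩ : Fin n) ∈ Z <;> by_cases h2 : g ⟨l, hl⟩ = 2 <;>
            simp only [h1, h2, not_true, not_false_eq_true, and_false, and_true,
              if_true, if_false] <;> split_ifs <;> omega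
        rw [this]
        have hlt : (1 - if (⟨l, hl⟩ : Fin n) ∈ Z then 1 else 0) *
            (if (g ⟨l, hl⟩).val = 2 then 1 else 0) ≤ 1 * 1 :=
          Nat.mul_le_mul (by omega) (ite_one_zero_le _)
        exact Ev.sub (Ev.lit 1) (Ev.eq (Ev.reg h17) (Ev.mul (Ev.sub (Ev.lit 1) (Ev.reg rfl)
          (ite_one_zero_le _)) (Ev.eq (Ev.reg rfl) (Ev.lit 2) hgl (by omega))) (by omega)
          (by omega)) (ite_one_zero_le _)
      · have hr : (restrictTo Z g ⟨l, hl⟩).val =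
            (if (⟨l, hl⟩ : Fin n) ∈ Z then 1 else 0) * (g ⟨l, hl⟩).val := by
          by_cases h1 : (⟨l, hl⟩ : Fin n) ∈ Z
          · rw [restrictTo_of_mem h1, if_pos h1, one_mul]
          · rw [restrictTo_of_notMem h1, if_neg h1, zero_mul]; rfl
        refine wp_assign (m := (∑ u ∈ Finset.univ.filter (fun u : Fin n => u.val < l),
          (restrictTo Z g u).val * placeValue (Y i) u) + (restrictTo Z g ⟨l, hl⟩).val * placeValue (Y i) ⟨l, hl⟩)
          ?_ ⟨h20, h0, ?_, ?_, ?_, ?_⟩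
        · rw [hr]
          exact Ev.add (Ev.reg h14) (Ev.mul (Ev.mul (Ev.reg rfl) (Ev.reg rfl))
            (Ev.load (Ev.add (Ev.mul (Ev.reg ((hk.reg 11 (by norm_num)).trans h11)) (Ev.reg h0))
              (Ev.reg h20)) (hcτ.places i hi ⟨l, hl⟩)))
        · exact (((((hk.setReg (by norm_num) _).setReg (by norm_num) _).setReg
            (by norm_num) _).setReg (by norm_num) _).setReg (by norm_num) _).setReg (by norm_num) _
        · rw [sum_filter_lt_succ hl]; rfl
        · rw [sum_filter_lt_succ hl]; rfl
        · rw [sum_filter_lt_succ hl]; rfl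
    · simp [Expr.cost, Expr.cost_sub]
  · rintro τ ⟨h1, h2, h3, h4⟩
    rw [sum_filter_lt_self, ← Finset.card_filter] at h2 h3
    rw [sum_filter_lt_self] at h4
    exact ⟨h1, h2, h3, h4⟩
  · simp only [Expr.cost]; omega

/-- Multiplies slot 0 by the entries of the table for all children of the node register 10 at the
colouring in array 9. -/
def multiplyChildren (M : Program) : Program :=
  forUp 15 1 (ite (.op .eq (load 6 (reg 15)) (reg 10))
    (assign 23 (load 5 (reg 15)) ;; assign 19 (lit 0) ;;
      forUp 20 0 (assign 19 (reg 19 + load 9 (reg 20) * load 7 (reg 23 * reg 0 + reg 20))) ;;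
      assign 19 (lit 5 + (reg 15 * reg 5 + reg 19)) ;; polyMul M)
    .skip)

/-- All nodes are scanned, but only children cost a polynomial product. The bound therefore
separates the cheap scan from the number of children, which is summed over all nodes later. -/
theorem wp_multiplyChildren {M : Program} {T i : ℕ} {g : Fin n → Fin 3}
    {p : (ZMod (2 ^ n))[X]} {E : ℕ → ℕ → (ZMod (2 ^ n))[X]} (hw : 0 < w) (hn : 0 < n)
    (hK : (5 + N * S) * (n + 1) * numWords w n < 2 ^ w) (hM : MultipliesWithin M w n T)
    (hT : numWords w n ≤ T) (hc : Context G N S Y ord par σ) (hnw : n < 2 ^ w)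
    (hNw : N < 2 ^ w) (hpar : ∀ j < N, par j ≤ N) (hS : ∀ j < N, 3 ^ (Y j).card ≤ S) (hi : i < N)
    (h10 : σ.reg 10 = BitVec.ofNat w i)
    (hcol : ∀ v : Fin n, σ.mem 9 (BitVec.ofNat w v) = BitVec.ofNat w (g v))
    (hE : Tables n N S p E σ) :
    wp (multiplyChildren M) (N * 20 + ((Finset.range N).filter fun j => par j = i).card *
        (n * 40 + 50 + (n + 1) * (n + 1) * T * 700) + 6) (fun τ => Keep 15 [3] σ τ ∧
      Tables n N S (p * ∏ j ∈ (Finset.range N).filter (fun j => par j = i),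
        E j (colouringIndex (Y j) g)) E τ) σ := by
  refine wp.of_le (wp_forUp_sum (fun l τ => Keep 15 [3] σ τ ∧
    Tables n N S (p * ∏ j ∈ (Finset.range l).filter (fun j => par j = i),
        E j (colouringIndex (Y j) g)) E τ)
      (fun j => 8 + if par j = i then n * 40 + 50 + (n + 1) * (n + 1) * T * 700 else 0)
      (by norm_num) hNw hc.reg_one
      ⟨(Keep.refl σ).setReg (by norm_num) _, by
        rw [Finset.range_zero, Finset.filter_empty, Finset.prod_empty, mul_one]
        exact hE.of_mem_eq rfl⟩ ?_) ?_
  · rintro j hj τ h15 h1 ⟨hk, hEτ⟩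
    have hcτ : Context G N S Y ord par τ := hc.keep hk (by norm_num) (by simp)
    have hpj := hpar j hj
    have h10' := (hk.reg 10 (by norm_num)).trans h10
    -- Words can be compared because `par j ≤ N < 2 ^ w`.
    have e := Ev.eq (Ev.load (Ev.reg h15) (hcτ.parents j hj)) (Ev.reg h10') (by omega) (by omega)
    by_cases hji : par j = i
    · rw [if_pos hji] at e
      have hk₁ : Keep 15 [3] σ ((τ.setReg 23 (BitVec.ofNat w (ord j))).setReg 19
        (BitVec.ofNat w 0)) := (hk.setReg (by norm_num) _).setReg (by norm_num) _
      refine wp.of_le (wp_ite_pos e one_ne_zero (by omega) (wp_assign_seq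
        (Ev.load (Ev.reg h15) (hcτ.order j hj)) (wp_assign_seq (Ev.lit 0)
        (wp_seq (wp_forUp (T := 15) (fun l ρ => Keep 15 [3] σ ρ ∧
          Tables n N S (p * ∏ j ∈ (Finset.range j).filter (fun j => par j = i),
            E j (colouringIndex (Y j) g)) E ρ ∧ ρ.reg 15 = BitVec.ofNat w j ∧
          ρ.reg 23 = BitVec.ofNat w (ord j) ∧
          ρ.reg 19 = BitVec.ofNat w (∑ u ∈ Finset.univ.filter (fun u : Fin n => u.val < l),
            (g u).val * placeValue (Y j) u)) (m := n) (by norm_num) hnw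
            hcτ.globals.reg_zero ⟨hk₁.setReg (by norm_num) _, hEτ.of_mem_eq rfl, h15, rfl, ?_⟩ ?_)
          (T₂ := 20 + (n + 1) * (n + 1) * T * 700) ?_)))) ?_
      · rw [sum_filter_lt_zero]; rfl
      · rintro l hl ρ h20 h0 ⟨hkρ, hEρ, h15, h23, h19⟩
        have hcρ : Context G N S Y ord par ρ := hc.keep hkρ (by norm_num) (by simp)
        have hcol' : ρ.mem 9 (BitVec.ofNat w l) = BitVec.ofNat w (g ⟨l, hl⟩) := by
          rw [hkρ.mem 9 (by norm_num) (by simp)]; exact hcol ⟨l, hl⟩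
        refine wp.of_le (wp_assign (Ev.add (Ev.reg h19) (Ev.mul (Ev.load (Ev.reg h20) hcol')
          (Ev.load (Ev.add (Ev.mul (Ev.reg h23) (Ev.reg h0)) (Ev.reg h20))
            (hcρ.places j hj ⟨l, hl⟩)))) ⟨h20, h0, (hkρ.setReg (by norm_num) _).setReg
              (by norm_num) _, hEρ.of_mem_eq rfl, h15, h23, ?_⟩) (by simp [Expr.cost])
        rw [sum_filter_lt_succ hl]
        rfl
      · rintro ρ ⟨hkρ, hEρ, h15, h23, h19⟩
        have hcρ : Context G N S Y ord par ρ := hc.keep hkρ (by norm_num) (by simp)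
        rw [sum_filter_lt_self] at h19
        have hk₂ : Keep 15 [3] σ (ρ.setReg 19 (BitVec.ofNat w (5 + (j * S +
          colouringIndex (Y j) g)))) := hkρ.setReg (by norm_num) _
        refine wp.of_le (wp_assign_seq (m := 5 + (j * S + colouringIndex (Y j) g))
          (Ev.add (Ev.lit 5) (Ev.add (Ev.mul (Ev.reg h15) (Ev.reg hcρ.reg_five)) (Ev.reg h19)))
          (wp.mono (wp_polyMul_tables (j := j) (r := colouringIndex (Y j) g) hw hn
            (hc.globals.keep hk₂ (by norm_num)) hK hM hT (hEρ.of_mem_eq rfl) hj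
              ((colouringIndex_lt _ _).trans_le (hS j hj)) rfl) ?_ le_rfl)) ?_
        · rintro π ⟨h3, h4⟩
          refine ⟨(h3.reg 15 (by norm_num)).trans h15,
            (h3.reg 1 (by norm_num)).trans ((hk₂.reg 1 (by norm_num)).trans hc.reg_one),
            (hk₂.trans (h3.mono (by norm_num) (by simp))).setReg (by norm_num) _, ?_⟩
          rw [Finset.range_add_one, Finset.filter_insert, if_pos hji, Finset.prod_insert (by simp),
            mul_comm (E j _), ← mul_assoc]
          exact h4.of_mem_eq rfl
        · simp only [Expr.cost]; omega
      · rw [if_pos hji]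
        simp only [Expr.cost]; omega
    · rw [if_neg hji] at e
      refine wp.of_le (wp_ite_neg e (wp_skip ⟨h15, h1, hk.setReg (by norm_num) _, ?_⟩)) ?_
      · rw [Finset.range_add_one, Finset.filter_insert, if_neg hji]
        exact hEτ.of_mem_eq rfl
      · simp only [Expr.cost]; omega
  · rw [Finset.card_filter, Finset.sum_mul]
    simp only [Finset.sum_add_distrib, Finset.sum_const, Finset.card_range, smul_eq_mul]
    simp only [ite_mul, one_mul, zero_mul]
    omega

end NodeBody

end WordRAM

namespace WordRAM

open Polynomial
open _root_.WordRAM.Expr (reg lit load)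
open _root_.WordRAM.Program (assign store ite loop)

/-! ### The table of a node, and all tables. -/

section Node

variable {w n N S : ℕ} {σ τ : State w} {G : SimpleGraph (Fin n)} {Y : ℕ → Finset (Fin n)}
  {ord par : ℕ → ℕ}

open Classical in
/-- The contribution of the colouring with number `c` of the bag of node `i` to the entry
`r` of its table, for the separator `Z` of the bag and the tables `E` of the children. -/
noncomputable def tableTerm (G : SimpleGraph (Fin n)) (N : ℕ) (Y : ℕ → Finset (Fin n))
    (par : ℕ → ℕ) (i : ℕ) (Z : Finset (Fin n)) (E : ℕ → ℕ → (ZMod (2 ^ n))[X]) (c r : ℕ) :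
    (ZMod (2 ^ n))[X] :=
  if IsSeparated G (digitColouring (Y i) c) ∧
      colouringIndex (Y i) (restrictTo Z (digitColouring (Y i) c)) = r then
    (∏ v ∈ Y i \ Z, colourWeight (ZMod (2 ^ n)) (digitColouring (Y i) c v)) *
      ∏ l ∈ (Finset.range N).filter (fun l => par l = i),
        E l (colouringIndex (Y l) (digitColouring (Y i) c))
  else 0

/-- Only the rows of the children are read, and these within the stored range. So a term stays the
same while the row of the node itself is being accumulated or earlier rows are still empty. -/
theorem tableTerm_congr {i : ℕ} {Z : Finset (Fin n)} {E E' : ℕ → ℕ → (ZMod (2 ^ n))[X]}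
    (hS : ∀ j < N, 3 ^ (Y j).card ≤ S)
    (h : ∀ l < N, par l = i → ∀ r < S, E l r = E' l r) (c r : ℕ) :
    tableTerm G N Y par i Z E c r = tableTerm G N Y par i Z E' c r := by
  unfold tableTerm
  congr 2
  refine Finset.prod_congr rfl fun l hl => ?_
  rw [Finset.mem_filter, Finset.mem_range] at hl
  exact h l hl.1 hl.2 _ ((colouringIndex_lt _ _).trans_le (hS l hl.1))

/-- Adds the contribution of the colouring number register 12 to the table of the node register
10. -/
def nodeBody (M : Program) : Program :=
  decodeColouring ;; checkSeparated ;;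
  ite (reg 16)
    (summarizeColouring ;; setMonomial ;; multiplyChildren M ;;
      assign 19 (lit 5 + (reg 10 * reg 5 + reg 14)) ;; polyAdd)
    .skip

theorem wp_nodeBody {M : Program} {T i c : ℕ} {Z : Finset (Fin n)}
    {p : (ZMod (2 ^ n))[X]} {E : ℕ → ℕ → (ZMod (2 ^ n))[X]} (hw : 2 ≤ w) (hn : 0 < n)
    (hK : (5 + N * S) * (n + 1) * numWords w n < 2 ^ w) (hM : MultipliesWithin M w n T)
    (hT : numWords w n ≤ T) (hc : Context G N S Y ord par σ) (hnw : n < 2 ^ w)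
    (hNw : N < 2 ^ w) (hpar : ∀ j < N, par j ≤ N) (hS : ∀ j < N, 3 ^ (Y j).card ≤ S)
    (hYw : 2 * 3 ^ (Y i).card < 2 ^ w) (hi : i < N)
    (h10 : σ.reg 10 = BitVec.ofNat w i) (h11 : σ.reg 11 = BitVec.ofNat w (ord i))
    (h12 : σ.reg 12 = BitVec.ofNat w c) (hcY : c < 3 ^ (Y i).card)
    (hZ : ∀ v : Fin n, σ.mem 10 (BitVec.ofNat w v) = BitVec.ofNat w (if v ∈ Z then 1 else 0))
    (hE : Tables n N S p E σ) :
    wp (nodeBody M) (N * 20 + (n + 1) * (n + 1) * T * 1000 +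
        ((Finset.range N).filter fun j => par j = i).card * ((n + 1) * (n + 1) * T * 800))
      (fun τ => Keep 14 [3, 9] σ τ ∧ ∃ p', Tables n N S p'
        (fun j r => if j = i then E i r + tableTerm G N Y par i Z E c r else E j r) τ) σ := by
  have hL : 0 < numWords w n := numWords_pos (by omega) hn
  set g := digitColouring (Y i) c with hg
  set r₀ := colouringIndex (Y i) (restrictTo Z g) with hr₀
  have hrS : r₀ < S := (colouringIndex_lt _ _).trans_le (hS i hi)
  have hgY : g ∈ colourings (Y i) := digitColouring_mem _ _
  set ch := ((Finset.range N).filter fun j => par j = i).card with hch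
  -- The unit of time for one colouring: the check of separation is quadratic in `n`, the other
  -- operations on slots are linear in `(n + 1) * numWords w n`, and `T ≥ numWords w n ≥ 1`.
  set q := (n + 1) * (n + 1) * T with hq
  have q1 : (n + 1) * (n + 1) ≤ q := Nat.le_mul_of_pos_right _ (by omega)
  have q2 : (n + 1) * numWords w n ≤ q :=
    Nat.mul_le_mul (Nat.le_mul_of_pos_right _ (by omega)) hT
  have q3 : ch * (n * 40 + 50 + q * 700) ≤ ch * (q * 800) := Nat.mul_le_mul_left _ (by nlinarith)
  have q6 : n + 1 ≤ q := (Nat.le_mul_of_pos_right _ (by omega)).trans q1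
  have q4 : n * (n * 40 + 20) + 100 * n + 40 ≤ 100 * q := by nlinarith
  have q5 : (n + 1) * (numWords w n * 40 + 60) ≤ 100 * q := by nlinarith
  refine wp.of_le (wp_seq (T₂ := N * 20 + q * 700 + ch * (q * 800))
    (wp_decodeColouring hc hnw hYw hi h11 h12 hgY
    (colouringIndex_digitColouring hcY)) ?_)
    (by omega)
  rintro τ ⟨hk₁, hcol₁⟩
  have hc₁ := hc.keep hk₁ (by norm_num) (by simp)
  refine wp.of_le (wp_seq (T₂ := N * 20 + q * 600 + ch * (q * 800))
    (wp_checkSeparated hc₁ hnw hw hcol₁) ?_)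
    (by omega)
  rintro ρ ⟨hk₂, h16⟩
  have hk₁₂ : Keep 16 [3, 9] σ ρ := (hk₁.mono (by norm_num) (by simp)).trans
    (hk₂.mono le_rfl (by simp))
  have hc₂ := hc₁.keep hk₂ (by norm_num) (by simp)
  have hE₁ := hE.keep hk₁ (by simp)
  have hE₂ := hE₁.keep hk₂ (by simp)
  by_cases hsep : IsSeparated G g
  · rw [if_pos hsep] at h16
    have hcol₂ : ∀ v : Fin n, ρ.mem 9 (BitVec.ofNat w v) = BitVec.ofNat w (g v) := fun v => by
      rw [hk₂.mem 9 (by norm_num) (by simp)]; exact hcol₁ v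
    have hZ₂ : ∀ v : Fin n, ρ.mem 10 (BitVec.ofNat w v) =
        BitVec.ofNat w (if v ∈ Z then 1 else 0) := fun v => by
      rw [hk₁₂.mem 10 (by norm_num) (by simp)]; exact hZ v
    refine wp.of_le (wp_ite_pos (T := N * 20 + q * 500 + ch * (q * 800)) (Ev.reg h16)
      one_ne_zero (by omega) ?_) (by simp only [Expr.cost]; omega)
    refine wp.of_le (wp_seq (T₂ := N * 20 + q * 400 + ch * (q * 800))
      (wp_summarizeColouring hc₂ hnw hw hi
      ((hk₁₂.reg 11 (by norm_num)).trans h11) hcol₂ hZ₂) ?_)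
      (by omega)
    rintro π ⟨hk₃, h18, h17, h14⟩
    have hc₃ := hc₂.keep hk₃ (by norm_num) (by simp)
    have hk₁₃ : Keep 14 [3, 9] σ π := (hk₁₂.mono (by norm_num) (by simp)).trans
      (hk₃.mono le_rfl (by simp))
    refine wp.of_le (wp_seq (T₂ := N * 20 + q * 160 + ch * (q * 800))
      (wp_setMonomial_tables (by omega) hn hc₃.globals hK
      (hE₂.keep hk₃ (by simp)) (Nat.mod_lt _ (by norm_num)) ?_ h17 h18) ?_)
      (by omega)
    · exact (Finset.card_le_univ _).trans (Fintype.card_fin n).le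
    rintro π₁ ⟨hk₄, hE₄⟩
    have hc₄ := hc₃.keep hk₄ (by norm_num) (by simp)
    have hk₁₄ : Keep 14 [3, 9] σ π₁ := hk₁₃.trans (hk₄.mono (by norm_num) (by simp))
    have hcol₄ : ∀ v : Fin n, π₁.mem 9 (BitVec.ofNat w v) = BitVec.ofNat w (g v) := fun v => by
      rw [hk₄.mem 9 (by norm_num) (by simp), hk₃.mem 9 (by norm_num) (by simp)]; exact hcol₂ v
    refine wp.of_le (wp_seq (T₂ := q * 150)
      (wp_multiplyChildren (by omega) hn hK hM hT hc₄ hnw hNw hpar hS hi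
      ((hk₁₄.reg 10 (by norm_num)).trans h10) hcol₄ hE₄) ?_)
      (by simp only [← hch, ← hq]; omega)
    rintro π₂ ⟨hk₅, hE₅⟩
    have hk₁₅ : Keep 14 [3, 9] σ π₂ := hk₁₄.trans (hk₅.mono (by norm_num) (by simp))
    have hc₅ := hc₄.keep hk₅ (by norm_num) (by simp)
    have h14₅ : π₂.reg 14 = BitVec.ofNat w r₀ :=
      ((hk₅.reg 14 (by norm_num)).trans (hk₄.reg 14 (by norm_num))).trans h14
    have h10₅ := (hk₁₅.reg 10 (by norm_num)).trans h10
    have hk₆ : Keep 14 [3, 9] σ (π₂.setReg 19 (BitVec.ofNat w (5 + (i * S + r₀)))) :=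
      hk₁₅.setReg (by norm_num) _
    refine wp.of_le (wp_assign_seq (m := 5 + (i * S + r₀)) (Ev.add (Ev.lit 5) (Ev.add
      (Ev.mul (Ev.reg h10₅) (Ev.reg hc₅.reg_five)) (Ev.reg h14₅)))
      (wp.mono (wp_polyAdd_tables (j := i) (r := r₀) (by omega) hn
        (hc.globals.keep hk₆ (by norm_num)) hK (hE₅.of_mem_eq rfl) hi hrS rfl) ?_ le_rfl))
      (by simp only [Expr.cost]; omega)
    rintro π₃ ⟨hk₇, hE₇⟩
    refine ⟨hk₆.trans (hk₇.mono (by norm_num) (by simp)), _, hE₇.congr fun j hj r hr => ?_⟩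
    by_cases hji : j = i
    · subst hji
      rw [if_pos rfl]
      unfold tableTerm
      rw [← hg]
      by_cases hr : r = r₀
      · subst hr
        rw [if_pos ⟨rfl, rfl⟩, if_pos ⟨hsep, rfl⟩, prod_colourWeight _ hgY]
        -- The program keeps the exponent of -1 only modulo 2.
        congr 3
        exact (neg_one_pow_eq_pow_mod_two _).symm
      · rw [if_neg (fun h => hr h.2), if_neg (fun h => hr h.2.symm), add_zero]
    · rw [if_neg (fun h => hji h.1), if_neg hji]
  · rw [if_neg hsep] at h16
    refine wp.of_le (wp_ite_neg (Ev.reg h16) (wp_skip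
      ⟨hk₁₂.mono (by norm_num) (by simp), p, hE₂.congr fun j _ r _ => ?_⟩))
      (by simp only [Expr.cost]; omega)
    by_cases hji : j = i
    · subst hji
      rw [if_pos rfl, tableTerm, if_neg (fun h => hsep h.1), add_zero]
    · rw [if_neg hji]

/-- Computes the table of the node register 10. -/
def nodeTable (M : Program) : Program :=
  assign 11 (load 5 (reg 10)) ;; loadSeparator ;; assign 13 (load 8 (reg 11)) ;;
  forUp 12 13 (nodeBody M)

theorem wp_nodeTable {M : Program} {T i : ℕ} {Z : ℕ → Finset (Fin n)}
    {p : (ZMod (2 ^ n))[X]} {E : ℕ → ℕ → (ZMod (2 ^ n))[X]} (hw : 2 ≤ w) (hn : 0 < n)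
    (hK : (5 + N * S) * (n + 1) * numWords w n < 2 ^ w) (hM : MultipliesWithin M w n T)
    (hT : numWords w n ≤ T) (hc : Context G N S Y ord par σ) (hnw : n < 2 ^ w)
    (hNw : N < 2 ^ w) (hpar0 : par 0 = N) (hpar : ∀ j, 0 < j → j < N → par j < j)
    (hZ0 : Z 0 = ∅) (hZ : ∀ j, 0 < j → j < N → Z j = Y j ∩ Y (par j))
    (hS : ∀ j < N, 3 ^ (Y j).card ≤ S) (hYw : 2 * 3 ^ (Y i).card < 2 ^ w) (hi : i < N)
    (h10 : σ.reg 10 = BitVec.ofNat w i) (hE : Tables n N S p E σ)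
    (hE0 : ∀ r < S, E i r = 0) :
    wp (nodeTable M) (n * 40 + 30 + 3 ^ (Y i).card * (N * 20 + (n + 1) * (n + 1) * T * 1000 +
        ((Finset.range N).filter fun j => par j = i).card * ((n + 1) * (n + 1) * T * 800) + 8))
      (fun τ => Keep 11 [3, 9, 10] σ τ ∧ ∃ p', Tables n N S p' (fun j r => if j = i then
        ∑ c ∈ Finset.range (3 ^ (Y i).card), tableTerm G N Y par i (Z i) E c r else E j r) τ)
      σ := by
  have hk₁ : Keep 11 [3, 9, 10] σ (σ.setReg 11 (BitVec.ofNat w (ord i))) :=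
    (Keep.refl σ).setReg (by norm_num) _
  have hc₁ := hc.keep hk₁ (by norm_num) (by simp)
  refine wp.of_le (wp_assign_seq (Ev.load (Ev.reg h10) (hc.order i hi)) (wp_seq
    (T₂ := 15 + 3 ^ (Y i).card * (N * 20 + (n + 1) * (n + 1) * T * 1000 +
        ((Finset.range N).filter fun j => par j = i).card * ((n + 1) * (n + 1) * T * 800) + 8))
    (wp_loadSeparator hc₁ hnw hNw hpar hZ0 hZ hi h10 rfl) ?_))
    (by simp only [Expr.cost]; omega)
  rintro τ ⟨hk₂, hZτ⟩
  have hc₂ := hc₁.keep hk₂ (by norm_num) (by simp)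
  have hk₁₂ : Keep 11 [3, 9, 10] σ τ := hk₁.trans (hk₂.mono (by norm_num) (by simp))
  have h11 : τ.reg 11 = BitVec.ofNat w (ord i) := (hk₂.reg 11 (by norm_num)).trans
    (setReg_reg_self _ _)
  have h10₂ : τ.reg 10 = BitVec.ofNat w i := (hk₁₂.reg 10 (by norm_num)).trans h10
  have hk₀ : Keep 12 [3, 9] τ ((τ.setReg 13 (BitVec.ofNat w (3 ^ (Y i).card))).setReg 12
      (BitVec.ofNat w 0)) :=
    ((Keep.refl τ).setReg (by norm_num) _).setReg (by norm_num) _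
  have hpar' : ∀ j < N, par j ≤ N := fun j hj => by
    rcases Nat.eq_zero_or_pos j with rfl | h0
    · omega
    · have := hpar j h0 hj
      omega
  -- No node is its own child, so adding to row `i` does not affect the later terms of the sum.
  have hchild : ∀ l < N, par l = i → l ≠ i := fun l hl hli => by
    rcases Nat.eq_zero_or_pos l with rfl | h0
    · omega
    · have := hpar l h0 hl
      omega
  refine wp.of_le (wp_assign_seq (Ev.load (Ev.reg h11) (hc₂.sizes i hi)) (wp.mono
    (wp_forUp (T := N * 20 + (n + 1) * (n + 1) * T * 1000 +
        ((Finset.range N).filter fun j => par j = i).card * ((n + 1) * (n + 1) * T * 800))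
      (fun c ρ => Keep 12 [3, 9] τ ρ ∧ ∃ p', Tables n N S p' (fun j r => if j = i then
        ∑ c ∈ Finset.range c, tableTerm G N Y par i (Z i) E c r else E j r) ρ)
      (by norm_num) (by omega) (setReg_reg_self _ _) ⟨hk₀, p, ?_⟩ ?_)
      (fun ρ ⟨h1, h2⟩ => ⟨hk₁₂.trans (h1.mono (by norm_num) (by simp)), h2⟩) le_rfl)) ?_
  · have hEτ : Tables n N S p E τ := Tables.keep (σ := σ.setReg 11 (BitVec.ofNat w (ord i)))
      (hE.of_mem_eq rfl) hk₂ (by simp)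
    refine Tables.of_mem_eq (hEτ.congr fun j hj r hr => ?_) rfl
    split_ifs with h
    · rw [h, Finset.range_zero, Finset.sum_empty, hE0 r hr]
    · rfl
  · rintro c hcY ρ h12 h13 ⟨hk, p', hE'⟩
    have hcρ := hc₂.keep hk (by norm_num) (by simp)
    have hZρ : ∀ v : Fin n, ρ.mem 10 (BitVec.ofNat w v) =
        BitVec.ofNat w (if v ∈ Z i then 1 else 0) := fun v => by
      rw [hk.mem 10 (by norm_num) (by simp)]; exact hZτ v
    refine wp.mono (wp_nodeBody hw hn hK hM hT hcρ hnw hNw hpar' hS hYw hi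
      ((hk.reg 10 (by norm_num)).trans h10₂) ((hk.reg 11 (by norm_num)).trans h11) h12 hcY hZρ hE')
      ?_ le_rfl
    rintro π ⟨hkπ, p'', hE''⟩
    refine ⟨(hkπ.reg 12 (by norm_num)).trans h12, (hkπ.reg 13 (by norm_num)).trans h13,
      (hk.trans (hkπ.mono (by norm_num) (by simp))).setReg (by norm_num) _, p'', ?_⟩
    refine Tables.of_mem_eq (hE''.congr fun j hj r hr => ?_) rfl
    by_cases hji : j = i
    · subst hji
      rw [if_pos rfl, if_pos rfl, if_pos rfl, Finset.sum_range_succ]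
      congr 1
      refine tableTerm_congr hS (fun l hl hli r hr => ?_) c r
      rw [if_neg (hchild l hl hli)]
    · rw [if_neg hji, if_neg hji, if_neg hji]
  · simp only [Expr.cost]; omega

/-- Computes the tables of all nodes, from the last to the first. -/
def allTables (M : Program) : Program :=
  forUp 9 1 (assign 10 (reg 1 - (reg 9 + lit 1)) ;; nodeTable M)

/-- Each node is the child of at most one node. Thus the polynomial products number `O(N)`, and not
`O(N ^ 2)`, per colouring of a bag. -/
theorem sum_card_children_le (N : ℕ) (par : ℕ → ℕ) :
    ∑ t ∈ Finset.range N, ((Finset.range N).filter fun j => par j = N - (t + 1)).card ≤ N := by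
  have h := Finset.sum_range_reflect
    (fun i => ((Finset.range N).filter fun j => par j = i).card) N
  simp only [Nat.sub_sub, Nat.add_comm 1] at h
  rw [h]
  calc ∑ i ∈ Finset.range N, ((Finset.range N).filter fun j => par j = i).card
      = ((Finset.range N).filter fun j => par j ∈ Finset.range N).card :=
        (Finset.card_eq_sum_card_fiberwise (s := (Finset.range N).filter
          fun j => par j ∈ Finset.range N) (t := Finset.range N) (f := par)
          (fun j hj => (Finset.mem_filter.1 hj).2)).symm ▸ by
            refine Finset.sum_congr rfl fun i hi => ?_
            congr 1
            ext j
            simp only [Finset.mem_filter]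
            constructor
            · rintro ⟨h1, rfl⟩; exact ⟨⟨h1, hi⟩, rfl⟩
            · rintro ⟨⟨h1, _⟩, h2⟩; exact ⟨h1, h2⟩
    _ ≤ (Finset.range N).card := Finset.card_filter_le _ _
    _ = N := Finset.card_range N

theorem wp_allTables {M : Program} {T B : ℕ} {Z : ℕ → Finset (Fin n)}
    {p : (ZMod (2 ^ n))[X]} (hw : 2 ≤ w) (hn : 0 < n)
    (hK : (5 + N * S) * (n + 1) * numWords w n < 2 ^ w) (hM : MultipliesWithin M w n T)
    (hT : numWords w n ≤ T) (hc : Context G N S Y ord par σ) (hnw : n < 2 ^ w)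
    (hNw : N < 2 ^ w) (hpar0 : par 0 = N) (hpar : ∀ j, 0 < j → j < N → par j < j)
    (hZ0 : Z 0 = ∅) (hZ : ∀ j, 0 < j → j < N → Z j = Y j ∩ Y (par j))
    (hS : ∀ j < N, 3 ^ (Y j).card ≤ S) (hB : ∀ j < N, 3 ^ (Y j).card ≤ B) (hBw : 2 * B < 2 ^ w)
    (E : ℕ → ℕ → (ZMod (2 ^ n))[X])
    (hEr : ∀ i < N, ∀ r, E i r =
      ∑ c ∈ Finset.range (3 ^ (Y i).card), tableTerm G N Y par i (Z i) E c r)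
    (hE0 : Tables n N S p (fun _ _ => 0) σ) :
    wp (allTables M) (N * (n * 40 + 50) + B * (N * (N * 20 + (n + 1) * (n + 1) * T * 1800 + 8)) + 6)
      (fun τ => Keep 9 [3, 9, 10] σ τ ∧ ∃ p', Tables n N S p' E τ) σ := by
  set q := (n + 1) * (n + 1) * T with hq
  -- After `t` rounds the last `t` rows are final and the others are still 0. Children have larger
  -- numbers than their parents, so they are finished in time.
  refine wp.mono (wp_forUp_sum (fun t τ => Keep 9 [3, 9, 10] σ τ ∧ ∃ p', Tables n N S p'
      (fun j r => if N - t ≤ j then E j r else 0) τ)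
    (fun t => (n * 40 + 42) + B * (N * 20 + q * 1000 + ((Finset.range N).filter
      fun j => par j = N - (t + 1)).card * (q * 800) + 8))
    (by norm_num) hNw hc.reg_one
    ⟨(Keep.refl σ).setReg (by norm_num) _, p, Tables.of_mem_eq (hE0.congr fun j hj r _ => ?_) rfl⟩
    ?_) ?_ ?_
  · rw [if_neg (by omega)]
  · rintro t ht τ h9 h1 ⟨hk, p', hE⟩
    obtain ⟨i, hi⟩ : ∃ i, i = N - (t + 1) := ⟨_, rfl⟩
    have hiN : i < N := by omega
    have hk₁ : Keep 9 [3, 9, 10] σ (τ.setReg 10 (BitVec.ofNat w i)) := hk.setReg (by norm_num) _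
    have hBi := hB i hiN
    refine wp.of_le (wp_assign_seq (m := i) ?_ (wp.mono (wp_nodeTable hw hn hK hM hT
      (hc.keep hk₁ (by norm_num) (by simp)) hnw hNw hpar0 hpar hZ0 hZ hS (by omega) hiN
        (setReg_reg_self _ _) (hE.of_mem_eq rfl) (fun r hr => if_neg (by omega))) ?_ le_rfl)) ?_
    · rw [hi]
      exact Ev.sub (Ev.reg h1) (Ev.add (Ev.reg h9) (Ev.lit 1)) (by omega)
    · rintro ρ ⟨hkρ, p'', hEρ⟩
      refine ⟨(hkρ.reg 9 (by norm_num)).trans h9, (hkρ.reg 1 (by norm_num)).trans h1,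
        (hk₁.trans (hkρ.mono (by norm_num) (by simp))).setReg (by norm_num) _, p'',
        Tables.of_mem_eq (hEρ.congr fun j hj r hr => ?_) rfl⟩
      by_cases hji : j = i
      · rw [if_pos hji, if_pos (by omega), hji, hEr i hiN]
        refine Finset.sum_congr rfl fun c _ => tableTerm_congr hS (fun l hl hli r _ => ?_) c r
        refine if_pos ?_
        rcases Nat.eq_zero_or_pos l with rfl | h0
        · omega
        · have := hpar l h0 hl
          omega
      · rw [if_neg hji]
        exact if_congr (by omega) rfl rfl
    · rw [← hi]
      have := Nat.mul_le_mul_right (N * 20 + q * 1000 + ((Finset.range N).filter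
        fun j => par j = i).card * (q * 800) + 8) hBi
      simp only [Expr.cost, Expr.cost_sub, ← hq]; omega
  · rintro τ ⟨h1, p', h2⟩
    exact ⟨h1, p', h2.congr fun j _ r _ => if_pos (by omega)⟩
  · have h := sum_card_children_le N par
    have : ∑ t ∈ Finset.range N, (n * 40 + 42 + B * (N * 20 + q * 1000 + ((Finset.range N).filter
        fun j => par j = N - (t + 1)).card * (q * 800) + 8) + 8) =
        N * (n * 40 + 50) + B * (N * (N * 20 + q * 1000 + 8) +
          (∑ t ∈ Finset.range N, ((Finset.range N).filter
            fun j => par j = N - (t + 1)).card) * (q * 800)) := by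
      rw [Finset.sum_mul, mul_add B, Finset.mul_sum]
      simp only [Finset.sum_add_distrib, mul_add, Finset.sum_const, Finset.card_range, smul_eq_mul]
      ring
    rw [this]
    have h2 := Nat.mul_le_mul_right (q * 800) h
    have h3 : N * (N * 20 + q * 1000 + 8) + N * (q * 800) = N * (N * 20 + q * 1800 + 8) := by ring
    have := Nat.mul_le_mul_left B (Nat.add_le_add_left h2 (N * (N * 20 + q * 1000 + 8)))
    rw [h3] at this
    omega

/-- The recursion is well founded, since a row depends only on rows with larger numbers; it is
solved from the last row down. Having the solution beforehand lets the loop invariant name the final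
tables. -/
theorem exists_tables (G : SimpleGraph (Fin n)) (N : ℕ) (Y Z : ℕ → Finset (Fin n)) (par : ℕ → ℕ)
    (hpar0 : par 0 = N) (hpar : ∀ j, 0 < j → j < N → par j < j) :
    ∃ E : ℕ → ℕ → (ZMod (2 ^ n))[X], ∀ i < N, ∀ r, E i r =
      ∑ c ∈ Finset.range (3 ^ (Y i).card), tableTerm G N Y par i (Z i) E c r := by
  suffices h : ∀ t ≤ N, ∃ E : ℕ → ℕ → (ZMod (2 ^ n))[X], ∀ i < N, N - t ≤ i → ∀ r, E i r =
      ∑ c ∈ Finset.range (3 ^ (Y i).card), tableTerm G N Y par i (Z i) E c r by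
    obtain ⟨E, hE⟩ := h N le_rfl
    exact ⟨E, fun i hi => hE i hi (by omega)⟩
  have hchild : ∀ l < N, par l < N → par l < l := fun l hl h => by
    rcases Nat.eq_zero_or_pos l with rfl | h0
    · omega
    · exact hpar l h0 hl
  intro t
  induction t with
  | zero => exact fun _ => ⟨0, fun i hi h => by omega⟩
  | succ t ih =>
    intro ht
    obtain ⟨E, hE⟩ := ih (by omega)
    obtain ⟨j, hj⟩ : ∃ j, j = N - (t + 1) := ⟨_, rfl⟩
    have hcongr : ∀ i < N, j ≤ i → ∀ c r, tableTerm G N Y par i (Z i) (Function.update E j fun r =>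
        ∑ c ∈ Finset.range (3 ^ (Y j).card), tableTerm G N Y par j (Z j) E c r) c r =
        tableTerm G N Y par i (Z i) E c r := fun i hi hij c r => by
      unfold tableTerm
      congr 2
      refine Finset.prod_congr rfl fun l hl => ?_
      rw [Finset.mem_filter, Finset.mem_range] at hl
      have := hchild l hl.1 (by omega)
      rw [Function.update_of_ne (by omega)]
    refine ⟨Function.update E j fun r =>
      ∑ c ∈ Finset.range (3 ^ (Y j).card), tableTerm G N Y par j (Z j) E c r, fun i hi hij r => ?_⟩
    rw [Finset.sum_congr rfl fun c _ => hcongr i hi (by omega) c r]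
    by_cases h : i = j
    · subst h
      rw [Function.update_self]
    · rw [Function.update_of_ne h, hE i hi (by omega)]

end Node

end WordRAM

namespace WordRAM

open Polynomial
open _root_.WordRAM.Expr (reg lit load)
open _root_.WordRAM.Program (assign store ite loop)

/-! ### Word count, mask, place values and table sizes. -/

section Preparation

variable {w n N : ℕ} {σ τ : State w}

/-- 0 - 1 is the word of `w` ones, and the shift drops `k` of them. With `k = w * L - n` this gives
the mask for the top word. -/
theorem Ev.shr_allOnes {e : Expr} {k : ℕ} (he : Ev σ e k) (hk : k < 2 ^ w) (hkw : k ≤ w) :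
    Ev σ (.op .shr (Expr.lit 0 - Expr.lit 1) e) (2 ^ (w - k) - 1) := by
  unfold Ev at *
  change (BitVec.ofNat w 0 - BitVec.ofNat w 1) >>> (e.eval σ).toNat = _
  rw [he, BitVec.toNat_ofNat, Nat.mod_eq_of_lt hk]
  have h0 : BitVec.ofNat w 0 - BitVec.ofNat w 1 = BitVec.ofNat w (2 ^ w - 1) := by
    rw [sub_eq_iff_eq_add, ← BitVec.ofNat_add, Nat.sub_add_cancel Nat.one_le_two_pow]
    apply BitVec.eq_of_toNat_eq
    rw [BitVec.toNat_ofNat, BitVec.toNat_ofNat, Nat.mod_self, Nat.zero_mod]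
  have h1 : 0 < 2 ^ w := by positivity
  have h2 : 2 ^ w = 2 ^ (w - k) * 2 ^ k := by rw [← pow_add, Nat.sub_add_cancel hkw]
  have h3 : 0 < 2 ^ (w - k) := by positivity
  have h4 : 2 ^ (w - k) ≤ 2 ^ w := Nat.pow_le_pow_right (by norm_num) (by omega)
  rw [h0]
  apply BitVec.eq_of_toNat_eq
  rw [BitVec.toNat_ushiftRight, BitVec.toNat_ofNat, BitVec.toNat_ofNat,
    Nat.mod_eq_of_lt (by omega), Nat.mod_eq_of_lt (by omega), Nat.shiftRight_eq_div_pow]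
  have h5 : 0 < 2 ^ k := by positivity
  refine Nat.div_eq_of_lt_le ?_ ?_
  · rw [Nat.sub_mul, ← h2]
    omega
  · rw [Nat.sub_add_cancel h3, ← h2]
    omega

/-- Computes the registers 2, 3, 4. -/
def setGlobals : Program :=
  assign 4 (reg 0 + lit 1) ;; assign 2 (lit 0) ;; assign 21 (lit 0) ;;
  forUp 20 0 (assign 22 (.op .lt (reg 21) (reg 0)) ;; assign 2 (reg 2 + reg 22) ;;
    assign 21 (reg 21 + reg 22 * .wordLength)) ;;
  assign 3 (.op .shr (lit 0 - lit 1) (reg 21 - reg 0))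

theorem wp_setGlobals (hw : 0 < w) (hn : 0 < n) (hnw : n + w < 2 ^ w)
    (h0 : σ.reg 0 = BitVec.ofNat w n) :
    wp setGlobals (n * 25 + 40) (fun τ => Keep 2 [] σ τ ∧ Globals n τ) σ := by
  set L := numWords w n with hL
  have hL0 : 0 < L := numWords_pos hw hn
  have hL1 : w * (L - 1) < n := mul_numWords_sub_one_lt hw hn
  have hL2 : n ≤ w * L := le_mul_numWords hw
  have hL3 : L ≤ n := numWords_le hw hn
  have hL4 : w * L < n + w := mul_numWords_lt hw hn
  have hwL : w * L = w * (L - 1) + w := by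
    rw [← Nat.mul_succ]; congr 1; omega
  have hk : Keep 2 [] σ (((σ.setReg 4 (BitVec.ofNat w (n + 1))).setReg 2
      (BitVec.ofNat w 0)).setReg 21 (BitVec.ofNat w 0)) :=
    (((Keep.refl σ).setReg (by norm_num) _).setReg (by norm_num) _).setReg (by norm_num) _
  refine wp.of_le (wp_assign_seq (m := n + 1) (Ev.add (Ev.reg h0) (Ev.lit 1)) (wp_assign_seq
    (Ev.lit 0) (wp_assign_seq (Ev.lit 0) (wp_seq (T₂ := 10) (wp_forUp (T := 15)
      (fun l τ => Keep 2 [] σ τ ∧ τ.reg 4 = BitVec.ofNat w (n + 1) ∧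
        τ.reg 2 = BitVec.ofNat w (min l L) ∧ τ.reg 21 = BitVec.ofNat w (w * min l L))
      (m := n) (by norm_num) (by omega) h0
      ⟨hk.setReg (by norm_num) _, rfl, ?_, ?_⟩ ?_) ?_)))) ?_
  · rw [Nat.zero_min]; rfl
  · rw [Nat.zero_min]; rfl
  · rintro l hl τ h20 h0 ⟨hk, h4, h2, h21⟩
    have hlw : w * min l L ≤ w * L := Nat.mul_le_mul_left _ (by omega)
    -- The number of words is found without division: multiples of `w` are counted until they reach
    -- `n`. As `L ≤ n`, the `n` rounds are enough.
    have hlt : (if w * min l L < n then 1 else 0) = min (l + 1) L - min l L := by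
      by_cases h : l < L
      · have : w * min l L ≤ w * (L - 1) := Nat.mul_le_mul_left _ (by omega)
        rw [if_pos (by omega)]
        omega
      · rw [min_eq_right (by omega), if_neg (by omega)]
        omega
    have e := Ev.lt (Ev.reg h21) (Ev.reg h0) (by omega) (by omega)
    rw [hlt] at e
    apply wp.of_le
    · apply wp_assign_seq e
      apply wp_assign_seq (m := min (l + 1) L)
      · have := Ev.add (σ := τ.setReg 22 (BitVec.ofNat w (min (l + 1) L - min l L)))
          (Ev.reg (x := 2) h2) (Ev.reg (setReg_reg_self _ _))
        rwa [Nat.add_sub_cancel' (by omega)] at this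
      · refine wp_assign (m := w * min (l + 1) L) ?_ ⟨h20, h0, ?_, h4, rfl, rfl⟩
        · have := Ev.add (σ := (τ.setReg 22 (BitVec.ofNat w (min (l + 1) L - min l L))).setReg 2
            (BitVec.ofNat w (min (l + 1) L)))
            (Ev.reg (x := 21) h21) (Ev.mul (Ev.reg (m := min (l + 1) L - min l L) (x := 22) rfl)
              Ev.wordLength)
          rwa [mul_comm _ w, ← Nat.mul_add, Nat.add_sub_cancel' (by omega)] at this
        · exact (((hk.setReg (by norm_num) _).setReg (by norm_num) _).setReg
            (by norm_num) _).setReg (by norm_num) _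
    · simp [Expr.cost]
  · rintro τ ⟨hk, h4, h2, h21⟩
    rw [min_eq_right hL3] at h2 h21
    have h0' := (hk.reg 0 (by norm_num)).trans h0
    have e := Ev.shr_allOnes (Ev.sub (Ev.reg h21) (Ev.reg h0') hL2) (by omega) (by omega)
    rw [show w - (w * L - n) = n - w * (L - 1) by omega] at e
    refine wp.of_le (wp_assign e ⟨hk.setReg (by norm_num) _, ⟨h0', h2, ?_, h4⟩⟩)
      (by simp [Expr.cost, Expr.cost_sub])
    exact setReg_reg_self _ _
  · simp only [Expr.cost]; omega

/-- Computes the place values of the vertices in the bags (array 7), the numbers of colourings of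
the bags (array 8) and their sum (register 5). -/
def computePlaces : Program :=
  assign 5 (lit 0) ;;
  forUp 20 1 (assign 22 (lit 1) ;;
    forUp 21 0 (assign 23 (load 2 (reg 20 * reg 0 + reg 21)) ;;
      store 7 (reg 20 * reg 0 + reg 21) (reg 23 * reg 22) ;;
      assign 22 (reg 22 * (lit 1 + lit 2 * reg 23))) ;;
    store 8 (reg 20) (reg 22) ;; assign 5 (reg 5 + reg 22))

theorem cell_ne {x y u v : ℕ} (hu : u < n) (hv : v < n) (h : x ≠ y ∨ u ≠ v) :
    x * n + u ≠ y * n + v := by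
  rcases lt_trichotomy x y with h1 | rfl | h1
  · have := add_mul_le_of_lt (L := n) h1
    omega
  · omega
  · have := add_mul_le_of_lt (L := n) h1
    omega

theorem wp_computePlaces {U : ℕ → Finset (Fin n)} (hnw : n < 2 ^ w) (hNw : N < 2 ^ w)
    (hNn : N * n < 2 ^ w)
    (h0 : σ.reg 0 = BitVec.ofNat w n) (h1 : σ.reg 1 = BitVec.ofNat w N)
    (hU : ∀ x < N, ∀ v : Fin n,
      σ.mem 2 (BitVec.ofNat w (x * n + v)) = BitVec.ofNat w (if v ∈ U x then 1 else 0)) :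
    wp computePlaces (N * (n * 50 + 40) + 10) (fun τ => Keep 5 [7, 8] σ τ ∧
      τ.reg 5 = BitVec.ofNat w (∑ x ∈ Finset.range N, 3 ^ (U x).card) ∧
      (∀ x < N, ∀ v : Fin n,
        τ.mem 7 (BitVec.ofNat w (x * n + v)) = BitVec.ofNat w (placeValue (U x) v)) ∧
      ∀ x < N, τ.mem 8 (BitVec.ofNat w x) = BitVec.ofNat w (3 ^ (U x).card)) σ := by
  refine wp.of_le (wp_assign_seq (Ev.lit 0) (wp_forUp (T := n * 50 + 30)
    (fun y τ => Keep 5 [7, 8] σ τ ∧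
      τ.reg 5 = BitVec.ofNat w (∑ x ∈ Finset.range y, 3 ^ (U x).card) ∧
      (∀ x < y, ∀ v : Fin n,
        τ.mem 7 (BitVec.ofNat w (x * n + v)) = BitVec.ofNat w (placeValue (U x) v)) ∧
      ∀ x < y, τ.mem 8 (BitVec.ofNat w x) = BitVec.ofNat w (3 ^ (U x).card))
    (m := N) (by norm_num) hNw h1 ⟨((Keep.refl σ).setReg (by norm_num) _).setReg (by norm_num) _,
      rfl, fun x hx => absurd hx (by omega), fun x hx => absurd hx (by omega)⟩ ?_)) ?_
  · rintro y hy τ h20 h1 ⟨hk, h5, h7, h8⟩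
    have hyn := add_mul_le_of_lt (L := n) hy
    refine wp.of_le (wp_assign_seq (Ev.lit 1) (wp_seq (T₂ := 10) (wp_forUp (T := 40)
      (fun l ρ => Keep 5 [7, 8] σ ρ ∧ ρ.reg 20 = BitVec.ofNat w y ∧
        ρ.reg 5 = BitVec.ofNat w (∑ x ∈ Finset.range y, 3 ^ (U x).card) ∧
        (∀ x ≤ y, ∀ v : Fin n, x < y ∨ v.val < l →
          ρ.mem 7 (BitVec.ofNat w (x * n + v)) = BitVec.ofNat w (placeValue (U x) v)) ∧
        (∀ x < y, ρ.mem 8 (BitVec.ofNat w x) = BitVec.ofNat w (3 ^ (U x).card)) ∧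
        ρ.reg 22 = BitVec.ofNat w (placePower (U y) l))
      (m := n) (by norm_num) hnw ((hk.reg 0 (by norm_num)).trans h0)
      ⟨(hk.setReg (by norm_num) _).setReg (by norm_num) _, h20, h5,
        fun x _ v h => h7 x (by omega) v, h8, ?_⟩ ?_) ?_)) ?_
    · rw [placePower_zero]; rfl
    · rintro l hl ρ h21 h0 ⟨hk, h20, h5, h7, h8, h22⟩
      have hUρ : ρ.mem 2 (BitVec.ofNat w (y * n + l)) =
          BitVec.ofNat w (if (⟨l, hl⟩ : Fin n) ∈ U y then 1 else 0) := by
        rw [hk.mem 2 (by norm_num) (by simp)]; exact hU y hy ⟨l, hl⟩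
      apply wp.of_le
      · apply wp_assign_seq (m := if (⟨l, hl⟩ : Fin n) ∈ U y then 1 else 0)
        · exact Ev.load (Ev.add (Ev.mul (Ev.reg h20) (Ev.reg h0)) (Ev.reg h21)) hUρ
        apply wp_store_seq (k := y * n + l) (m := placeValue (U y) ⟨l, hl⟩)
        · exact Ev.add (Ev.mul (Ev.reg h20) (Ev.reg h0)) (Ev.reg h21)
        · have : placeValue (U y) ⟨l, hl⟩ =
              (if (⟨l, hl⟩ : Fin n) ∈ U y then 1 else 0) * placePower (U y) l := by
            unfold placeValue
            split_ifs <;> simp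
          rw [this]
          exact Ev.mul (Ev.reg rfl) (Ev.reg h22)
        refine wp_assign (m := placePower (U y) (l + 1)) ?_ ⟨h21, h0, ?_, h20, h5, ?_, h8, rfl⟩
        -- The factor `1 + 2 * b` is 3 for a vertex in the bag and 1 otherwise, which avoids a
        -- branch.
        · have : placePower (U y) (l + 1) = placePower (U y) l *
              (1 + 2 * if (⟨l, hl⟩ : Fin n) ∈ U y then 1 else 0) := by
            rw [placePower_succ _ hl]
            split_ifs <;> ring
          rw [this]
          exact Ev.mul (Ev.reg h22) (Ev.add (Ev.lit 1) (Ev.mul (Ev.lit 2) (Ev.reg rfl)))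
        · exact (((hk.setReg (by norm_num) _).setMem (by simp) _ _).setReg (by norm_num) _).setReg
            (by norm_num) _
        · intro x hx v hv
          by_cases hxv : x = y ∧ v.val = l
          · obtain ⟨rfl, hvl⟩ := hxv
            have : v = ⟨l, hl⟩ := Fin.ext hvl
            subst this
            simp only [State.setReg, State.setMem, Function.update_self]
          · have hxn : x * n ≤ y * n := Nat.mul_le_mul_right _ hx
            refine (setMem_mem_ne ?_ ?_ ?_ _).trans (h7 x hx v ?_)
            · have := v.isLt
              omega
            · omega
            · exact cell_ne v.isLt hl (by omega)
            · omega
      · simp [Expr.cost]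
    · rintro ρ ⟨hk, h20, h5, h7, h8, h22⟩
      rw [placePower_last] at h22
      refine wp.of_le (wp_store_seq (Ev.reg h20) (Ev.reg h22) (wp_assign
        (m := ∑ x ∈ Finset.range (y + 1), 3 ^ (U x).card) ?_ ⟨h20,
        (hk.reg 1 (by norm_num)).trans ‹σ.reg 1 = _›, ((hk.setMem (by simp) _ _).setReg
          (by norm_num) _).setReg (by norm_num) _, rfl, fun x hx v => h7 x (by omega) v ?_,
          fun x hx => ?_⟩)) (by simp [Expr.cost])
      · rw [Finset.sum_range_succ]
        exact Ev.add (Ev.reg h5) (Ev.reg h22)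
      · have := v.isLt
        omega
      · rcases Nat.lt_succ_iff_lt_or_eq.1 hx with hx | rfl
        · exact (setMem_mem_ne (by omega) (by omega) (by omega) _).trans (h8 x hx)
        · simp only [State.setReg, State.setMem, Function.update_self]
    · simp only [Expr.cost]; omega
  · have := Nat.mul_le_mul_left N (show n * 50 + 30 + 8 ≤ n * 50 + 40 by omega)
    simp only [Expr.cost]; omega

end Preparation

end WordRAM

namespace WordRAM

open Polynomial
open _root_.WordRAM.Expr (reg lit load)
open _root_.WordRAM.Program (assign store ite loop)

/-! ### Clearing the tables and producing the constants 1, -1 and 0. -/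

section Initialization

variable {w n N S : ℕ} {σ τ : State w}

/-- Clears array 3, and makes slot 2 the constant 1. -/
def clearSlots : Program :=
  assign 21 ((lit 5 + reg 1 * reg 5) * reg 4 * reg 2) ;;
  forUp 20 21 (store 3 (reg 20) (lit 0)) ;;
  store 3 (lit 2 * reg 4 * reg 2) (lit 1)

theorem wp_clearSlots (hw : 0 < w) (hn : 0 < n) (hg : Globals n σ)
    (hK : (5 + N * S) * (n + 1) * numWords w n < 2 ^ w)
    (h1 : σ.reg 1 = BitVec.ofNat w N) (h5 : σ.reg 5 = BitVec.ofNat w S) :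
    wp clearSlots ((5 + N * S) * (n + 1) * numWords w n * 13 + 40) (fun τ => Keep 20 [3] σ τ ∧
      Slots n (5 + N * S) (Function.update 0 2 1) τ) σ := by
  set L := numWords w n with hL
  have hLpos : 0 < L := numWords_pos hw hn
  set Q := (5 + N * S) * (n + 1) with hQ
  have hk : Keep 20 [3] σ (σ.setReg 21 (BitVec.ofNat w (Q * L))) :=
    (Keep.refl σ).setReg (by norm_num) _
  refine wp.of_le (wp_assign_seq (m := Q * L) (Ev.mul (Ev.mul (Ev.add (Ev.lit 5)
    (Ev.mul (Ev.reg h1) (Ev.reg h5))) (Ev.reg hg.reg_four)) (Ev.reg hg.reg_two))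
    (wp_seq (T₂ := 10) (wp_forUp (T := 5) (fun l τ => Keep 20 [3] σ τ ∧
      ∀ q < l, τ.mem 3 (BitVec.ofNat w q) = BitVec.ofNat w 0) (by norm_num) hK
      (setReg_reg_self _ _) ⟨hk.setReg (by norm_num) _, fun q hq => absurd hq (by omega)⟩ ?_) ?_)) ?_
  · rintro l hl τ h20 h21 ⟨hk, hz⟩
    refine wp.of_le (wp_store (Ev.reg h20) (Ev.lit 0) ⟨h20, h21, (hk.setMem (by simp) _ _).setReg
      (by norm_num) _, fun q hq => ?_⟩) (by simp [Expr.cost])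
    rcases Nat.lt_succ_iff_lt_or_eq.1 hq with hq | rfl
    · exact (setMem_mem_ne (by omega) (by omega) (by omega) _).trans (hz q hq)
    · simp only [State.setReg, State.setMem, Function.update_self]
  · rintro τ ⟨hk, hz⟩
    refine wp.of_le (wp_store (k := 2 * (n + 1) * L) (m := 1) (Ev.mul (Ev.mul (Ev.lit 2)
      (Ev.reg ((hk.reg 4 (by norm_num)).trans hg.reg_four)))
      (Ev.reg ((hk.reg 2 (by norm_num)).trans hg.reg_two))) (Ev.lit 1)
      ⟨hk.setMem (by simp) _ _, ?_⟩) (by simp [Expr.cost])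
    suffices h : Slots n (5 + N * S) (Function.update (fun _ => (0 : (ZMod (2 ^ n))[X])) 2
        (0 + monomial 0 1)) (τ.setMem 3 (BitVec.ofNat w (2 * (n + 1) * L)) (BitVec.ofNat w 1)) by
      rw [zero_add, monomial_zero_one] at h
      exact h
    -- Writing one word 1 adds the constant monomial 1 to slot 2 of the zero family.
    refine Slots.of_update (P := fun _ => 0) (Nat.zero_le n) fun q hq j hj => ?_
    have hqL := add_mul_le_of_lt (L := L) hq
    have h2L := add_mul_le_of_lt (L := L) (slot_lt (κ := 0) (Nat.zero_le n)
      (show 2 < 5 + N * S by omega))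
    rw [← hQ] at hqL
    rw [← hQ, Nat.add_zero] at h2L
    rw [← hL] at hj ⊢
    by_cases hq2 : q = 2 * (n + 1)
    · subst hq2
      have hv : (1 : ZMod (2 ^ n)).val = 1 := by
        have : Fact (1 < 2 ^ n) := ⟨Nat.one_lt_two_pow hn.ne'⟩
        exact ZMod.val_one _
      rw [add_zero, Function.update_self, coeff_zero, zero_add, hv]
      rcases Nat.eq_zero_or_pos j with rfl | hj0
      · rw [mul_zero, pow_zero, Nat.div_one]
        exact setMem_mem_self ..
      · rw [Nat.div_eq_of_lt (Nat.one_lt_two_pow (by positivity))]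
        exact (setMem_mem_ne (by omega) (by omega) (by omega) _).trans (hz _ (by omega))
    · rw [add_zero, Function.update_of_ne hq2]
      simp only [coeff_zero, ZMod.val_zero, Nat.zero_div]
      refine (setMem_mem_ne (by omega) (by omega) ?_ _).trans (hz _ (by omega))
      rw [← Nat.add_zero (2 * (n + 1) * L)]
      exact cell_ne hj hLpos (Or.inl hq2)
  · simp only [Expr.cost]; omega

/-- Doubles the polynomial in slot 3 and adds that in slot 2, by means of slot 0. -/
def doubleAdd : Program :=
  assign 19 (lit 3) ;; assign 25 (lit 0) ;; assign 26 (lit 3) ;; polyCopy ;; polyAdd ;;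
  assign 25 (lit 0) ;; assign 26 (lit 2) ;; polyCopy ;; polyAdd

theorem wp_doubleAdd {K : ℕ} {P : ℕ → (ZMod (2 ^ n))[X]} (hw : 0 < w) (hn : 0 < n)
    (hg : Globals n σ) (hP : Slots n K P σ) (hK : K * (n + 1) * numWords w n < 2 ^ w)
    (hK5 : 5 ≤ K) :
    wp doubleAdd ((n + 1) * numWords w n * 240 + 130) (fun τ => Keep 19 [3] σ τ ∧
      Slots n K (Function.update (Function.update P 0 (P 2)) 3 (2 * P 3 + P 2)) τ) σ := by
  have hk₁ : Keep 19 [3] σ (((σ.setReg 19 (BitVec.ofNat w 3)).setReg 25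
      (BitVec.ofNat w 0)).setReg 26 (BitVec.ofNat w 3)) :=
    (((Keep.refl σ).setReg (by norm_num) _).setReg (by norm_num) _).setReg (by norm_num) _
  have hL : (n + 1) ≤ (n + 1) * numWords w n := Nat.le_mul_of_pos_right _ (numWords_pos hw hn)
  have hA : (n + 1) * (numWords w n * 40 + 60) = (n + 1) * numWords w n * 40 + (n + 1) * 60 := by
    ring
  refine wp.of_le (wp_assign_seq (Ev.lit 3) (wp_assign_seq (Ev.lit 0) (wp_assign_seq (Ev.lit 3)
    (wp_seq (wp_polyCopy (s := 0) (s' := 3) hw hn (hg.keep hk₁ (by norm_num))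
      (hP.of_mem_eq rfl) hK (by omega) (by omega) (by norm_num) rfl rfl)
      (T₂ := (n + 1) * numWords w n * 216 + 70) ?_)))) (by simp only [Expr.cost]; omega)
  rintro τ₁ ⟨hkτ₁, hP₁⟩
  have hk₂ := hk₁.trans (hkτ₁.mono (by norm_num) (by simp))
  refine wp.of_le (wp_seq (wp_polyAdd (s := 3) hw hn (hg.keep hk₂ (by norm_num)) hP₁ hK
    (by omega) (by omega) ((hkτ₁.reg 19 (by norm_num)).trans rfl))
      (T₂ := (n + 1) * numWords w n * 116 + 62) ?_) (by omega)
  rintro τ₂ ⟨hkτ₂, hP₂⟩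
  have hk₃ := hk₂.trans (hkτ₂.mono (by norm_num) (by simp))
  have hk₄ : Keep 19 [3] σ ((τ₂.setReg 25 (BitVec.ofNat w 0)).setReg 26 (BitVec.ofNat w 2)) :=
    (hk₃.setReg (by norm_num) _).setReg (by norm_num) _
  refine wp.of_le (wp_assign_seq (Ev.lit 0) (wp_assign_seq (Ev.lit 2)
    (wp_seq (wp_polyCopy (s := 0) (s' := 2) hw hn (hg.keep hk₄ (by norm_num))
      (hP₂.of_mem_eq rfl) hK (by omega) (by omega) (by norm_num) rfl rfl)
      (T₂ := (n + 1) * numWords w n * 100 + 6) ?_))) (by simp only [Expr.cost]; omega)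
  rintro τ₃ ⟨hkτ₃, hP₃⟩
  have hk₅ := hk₄.trans (hkτ₃.mono (by norm_num) (by simp))
  refine wp.mono (wp_polyAdd (s := 3) hw hn (hg.keep hk₅ (by norm_num)) hP₃ hK
    (by omega) (by omega) ?_) ?_ (by omega)
  · exact (hkτ₃.reg 19 (by norm_num)).trans ((hkτ₂.reg 19 (by norm_num)).trans
      ((hkτ₁.reg 19 (by norm_num)).trans rfl))
  · rintro τ ⟨hkτ, hP⟩
    refine ⟨hk₅.trans (hkτ.mono (by norm_num) (by simp)), hP.congr fun s _ κ _ => ?_⟩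
    congr 1
    by_cases hs3 : s = 3
    · subst hs3
      simp [two_mul]
    · rw [Function.update_of_ne hs3, Function.update_of_ne hs3]
      by_cases hs0 : s = 0
      · subst hs0
        simp
      · rw [Function.update_of_ne hs0, Function.update_of_ne hs0, Function.update_of_ne hs3,
          Function.update_of_ne hs0]

/-- Initializes array 3 with the constants 1, -1 and 0, and with tables that are 0. -/
def initTables : Program := clearSlots ;; forUp 18 0 doubleAdd

/-- Makes `2 ^ n - 1` equal to -1. -/
theorem two_pow_eq_zero (n : ℕ) : (2 : (ZMod (2 ^ n))[X]) ^ n = 0 := by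
  have : ((2 ^ n : ℕ) : (ZMod (2 ^ n))[X]) = 0 := by
    rw [← map_natCast (C : ZMod (2 ^ n) →+* _), ZMod.natCast_self, map_zero]
  exact_mod_cast this

theorem wp_initTables (hw : 0 < w) (hn : 0 < n) (hnw : n < 2 ^ w) (hg : Globals n σ)
    (hK : (5 + N * S) * (n + 1) * numWords w n < 2 ^ w)
    (h1 : σ.reg 1 = BitVec.ofNat w N) (h5 : σ.reg 5 = BitVec.ofNat w S) :
    wp initTables ((5 + N * S) * (n + 1) * numWords w n * 13 + 46 +
      n * ((n + 1) * numWords w n * 240 + 138)) (fun τ => Keep 18 [3] σ τ ∧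
        ∃ p, Tables n N S p (fun _ _ => 0) τ) σ := by
  refine wp.of_le (wp_seq (wp_clearSlots hw hn hg hK h1 h5)
    (T₂ := n * ((n + 1) * numWords w n * 240 + 138) + 6) ?_) (by omega)
  rintro τ ⟨hk, hP⟩
  have hk' : Keep 18 [3] σ τ := hk.mono (by norm_num) (by simp)
  -- Slot 3 runs through `2 ^ l - 1`, because `2 * (2 ^ l - 1) + 1 = 2 ^ (l + 1) - 1`. So -1 is
  -- obtained from the routines for copying and adding alone.
  refine wp.mono (wp_forUp (T := (n + 1) * numWords w n * 240 + 130) (fun l τ => Keep 18 [3] σ τ ∧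
    ∃ P, Slots n (5 + N * S) P τ ∧ P 2 = 1 ∧ P 3 = 2 ^ l - 1 ∧ ∀ s, 4 ≤ s → P s = 0)
    (by norm_num) hnw ((hk'.reg 0 (by norm_num)).trans hg.reg_zero)
    ⟨hk'.setReg (by norm_num) _, _, hP.of_mem_eq rfl, by simp, by simp,
      fun s hs => by rw [Function.update_of_ne (by omega)]; rfl⟩ ?_) ?_
    (by rw [add_assoc _ 130 8])
  · rintro l hl ρ h18 h0 ⟨hk, P, hP, h2, h3, h4⟩
    refine wp.mono (wp_doubleAdd hw hn (hg.keep hk (by norm_num)) hP hK (by omega)) ?_ le_rfl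
    rintro π ⟨hkπ, hP'⟩
    refine ⟨(hkπ.reg 18 (by norm_num)).trans h18, (hkπ.reg 0 (by norm_num)).trans h0,
      (hk.trans (hkπ.mono (by norm_num) (by simp))).setReg (by norm_num) _, _, hP'.of_mem_eq rfl,
      ?_, ?_, fun s hs => ?_⟩
    · rw [Function.update_of_ne (by norm_num), Function.update_of_ne (by norm_num), h2]
    · rw [Function.update_self, h2, h3]
      ring
    · rw [Function.update_of_ne (by omega), Function.update_of_ne (by omega), h4 s hs]
  · rintro ρ ⟨hk, P, hP, h2, h3, h4⟩
    refine ⟨hk, P 0, P, hP, rfl, h2, ?_, h4 4 le_rfl, fun j _ r _ => h4 _ (by omega)⟩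
    rw [h3, two_pow_eq_zero, zero_sub]

end Initialization

end WordRAM

/-! ### Search orders of a tree and the running intersection property. -/

section TreeOrder

variable {N : ℕ} {T : SimpleGraph (Fin N)} {cnt : ℕ} {ord : ℕ → Fin N} {par : ℕ → ℕ}

/-- `ord 0`, …, `ord (cnt - 1)` are different nodes, each of which, except for the first, is a
neighbour of an earlier one, the one with number `par j`. -/
structure IsSearchOrder (T : SimpleGraph (Fin N)) (cnt : ℕ) (ord : ℕ → Fin N) (par : ℕ → ℕ) :
    Prop where
  inj : ∀ j < cnt, ∀ l < cnt, ord j = ord l → j = l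
  parent_lt : ∀ j, 0 < j → j < cnt → par j < j
  adj : ∀ j, 0 < j → j < cnt → T.Adj (ord j) (ord (par j))

theorem IsSearchOrder.extend {i : ℕ} {y : Fin N} (h : IsSearchOrder T cnt ord par) (hi : i < cnt)
    (hadj : T.Adj (ord i) y) (hy : ∀ l < cnt, ord l ≠ y) :
    IsSearchOrder T (cnt + 1) (Function.update ord cnt y) (Function.update par cnt i) := by
  constructor
  · intro j hj l hl hjl
    rcases Nat.lt_succ_iff_lt_or_eq.1 hj with hj | rfl <;>
      rcases Nat.lt_succ_iff_lt_or_eq.1 hl with hl | rfl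
    · rw [Function.update_of_ne hj.ne, Function.update_of_ne hl.ne] at hjl
      exact h.inj j hj l hl hjl
    · rw [Function.update_of_ne hj.ne, Function.update_self] at hjl
      exact absurd hjl (hy j hj)
    · rw [Function.update_of_ne hl.ne, Function.update_self] at hjl
      exact absurd hjl.symm (hy l hl)
    · rfl
  · intro j hj0 hj
    rcases Nat.lt_succ_iff_lt_or_eq.1 hj with hj | rfl
    · rw [Function.update_of_ne hj.ne]
      exact h.parent_lt j hj0 hj
    · rwa [Function.update_self]
  · intro j hj0 hj
    rcases Nat.lt_succ_iff_lt_or_eq.1 hj with hj | rfl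
    · have := h.parent_lt j hj0 hj
      rw [Function.update_of_ne hj.ne, Function.update_of_ne hj.ne,
        Function.update_of_ne (by omega)]
      exact h.adj j hj0 hj
    · rw [Function.update_self, Function.update_self, Function.update_of_ne hi.ne]
      exact hadj.symm

theorem IsSearchOrder.le (h : IsSearchOrder T cnt ord par) : cnt ≤ N := by
  have := Fintype.card_le_of_injective (fun j : Fin cnt => ord j)
    fun j l hjl => Fin.ext (h.inj j j.isLt l l.isLt hjl)
  simpa using this

/-- A nonempty set of nodes that contains all neighbours of its members is everything: follow a walk
from `ord 0`. -/
theorem surjOn_of_closed (hT : T.Connected) (hcnt : 0 < cnt)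
    (h : ∀ j < cnt, ∀ y, T.Adj (ord j) y → ∃ l < cnt, ord l = y) (y : Fin N) :
    ∃ l < cnt, ord l = y := by
  obtain ⟨p⟩ := hT.preconnected (ord 0) y
  suffices h' : ∀ x y, T.Walk x y → (∃ l < cnt, ord l = x) → ∃ l < cnt, ord l = y from
    h' _ _ p ⟨0, hcnt, rfl⟩
  intro x y p
  induction p with
  | nil => exact id
  | cons hadj _ ih =>
    rintro ⟨l, hl, rfl⟩
    exact ih (h l hl _ hadj)

theorem le_of_surjOn (h : ∀ y : Fin N, ∃ l < cnt, ord l = y) : N ≤ cnt := by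
  choose f hf hord using h
  have := Fintype.card_le_of_injective (fun y => (⟨f y, hf y⟩ : Fin cnt)) fun x y hxy => by
    rw [← hord x, ← hord y, Fin.mk.inj_iff.1 hxy]
  simpa using this

/-- Going from parent to parent leads to the first node, and the numbers only decrease on the way.
-/
theorem IsSearchOrder.exists_walk (h : IsSearchOrder T cnt ord par) {j : ℕ} (hj : j ≤ cnt) {l : ℕ}
    (hl : l < j) : ∃ p : T.Walk (ord l) (ord 0), ∀ z ∈ p.support, ∃ i < j, ord i = z := by
  induction l using Nat.strong_induction_on with
  | _ l ih =>
    rcases Nat.eq_zero_or_pos l with rfl | hl0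
    · exact ⟨.nil, fun z hz => ⟨0, hl, by simpa using Eq.symm (List.mem_singleton.1 hz)⟩⟩
    · have hp := h.parent_lt l hl0 (by omega)
      obtain ⟨p, hp⟩ := ih (par l) hp (by omega)
      refine ⟨.cons (h.adj l hl0 (by omega)) p, fun z hz => ?_⟩
      rw [SimpleGraph.Walk.support_cons, List.mem_cons] at hz
      rcases hz with rfl | hz
      · exact ⟨l, hl, rfl⟩
      · exact hp z hz

/-- From the parent of node `j` one reaches node `i` by way of the first node, using only nodes
numbered below `j`. Shortened to a path and prolonged by the edge from node `j` to its parent, this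
remains a path; it joins node `j` to node `i` through the parent, so the parent's bag contains every
common vertex. -/
theorem TreeDecomposition.inter_subset_parent {V : Type*} [DecidableEq V] {G : SimpleGraph V}
    (D : TreeDecomposition G (Fin N)) (h : IsSearchOrder D.tree cnt ord par) {i j : ℕ}
    (hij : i < j) (hj : j < cnt) :
    D.bag (ord j) ∩ D.bag (ord i) ⊆ D.bag (ord (par j)) := by
  intro v hv
  rw [Finset.mem_inter] at hv
  have hp := h.parent_lt j (by omega) hj
  obtain ⟨p, hp⟩ := h.exists_walk hj.le hp
  obtain ⟨q, hq⟩ := h.exists_walk hj.le hij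
  set r := (p.append q.reverse).toPath with hr
  have hsupp : ∀ z ∈ r.val.support, ∃ i < j, ord i = z := by
    intro z hz
    have := SimpleGraph.Walk.support_toPath_subset_support _ hz
    rw [SimpleGraph.Walk.mem_support_append_iff, SimpleGraph.Walk.support_reverse,
      List.mem_reverse] at this
    exact this.elim (hp z) (hq z)
  have hpath : (SimpleGraph.Walk.cons (h.adj j (by omega) hj) r.val).IsPath := by
    rw [SimpleGraph.Walk.cons_isPath_iff]
    refine ⟨r.property, fun hz => ?_⟩
    obtain ⟨l, hl, hlj⟩ := hsupp _ hz
    exact hl.ne (h.inj l (by omega) j hj hlj)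
  refine D.mem_bag_of_path v _ _ _ hpath hv.1 hv.2 _ ?_
  rw [SimpleGraph.Walk.support_cons]
  exact List.mem_cons_of_mem _ (SimpleGraph.Walk.start_mem_support _)

end TreeOrder

namespace WordRAM

open _root_.WordRAM.Expr (reg lit load)
open _root_.WordRAM.Program (assign store ite loop)

/-! ### Breadth-first search on the machine. -/

section Search

variable {w N : ℕ} {σ τ : State w} {T : SimpleGraph (Fin N)}

/-- Appends the node register 21 to the search order, as a child of node number register 20. -/
def appendNode : Program :=
  store 4 (reg 21) (lit 1) ;; store 5 (reg 7) (reg 21) ;; store 6 (reg 7) (reg 20) ;;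
  assign 7 (reg 7 + lit 1)

/-- Computes a search order of the tree (array 5) and the parents (array 6), with the visited
nodes marked in array 4 and their number in register 7. -/
def searchTree : Program :=
  forUp 20 1 (store 4 (reg 20) (lit 0)) ;; assign 21 (lit 0) ;; assign 20 (reg 1) ;;
  assign 7 (lit 0) ;; appendNode ;;
  forUp 20 1 (assign 22 (load 5 (reg 20)) ;;
    forUp 21 1 (ite (load 1 (reg 22 * reg 1 + reg 21) * (lit 1 - load 4 (reg 21)))
      appendNode .skip))

open Classical in
/-- The state `σ` holds a search order. -/
structure HoldsOrder (T : SimpleGraph (Fin N)) (cnt : ℕ) (ord : ℕ → Fin N) (par : ℕ → ℕ)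
    (σ : State w) : Prop where
  isSearchOrder : IsSearchOrder T cnt ord par
  reg_seven : σ.reg 7 = BitVec.ofNat w cnt
  marks : ∀ y : Fin N,
    σ.mem 4 (BitVec.ofNat w y) = BitVec.ofNat w (if ∃ l < cnt, ord l = y then 1 else 0)
  order : ∀ j < cnt, σ.mem 5 (BitVec.ofNat w j) = BitVec.ofNat w (ord j)
  parents : ∀ j < cnt, σ.mem 6 (BitVec.ofNat w j) = BitVec.ofNat w (par j)

variable {cnt : ℕ} {ord : ℕ → Fin N} {par : ℕ → ℕ}

theorem HoldsOrder.congr (h : HoldsOrder T cnt ord par σ) (h7 : τ.reg 7 = σ.reg 7)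
    (hm : τ.mem = σ.mem) : HoldsOrder T cnt ord par τ := by
  obtain ⟨h1, h2, h3, h4, h5⟩ := h
  refine ⟨h1, h7.trans h2, ?_, ?_, ?_⟩ <;> rw [hm] <;> assumption

theorem wp_appendNode {i : ℕ} {y : Fin N} (hNw : N < 2 ^ w) (h : HoldsOrder T cnt ord par σ)
    (hcnt : cnt < N)
    (hext : IsSearchOrder T (cnt + 1) (Function.update ord cnt y) (Function.update par cnt i))
    (h20 : σ.reg 20 = BitVec.ofNat w i) (h21 : σ.reg 21 = BitVec.ofNat w y) :
    wp appendNode 20 (fun τ => Keep 6 [4, 5, 6] σ τ ∧ (∀ x ≠ 7, τ.reg x = σ.reg x) ∧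
      HoldsOrder T (cnt + 1) (Function.update ord cnt y) (Function.update par cnt i) τ) σ := by
  have h7 := h.reg_seven
  refine wp.of_le (wp_store_seq (Ev.reg h21) (Ev.lit 1) (wp_store_seq (k := cnt) (m := y)
    (Ev.reg h7) (Ev.reg h21) (wp_store_seq (k := cnt) (m := i) (Ev.reg h7) (Ev.reg h20)
      (wp_assign (m := cnt + 1) (Ev.add (Ev.reg h7) (Ev.lit 1))
        ⟨?_, fun x hx => setReg_reg_ne hx _, hext, rfl, ?_, ?_, ?_⟩)))) (by simp [Expr.cost])
  · exact ((((Keep.refl σ).setMem (by simp) _ _).setMem (by simp) _ _).setMem (by simp)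
      _ _).setReg (by norm_num) _
  · intro z
    by_cases hzy : z = y
    · subst hzy
      rw [if_pos ⟨cnt, by omega, Function.update_self ..⟩]
      simp [State.setReg, State.setMem]
    · refine (setMem_mem_ne (by omega) (by omega) (fun h => hzy (Fin.ext h)) _).trans
        ((h.marks z).trans ?_)
      congr 1
      refine if_congr ⟨?_, ?_⟩ rfl rfl
      · rintro ⟨l, hl, h⟩
        exact ⟨l, by omega, by rwa [Function.update_of_ne hl.ne]⟩
      · rintro ⟨l, hl, h⟩
        rcases Nat.lt_succ_iff_lt_or_eq.1 hl with hl | rfl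
        · exact ⟨l, hl, by rwa [Function.update_of_ne hl.ne] at h⟩
        · rw [Function.update_self] at h
          exact absurd h.symm hzy
  · intro j hj
    rcases Nat.lt_succ_iff_lt_or_eq.1 hj with hj | rfl
    · rw [Function.update_of_ne hj.ne]
      exact (setMem_mem_ne (a := 5) (by omega) (by omega) hj.ne _).trans (h.order j hj)
    · rw [Function.update_self]
      simp [State.setReg, State.setMem]
  · intro j hj
    rcases Nat.lt_succ_iff_lt_or_eq.1 hj with hj | rfl
    · rw [Function.update_of_ne hj.ne]
      exact (setMem_mem_ne (a := 6) (by omega) (by omega) hj.ne _).trans (h.parents j hj)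
    · rw [Function.update_self]
      simp [State.setReg, State.setMem]

/-- All neighbours of the nodes `ord j`, `j < i`, and the first `m` nodes if they are neighbours
of `ord i`, are in the search order. -/
structure ScannedTo (T : SimpleGraph (Fin N)) (cnt : ℕ) (ord : ℕ → Fin N) (i m : ℕ) : Prop where
  closed : ∀ j < i, ∀ y, T.Adj (ord j) y → ∃ l < cnt, ord l = y
  current : ∀ y : Fin N, y.val < m → T.Adj (ord i) y → ∃ l < cnt, ord l = y

theorem ScannedTo.extend {i m : ℕ} {y : Fin N} (h : ScannedTo T cnt ord i m) (hi : i < cnt)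
    (hy : y.val = m) : ScannedTo T (cnt + 1) (Function.update ord cnt y) i (m + 1) := by
  have hlift : ∀ z, (∃ l < cnt, ord l = z) → ∃ l < cnt + 1, Function.update ord cnt y l = z := by
    rintro z ⟨l, hl, h⟩
    exact ⟨l, by omega, by rwa [Function.update_of_ne hl.ne]⟩
  constructor
  · intro j hj z hz
    rw [Function.update_of_ne (by omega)] at hz
    exact hlift z (h.closed j hj z hz)
  · intro z hzm hz
    rw [Function.update_of_ne hi.ne] at hz
    by_cases hzy : z = y
    · exact ⟨cnt, by omega, by rw [Function.update_self, hzy]⟩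
    · refine hlift z (h.current z ?_ hz)
      have : z.val ≠ y.val := fun h => hzy (Fin.ext h)
      omega

theorem ScannedTo.skip {i m : ℕ} (h : ScannedTo T cnt ord i m)
    (hm : ∀ y : Fin N, y.val = m → T.Adj (ord i) y → ∃ l < cnt, ord l = y) :
    ScannedTo T cnt ord i (m + 1) := by
  refine ⟨h.closed, fun z hzm hz => ?_⟩
  rcases Nat.lt_succ_iff_lt_or_eq.1 hzm with hzm | hzm
  · exact h.current z hzm hz
  · exact hm z hzm hz

open Classical in
theorem wp_searchTree (hT : T.Connected) (hN : 0 < N) (hNw : N < 2 ^ w)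
    (h1 : σ.reg 1 = BitVec.ofNat w N)
    (hadj : ∀ x y : Fin N,
      σ.mem 1 (BitVec.ofNat w (x * N + y)) = BitVec.ofNat w (if T.Adj x y then 1 else 0)) :
    wp searchTree (N * (N * 50 + 40) + 60) (fun τ => Keep 6 [4, 5, 6] σ τ ∧
      ∃ (ord : ℕ → Fin N) (par : ℕ → ℕ), par 0 = N ∧ (∀ y, ∃ l < N, ord l = y) ∧
        HoldsOrder T N ord par τ) σ := by
  refine wp.of_le (wp_seq (wp_forUp (T := 5) (fun m τ => Keep 6 [4, 5, 6] σ τ ∧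
    ∀ y : Fin N, y.val < m → τ.mem 4 (BitVec.ofNat w y) = BitVec.ofNat w 0) (by norm_num) hNw h1
    ⟨(Keep.refl σ).setReg (by norm_num) _, fun y hy => absurd hy (by omega)⟩ ?_)
    (T₂ := N * (N * 50 + 22) + 50) ?_) (by nlinarith)
  · rintro m hm τ h20 h1 ⟨hk, hz⟩
    refine wp.of_le (wp_store (Ev.reg h20) (Ev.lit 0) ⟨h20, h1, (hk.setMem (by simp) _ _).setReg
      (by norm_num) _, fun y hy => ?_⟩) (by simp [Expr.cost])
    by_cases hym : y.val = m
    · rw [hym]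
      simp [State.setReg, State.setMem]
    · exact (setMem_mem_ne (by omega) (by omega) hym _).trans (hz y (by omega))
  rintro τ ⟨hk, hz⟩
  have hk₁ : Keep 6 [4, 5, 6] σ (((τ.setReg 21 (BitVec.ofNat w 0)).setReg 20
      (BitVec.ofNat w N)).setReg 7 (BitVec.ofNat w 0)) :=
    ((hk.setReg (by norm_num) _).setReg (by norm_num) _).setReg (by norm_num) _
  have h1τ := (hk.reg 1 (by norm_num)).trans h1
  -- Node 0 becomes the root, with `N` as its parent: a value that is never the number of a node, so
  -- the root is not taken for a child.
  refine wp.of_le (wp_assign_seq (Ev.lit 0) (wp_assign_seq (Ev.reg h1τ) (wp_assign_seq (Ev.lit 0)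
    (wp_seq (wp_appendNode (T := T) (cnt := 0) (ord := fun _ => ⟨0, hN⟩) (par := fun _ => N)
      (i := N) (y := ⟨0, hN⟩) hNw ⟨⟨by omega, by omega, by omega⟩, rfl, fun y => ?_, by omega,
        by omega⟩ hN ⟨fun j hj l hl _ => by omega, by omega, by omega⟩ rfl rfl)
      (T₂ := N * (N * 50 + 22) + 10) ?_)))) (by simp only [Expr.cost]; omega)
  · rw [if_neg (by rintro ⟨l, hl, -⟩; omega)]
    exact hz y y.isLt
  rintro τ₁ ⟨hkτ₁, -, hτ₁⟩
  rw [Function.update_eq_self, Function.update_eq_self] at hτ₁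
  have hk₂ := hk₁.trans hkτ₁
  refine wp.mono (wp_forUp (T := N * 50 + 14) (fun i τ => Keep 6 [4, 5, 6] σ τ ∧
    ∃ (cnt : ℕ) (ord : ℕ → Fin N) (par : ℕ → ℕ), par 0 = N ∧ 0 < cnt ∧ i ≤ cnt ∧
      ScannedTo T cnt ord i 0 ∧ HoldsOrder T cnt ord par τ) (by norm_num) hNw
      ((hk₂.reg 1 (by norm_num)).trans h1)
      ⟨hk₂.setReg (by norm_num) _, 1, _, _, rfl, one_pos, by omega, ⟨by omega, by omega⟩,
        hτ₁.congr rfl rfl⟩ ?_) ?_ (by rw [add_assoc _ 14 8]; omega)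
  · rintro i hi τ h20 h1 ⟨hk, cnt, ord, par, hpar, hcnt, hicnt, hsc, hh⟩
    -- The queue cannot run dry early: if all `cnt` nodes found have been scanned, they are closed
    -- under adjacency, hence all `N` nodes, contrary to `i < N`.
    have hilt : i < cnt := by
      rcases hicnt.lt_or_eq with h | rfl
      · exact h
      · have := le_of_surjOn (surjOn_of_closed hT hcnt hsc.closed)
        omega
    have hordN := (ord i).isLt
    refine wp.of_le (wp_assign_seq (Ev.load (Ev.reg h20) (hh.order i hilt)) (wp.mono
      (wp_forUp (T := 42) (fun m τ' => Keep 6 [4, 5, 6] σ τ' ∧ τ'.reg 20 = BitVec.ofNat w i ∧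
        τ'.reg 22 = BitVec.ofNat w (ord i) ∧ ∃ (cnt' : ℕ) (ord' : ℕ → Fin N) (par' : ℕ → ℕ),
          par' 0 = N ∧ i < cnt' ∧ ord' i = ord i ∧ ScannedTo T cnt' ord' i m ∧
          HoldsOrder T cnt' ord' par' τ') (by norm_num) hNw h1
        ⟨(hk.setReg (by norm_num) _).setReg (by norm_num) _, h20, rfl, cnt, ord, par, hpar, hilt,
          rfl, hsc, hh.congr rfl rfl⟩ ?_) ?_ le_rfl)) (by simp only [Expr.cost]; omega)
    · rintro m hm ρ h21 h1 ⟨hk, h20, h22, cnt', ord', par', hpar', hicnt', hordi, hsc', hh'⟩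
      have hadj' : ρ.mem 1 (BitVec.ofNat w (ord i * N + m)) =
          BitVec.ofNat w (if T.Adj (ord i) ⟨m, hm⟩ then 1 else 0) := by
        rw [hk.mem 1 (by norm_num) (by simp)]; exact hadj (ord i) ⟨m, hm⟩
      have e := Ev.mul (Ev.load (Ev.add (Ev.mul (Ev.reg h22) (Ev.reg h1)) (Ev.reg h21)) hadj')
        (Ev.sub (Ev.lit 1) (Ev.load (Ev.reg h21) (hh'.marks ⟨m, hm⟩)) (ite_one_zero_le _))
      by_cases hnew : T.Adj (ord i) ⟨m, hm⟩ ∧ ¬ ∃ l < cnt', ord' l = ⟨m, hm⟩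
      · rw [if_pos hnew.1, if_neg hnew.2] at e
        have hext := hh'.isSearchOrder.extend hicnt' (hordi ▸ hnew.1)
          fun l hl h => hnew.2 ⟨l, hl, h⟩
        refine wp.of_le (wp_ite_pos e (by norm_num) (by omega) (wp.mono (wp_appendNode hNw hh'
          hext.le hext h20 h21) ?_ le_rfl)) (by simp [Expr.cost, Expr.cost_sub])
        rintro π ⟨hkπ, hrπ, hhπ⟩
        refine ⟨(hrπ 21 (by norm_num)).trans h21, (hrπ 1 (by norm_num)).trans h1,
          (hk.trans hkπ).setReg (by norm_num) _, (hrπ 20 (by norm_num)).trans h20,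
          (hrπ 22 (by norm_num)).trans h22, cnt' + 1, _, _, ?_, by omega, ?_,
          hsc'.extend hicnt' rfl, hhπ.congr rfl rfl⟩
        · rw [Function.update_of_ne (by omega), hpar']
        · rw [Function.update_of_ne (by omega), hordi]
      · have h0 : (if T.Adj (ord i) ⟨m, hm⟩ then 1 else 0) *
            (1 - if ∃ l < cnt', ord' l = ⟨m, hm⟩ then 1 else 0) = 0 := by
          by_cases h1 : T.Adj (ord i) ⟨m, hm⟩
          · rw [if_pos (c := ∃ l < cnt', ord' l = ⟨m, hm⟩) (not_not.1 fun h => hnew ⟨h1, h⟩),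
              Nat.sub_self, mul_zero]
          · rw [if_neg h1, zero_mul]
        rw [h0] at e
        refine wp.of_le (wp_ite_neg e (wp_skip ⟨h21, h1, hk.setReg (by norm_num) _, h20, h22,
          cnt', ord', par', hpar', hicnt', hordi, hsc'.skip fun y hy hadj => ?_,
          hh'.congr rfl rfl⟩)) (by simp [Expr.cost, Expr.cost_sub])
        have : y = ⟨m, hm⟩ := Fin.ext hy
        subst this
        rw [hordi] at hadj
        exact not_not.1 fun h => hnew ⟨hadj, h⟩
    · rintro ρ ⟨hk, h20, -, cnt', ord', par', hpar', hicnt', -, hsc', hh'⟩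
      refine ⟨h20, (hk.reg 1 (by norm_num)).trans ‹σ.reg 1 = _›, hk.setReg (by norm_num) _, cnt',
        ord', par', hpar', by omega, by omega, ⟨fun j hj y hy => ?_, by omega⟩, hh'.congr rfl rfl⟩
      rcases Nat.lt_succ_iff_lt_or_eq.1 hj with hj | rfl
      · exact hsc'.closed j hj y hy
      · exact hsc'.current y y.isLt hy
  · rintro ρ ⟨hk, cnt, ord, par, hpar, hcnt, hicnt, hsc, hh⟩
    have hcN : cnt = N := le_antisymm hh.isSearchOrder.le hicnt
    subst hcN
    exact ⟨hk, ord, par, hpar, surjOn_of_closed hT hcnt hsc.closed, hh⟩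

end Search

end WordRAM

namespace WordRAM

open Polynomial
open _root_.WordRAM.Expr (reg lit load)
open _root_.WordRAM.Program (assign store ite loop)

/-! ### The whole program, its running time and the word length. -/

section Main

variable {w n N : ℕ} {σ : State w} {G : SimpleGraph (Fin n)} {D : TreeDecomposition G (Fin N)}

/-- Counts the dominating sets of all sizes by dynamic programming, with the multiplication
procedure `M`. -/
def countDominatingSets (M : Program) : Program :=
  setGlobals ;; computePlaces ;; searchTree ;; initTables ;; allTables M ;;
  assign 25 (lit 0) ;; assign 26 (lit 5) ;; polyCopy

theorem wp_countDominatingSets {M : Program} {T B : ℕ} (hw : 2 ≤ w) (hn : 0 < n)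
    (hM : MultipliesWithin M w n T) (hT : numWords w n ≤ T) (hnw : n + w < 2 ^ w)
    (hNw : N < 2 ^ w) (hNn : N * n < 2 ^ w) (hB : ∀ x, 3 ^ (D.bag x).card ≤ B)
    (hBw : 2 * B < 2 ^ w) (hK : (5 + N * (N * B)) * (n + 1) * numWords w n < 2 ^ w)
    (hσ : σ.Encodes G D) :
    wp (countDominatingSets M) (n * 25 + 40 + (N * (n * 50 + 40) + 10 + (N * (N * 50 + 40) + 60 +
        ((5 + N * (N * B)) * (n + 1) * numWords w n * 13 + 46 +
          n * ((n + 1) * numWords w n * 240 + 138) +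
        (N * (n * 40 + 50) + B * (N * (N * 20 + (n + 1) * (n + 1) * T * 1800 + 8)) + 6 +
        ((n + 1) * numWords w n * 16 + 60))))))
      (fun τ => ∀ κ ≤ n, τ.Stores 3 (κ * numWords w n) (numWords w n)
        (numDominatingSets G κ)) σ := by
  classical
  have hw0 : 0 < w := by omega
  have hN : 0 < N := by
    obtain ⟨x, -⟩ := D.exists_mem_bag ⟨0, hn⟩
    exact x.pos
  set U : ℕ → Finset (Fin n) := fun x => if h : x < N then D.bag ⟨x, h⟩ else ∅ with hU
  have hUbag : ∀ x : Fin N, U x = D.bag x := fun x => dif_pos x.isLt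
  -- The common row length is the sum of the sizes of all tables, which is simpler to compute than
  -- their maximum. It costs another factor of `N` in space, but clearing that space still fits into
  -- the time bound.
  set S := ∑ x ∈ Finset.range N, 3 ^ (U x).card with hS
  have hSB : S ≤ N * B := by
    refine (Finset.sum_le_card_nsmul _ _ B fun x hx => ?_).trans (by simp)
    rw [Finset.mem_range] at hx
    exact hUbag ⟨x, hx⟩ ▸ hB ⟨x, hx⟩
  have hKle : (5 + N * S) * (n + 1) * numWords w n ≤
      (5 + N * (N * B)) * (n + 1) * numWords w n := by gcongr
  have hKS : (5 + N * S) * (n + 1) * numWords w n < 2 ^ w := hKle.trans_lt hK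
  refine wp_seq (wp_setGlobals hw0 hn hnw hσ.numVertices) ?_
  rintro τ₁ ⟨hk₁, hg₁⟩
  have h1₁ := (hk₁.reg 1 (by norm_num)).trans hσ.numNodes
  refine wp_seq (wp_computePlaces (U := U) (by omega) hNw hNn hg₁.reg_zero h1₁
    fun x hx v => ?_) ?_
  · rw [hk₁.mem 2 (by norm_num) (by simp), ← Fin.val_mk hx, hUbag]
    exact hσ.bags ⟨x, hx⟩ v
  rintro τ₂ ⟨hk₂, h5₂, h7₂, h8₂⟩
  refine wp_seq (wp_searchTree D.isTree.connected hN hNw ((hk₂.reg 1 (by norm_num)).trans h1₁)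
    fun x y => ?_) ?_
  · rw [hk₂.mem 1 (by norm_num) (by simp), hk₁.mem 1 (by norm_num) (by simp)]
    exact hσ.tree x y
  rintro τ₃ ⟨hk₃, ord, par, hpar0, hsurj, hord⟩
  have hpar := hord.isSearchOrder.parent_lt
  set Y : ℕ → Finset (Fin n) := fun j => D.bag (ord j) with hY
  set Z : ℕ → Finset (Fin n) := fun j => if j = 0 then ∅ else Y j ∩ Y (par j) with hZ
  have hk₁₃ : Keep 2 [4, 5, 6, 7, 8] σ τ₃ := ((hk₁.mono (by norm_num) (by simp)).trans
    (hk₂.mono (by norm_num) (by simp))).trans (hk₃.mono (by norm_num) (by simp))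
  have hc : Context G N S Y (fun j => ord j) par τ₃ := by
    refine ⟨(hg₁.keep hk₂ le_rfl).keep hk₃ (by norm_num),
      (hk₁₃.reg 1 (by norm_num)).trans hσ.numNodes, (hk₃.reg 5 (by norm_num)).trans h5₂,
      ?_, ?_, hord.order, hord.parents, ?_, ?_⟩
    · rw [hk₁₃.mem 0 (by norm_num) (by simp)]
      intro u v
      convert hσ.graph u v
    · rw [hk₁₃.mem 2 (by norm_num) (by simp)]
      intro j _ v
      convert hσ.bags (ord j) v
    · rw [hk₃.mem 7 (by norm_num) (by simp)]
      intro j _ v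
      rw [h7₂ (ord j) (ord j).isLt v, hUbag]
    · rw [hk₃.mem 8 (by norm_num) (by simp)]
      intro j _
      rw [h8₂ (ord j) (ord j).isLt, hUbag]
  have hYS : ∀ j < N, 3 ^ (Y j).card ≤ S := fun j _ => by
    have := Finset.single_le_sum (f := fun x => 3 ^ (U x).card) (fun _ _ => Nat.zero_le _)
      (Finset.mem_range.2 (ord j).isLt)
    rwa [hUbag] at this
  refine wp_seq (wp.of_le (wp_initTables hw0 hn (by omega) hc.globals hKS hc.reg_one hc.reg_five)
    (by omega)) ?_
  rintro τ₄ ⟨hk₄, p, hp⟩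
  have hc₄ := hc.keep hk₄ (by norm_num) (by simp)
  obtain ⟨E, hE⟩ := exists_tables G N Y Z par hpar0 hpar
  refine wp_seq (wp_allTables hw hn hKS hM hT hc₄ (by omega) hNw hpar0 hpar (if_pos rfl)
    (fun j hj _ => if_neg hj.ne') hYS (fun j _ => hB (ord j)) hBw E hE hp) ?_
  rintro τ₅ ⟨hk₅, p', P, hP, -, -, -, -, hPE⟩
  have hg₅ := hc₄.globals.keep hk₅ (by norm_num)
  have hk₆ : Keep 9 [] τ₅ ((τ₅.setReg 25 (BitVec.ofNat w 0)).setReg 26 (BitVec.ofNat w 5)) :=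
    ((Keep.refl τ₅).setReg (by norm_num) _).setReg (by norm_num) _
  have hS0 : 0 < S := lt_of_lt_of_le (by positivity) (hYS 0 hN)
  have hNS : 0 < N * S := Nat.mul_pos hN hS0
  refine wp.of_le (wp_assign_seq (Ev.lit 0) (wp_assign_seq (Ev.lit 5) (wp.mono
    (wp_polyCopy (s := 0) (s' := 5) hw0 hn (hg₅.keep hk₆ (by norm_num)) (hP.of_mem_eq rfl) hKS
      (by omega) (by omega) (by norm_num) rfl rfl) ?_ le_rfl))) (by simp only [Expr.cost]; omega)
  rintro τ ⟨-, hτ⟩ κ hκ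
  -- The separator of the root is empty, so the answer is the entry 0 of row 0, which is slot 5.
  have hres := table_eq (ZMod (2 ^ n)) G hN (X := Y) (S := Z) (par := par) hpar0.ge hpar
    (if_pos rfl) (fun j hj _ => if_neg hj.ne')
    (fun i j hij hj => D.inter_subset_parent hord.isSearchOrder hij hj)
    (fun v => ?_) (fun u v huv => ?_) E (fun j hj r => (hE j hj r).trans ?_)
  · have hcoeff : (P 5).coeff κ = (numDominatingSets G κ : ZMod (2 ^ n)) := by
      have h5 := hPE 0 hN 0 hS0
      rw [zero_mul, add_zero, add_zero, hres] at h5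
      rw [h5, ← coeff_sum_isDominatingSet (ZMod (2 ^ n)) G κ]
    have hlt := numDominatingSets_lt hn G κ
    refine ⟨hlt.trans_le (Nat.pow_le_pow_right (by norm_num) (le_mul_numWords hw0)),
      fun j hj => ?_⟩
    have h := hτ κ (by
      have := Nat.mul_le_mul_right (n + 1) (show 1 ≤ 5 + N * S by omega)
      omega) j hj
    rw [h]
    beta_reduce
    rw [Nat.div_eq_of_lt (show κ < n + 1 by omega), Nat.mod_eq_of_lt (show κ < n + 1 by omega),
      Function.update_self, hcoeff, ZMod.val_natCast, Nat.mod_eq_of_lt hlt]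
  · obtain ⟨x, hx⟩ := D.exists_mem_bag v
    obtain ⟨j, hj, rfl⟩ := hsurj x
    exact ⟨j, hj, hx⟩
  · obtain ⟨x, hx⟩ := D.exists_adj_mem_bag u v huv
    obtain ⟨j, hj, rfl⟩ := hsurj x
    exact ⟨j, hj, hx⟩
  · refine Finset.sum_congr rfl fun c _ => ?_
    rw [tableTerm]

theorem time_le {n N a L T z : ℕ} (hn : 0 < n) (hN : N ≤ a * n) (hL : L ≤ T) (hT : 0 < T)
    (hz : 0 < z) :
    n * 25 + 40 + (N * (n * 50 + 40) + 10 + (N * (N * 50 + 40) + 60 +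
        ((5 + N * (N * (3 * z))) * (n + 1) * L * 13 + 46 + n * ((n + 1) * L * 240 + 138) +
        (N * (n * 40 + 50) + 3 * z * (N * (N * 20 + (n + 1) * (n + 1) * T * 1800 + 8)) + 6 +
        ((n + 1) * L * 16 + 60))))) ≤
      (2000 + 30000 * a + 1000 * (a * a)) * (n ^ 3 * z * T) := by
  have h1 : n + 1 ≤ 2 * n := by omega
  -- Since `n`, `z` and `T` are positive, every monomial that occurs is dominated by the leading
  -- one. The factor `z` stands for `3 ^ k`, and the 3 next to it for the remaining vertex of a
  -- largest bag.
  have key : ∀ i j l : ℕ, i ≤ 3 → j ≤ 1 → l ≤ 1 → n ^ i * z ^ j * T ^ l ≤ n ^ 3 * z * T := by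
    intro i j l hi hj hl
    have h2 := Nat.pow_le_pow_right hn hi
    have h3 := Nat.pow_le_pow_right hz hj
    have h4 := Nat.pow_le_pow_right hT hl
    rw [pow_one] at h3 h4
    gcongr
  calc _ ≤ n * 25 + 40 + (a * n * (n * 50 + 40) + 10 + (a * n * (a * n * 50 + 40) + 60 +
        ((5 + a * n * (a * n * (3 * z))) * (2 * n) * T * 13 + 46 + n * ((2 * n) * T * 240 + 138) +
        (a * n * (n * 40 + 50) +
          3 * z * (a * n * (a * n * 20 + (2 * n) * (2 * n) * T * 1800 + 8)) + 6 +
        ((2 * n) * T * 16 + 60))))) := by gcongr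
    _ ≤ _ := by
      set F := n ^ 3 * z * T with hF
      have k0 := key 0 0 0 (by norm_num) (by norm_num) (by norm_num)
      have k1 := key 1 0 0 (by norm_num) (by norm_num) (by norm_num)
      have k2 := key 2 0 0 (by norm_num) (by norm_num) (by norm_num)
      have k3 := key 1 0 1 (by norm_num) (by norm_num) (by norm_num)
      have k4 := key 2 0 1 (by norm_num) (by norm_num) (by norm_num)
      have k5 := key 1 1 0 (by norm_num) (by norm_num) (by norm_num)
      have k6 := key 2 1 0 (by norm_num) (by norm_num) (by norm_num)
      have a1 := Nat.mul_le_mul_left a k1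
      have a2 := Nat.mul_le_mul_left a k2
      have a5 := Nat.mul_le_mul_left a k5
      have b2 := Nat.mul_le_mul_left (a * a) k2
      have b6 := Nat.mul_le_mul_left (a * a) k6
      have e1 : a * F = a * (n ^ 3 * z * T) := rfl
      have e2 : a * a * F = a * a * (n ^ 3 * z * T) := rfl
      have a0 : 0 ≤ a * F := Nat.zero_le _
      have b0 : 0 ≤ a * a * F := Nat.zero_le _
      nlinarith

/-- A vertex exists and lies in some bag, so the 1 subtracted in the width is really subtracted. -/
theorem card_bag_le (hn : 0 < n) (x : Fin N) : (D.bag x).card ≤ D.width + 1 := by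
  have h : ∀ y, (D.bag y).card ≤ Finset.univ.sup fun x => (D.bag x).card := fun y =>
    Finset.le_sup (f := fun x => (D.bag x).card) (Finset.mem_univ y)
  obtain ⟨y, hy⟩ := D.exists_mem_bag ⟨0, hn⟩
  have h1 := h y
  have h2 := Finset.card_pos.2 ⟨_, hy⟩
  have := h x
  unfold TreeDecomposition.width
  omega

/-- With `X = 2 ^ (k + 1 + log n)` everything is at most a power of `X`: `n + 1 ≤ X`, `3 ^ (k + 1) ≤
X ^ 2` and `a ≤ X ^ a`. The largest quantity, the size of array 3, is at most `X ^ (2 * a + 9)`,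
while `2 ^ w` is at least `X ^ (2 * a + 20)`. -/
theorem sizes_le {n N a k w L : ℕ} (hN : N ≤ a * n) (hL : L ≤ n)
    (hw : (2 * a + 20) * (k + 1 + Nat.log 2 n) ≤ w) :
    2 ≤ w ∧ n + w < 2 ^ w ∧ N < 2 ^ w ∧ N * n < 2 ^ w ∧ 2 * 3 ^ (k + 1) < 2 ^ w ∧
      (5 + N * (N * 3 ^ (k + 1))) * (n + 1) * L < 2 ^ w := by
  set m := k + 1 + Nat.log 2 n with hm
  have hmw : 20 * m ≤ w := le_trans (Nat.mul_le_mul_right _ (by omega)) hw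
  set X := 2 ^ m with hX
  have hX2 : 2 ≤ X := by
    calc 2 = 2 ^ 1 := rfl
      _ ≤ 2 ^ m := Nat.pow_le_pow_right (by norm_num) (by omega)
  have hX0 : 0 < X := by omega
  have hnX : n + 1 ≤ X := by
    calc n + 1 ≤ 2 ^ (Nat.log 2 n + 1) := Nat.lt_pow_succ_log_self (by norm_num) n
      _ ≤ 2 ^ m := Nat.pow_le_pow_right (by norm_num) (by omega)
  have h3 : 3 ^ (k + 1) ≤ X ^ 2 := by
    calc 3 ^ (k + 1) ≤ 4 ^ (k + 1) := Nat.pow_le_pow_left (by norm_num) _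
      _ ≤ 4 ^ m := Nat.pow_le_pow_right (by norm_num) (by omega)
      _ = X ^ 2 := by rw [hX, ← pow_mul, mul_comm, pow_mul]; norm_num
  have ha : a ≤ X ^ a := (Nat.lt_pow_self (by norm_num : 1 < 2)).le.trans
    (Nat.pow_le_pow_left hX2 a)
  have hNX : N ≤ X ^ (a + 1) := by
    calc N ≤ a * n := hN
      _ ≤ X ^ a * X := Nat.mul_le_mul ha (by omega)
      _ = X ^ (a + 1) := (pow_succ _ _).symm
  have hXw : X ^ (2 * a + 20) ≤ 2 ^ w := by
    rw [hX, ← pow_mul, mul_comm]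
    exact Nat.pow_le_pow_right (by norm_num) hw
  have hlt : ∀ i < 2 * a + 20, X ^ i < 2 ^ w := fun i hi =>
    (Nat.pow_lt_pow_right (by omega) hi).trans_le hXw
  refine ⟨by omega, ?_, hNX.trans_lt (hlt _ (by omega)), ?_, ?_, ?_⟩
  · have h1 : 2 ^ w = 2 * 2 ^ (w - 1) := by
      rw [← pow_succ']; congr 1; omega
    have h2 : w - 1 < 2 ^ (w - 1) := Nat.lt_pow_self (by norm_num)
    have h3 : X ≤ 2 ^ (w - 1) := Nat.pow_le_pow_right (by norm_num) (by omega)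
    omega
  · calc N * n ≤ X ^ (a + 1) * X := Nat.mul_le_mul hNX (by omega)
      _ = X ^ (a + 2) := (pow_succ _ _).symm
      _ < 2 ^ w := hlt _ (by omega)
  · calc 2 * 3 ^ (k + 1) ≤ X * X ^ 2 := Nat.mul_le_mul hX2 h3
      _ = X ^ 3 := (pow_succ' _ _).symm
      _ < 2 ^ w := hlt _ (by omega)
  · have h5 : 5 ≤ X ^ (2 * a + 4) * 5 := Nat.le_mul_of_pos_left _ (by positivity)
    calc (5 + N * (N * 3 ^ (k + 1))) * (n + 1) * L
        ≤ (X ^ (2 * a + 4) * 5 + X ^ (a + 1) * (X ^ (a + 1) * X ^ 2)) * X * X := by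
          gcongr
          omega
      _ = 6 * X ^ (2 * a + 6) := by ring
      _ ≤ X ^ 3 * X ^ (2 * a + 6) := Nat.mul_le_mul_right _ (by
          calc 6 ≤ 2 ^ 3 := by norm_num
            _ ≤ X ^ 3 := Nat.pow_le_pow_left hX2 3)
      _ = X ^ (2 * a + 9) := by ring
      _ < 2 ^ w := hlt _ (by omega)

end Main

end WordRAM

theorem mainTheorem1 (mulTime : ℕ → ℕ → ℕ) (hmul : WordRAM.IsMultiplicationTime mulTime) :
    ∃ P : WordRAM.Program, ∀ a : ℕ, ∃ C c : ℕ,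
      ∀ (n N : ℕ) (G : SimpleGraph (Fin n)) (D : TreeDecomposition G (Fin N))
        (w : ℕ) (σ : WordRAM.State w),
        0 < n → N ≤ a * n → c * (D.width + 1 + Nat.log 2 n) ≤ w → σ.Encodes G D →
        ∃ (σ' : WordRAM.State w) (t : ℕ), WordRAM.Run P σ σ' t ∧
          t ≤ C * (n ^ 3 * 3 ^ D.width * mulTime w n) ∧
          ∀ κ ≤ n, σ'.Stores 3 (κ * WordRAM.numWords w n) (WordRAM.numWords w n)
            (numDominatingSets G κ) := by
  obtain ⟨M, cM, hM⟩ := hmul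
  refine ⟨WordRAM.countDominatingSets M, fun a => ⟨2000 + 30000 * a + 1000 * (a * a),
    cM + (2 * a + 20), fun n N G D w σ hn hN hw hσ => ?_⟩⟩
  rw [Nat.add_mul] at hw
  have hwa : (2 * a + 20) * (D.width + 1 + Nat.log 2 n) ≤ w := by omega
  have hw2 : 2 ≤ w := (WordRAM.sizes_le (L := 0) (k := D.width) hN (Nat.zero_le n) hwa).1
  have hL0 := WordRAM.numWords_pos (w := w) (n := n) (by omega) hn
  have hLn := WordRAM.numWords_le (w := w) (n := n) (by omega) hn
  obtain ⟨-, h1, h2, h3, h4, h5⟩ := WordRAM.sizes_le (k := D.width) hN hLn hwa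
  have hmulW : WordRAM.MultipliesWithin M w n (mulTime w n) := fun x y ρ hx hy h0 hsx hsy =>
    hM w n x y ρ hn (by
      have := Nat.mul_le_mul_left cM (show Nat.log 2 n + 1 ≤ D.width + 1 + Nat.log 2 n by omega)
      omega) hx hy h0 hsx hsy
  -- Nothing is assumed about the size of `mulTime`; that it is at least linear in the number of
  -- words, and in particular positive, is a consequence of `hmul`.
  have h2L : 2 * WordRAM.numWords w n ≤ mulTime w n := by
    refine WordRAM.two_mul_numWords_le_of_mul (by omega) ?_ hmulW
    have : (5 + N * (N * 3 ^ (D.width + 1))) * 1 * WordRAM.numWords w n ≤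
        (5 + N * (N * 3 ^ (D.width + 1))) * (n + 1) * WordRAM.numWords w n := by
      gcongr
      omega
    have := Nat.mul_le_mul_right (WordRAM.numWords w n)
      (show 2 ≤ (5 + N * (N * 3 ^ (D.width + 1))) * 1 by omega)
    omega
  obtain ⟨σ', t, hr, ht, hs⟩ := WordRAM.wp_countDominatingSets (B := 3 ^ (D.width + 1)) hw2 hn
    hmulW (by omega) h1 h2 h3
    (fun x => Nat.pow_le_pow_right (by norm_num) (WordRAM.card_bag_le hn x)) h4 h5 hσ
  refine ⟨σ', t, hr, ht.trans ?_, hs⟩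
  -- Splits `3 ^ (width + 1)` into `3 * 3 ^ width`, the form expected by `time_le`.
  rw [pow_succ']
  exact WordRAM.time_le hn hN (by omega) (by omega) (by positivity)
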